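/- \textbf{Conventions.} A \emph{locally convex algebra} is a complete Hausdorff locally convex complex vector space which is an associative (not necessarily unital) algebra with jointly continuous multiplication; morphisms are continuous algebra homomorphisms, and $\otimes_\pi$ is the completed projective tensor product. An extension $0\to B\xrightarrow{\iota} D\xrightarrow{\pi}A\to 0$ of locally convex algebras ($\iota$ a homeomorphism onto $\ker\pi$) is \emph{split} if $\pi$ has a right inverse which is a morphism. A functor $H$ from locally convex algebras to abelian groups is \begin{itemize} \item \emph{split exact} if for every split extension $0\to B\to D\to A\to 0$ the sequence $0\to H(B)\to H(D)\to H(A)\to 0$ is exact; \item \emph{diffotopy invariant} if $H(ev_0)\circ H(\varphi)=H(ev_1)\circ H(\varphi)$ for all morphisms $\varphi:A\to \mathcal Z B$, where $\mathcal ZB$ is the algebra of smooth functions $[0,1]\to B$ all of whose derivatives vanish at $0$ and at $1$, with the topology of uniform convergence of all derivatives; \item \emph{$\mathcal L^p$-stable} if, for a fixed projection $e\in\mathcal L^p$ of rank one, the stabilisation map $\theta_A=H(a\mapsto a\otimes e):H(A)\to H(A\otimes_\pi\mathcal L^p)$ is an isomorphism for every $A$. \end{itemize} Let $\hat B$ be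 an algebra containing a locally convex algebra $B$ as a subalgebra. A \emph{quasihomomorphism} $(\alpha,\bar\alpha):A\rightrightarrows\hat B\trianglerighteq B$ is a pair of homomorphisms $A\to\hat B$ such that $a\mapsto\alpha(a)-\bar\alpha(a)$, $(a,b)\mapsto\alpha(a)b$ and $(b,a)\mapsto b\alpha(a)$ ($a\in A$, $b\in B$) are $B$-valued and continuous as maps to $B$. Let $D_\alpha=A\oplus B$ with the product topology and the multiplication $(a,b)(a',b')=(aa',\alpha(a)b'+b\alpha(a')+bb')$; it is a split extension of $A$ by $B$ with $\iota(b)=(0,b)$ and the two splittings $\alpha'(a)=(a,0)$ and $\bar\alpha'(a)=(a,\bar\alpha(a)-\alpha(a))$. For a split exact functor $H$ and a locally convex algebra $C$, set $$H((\alpha,\bar\alpha)\otimes_\pi C)=H(\iota\otimes C)^{-1}\circ\big(H(\alpha'\otimes C)-H(\bar\alpha'\otimes C)\big):H(A\otimes_\pi C)\to H(B\otimes_\pi C).$$ A \emph{locally convex Kasparov $(A,B)$-module} $(\hat B,\phi,F)$ with grading $\varepsilon$ consists of a unital algebra $\hat B\supseteq B$, elements $\varepsilon,F\in\hat B$ and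 a homomorphism $\phi:A\to\hat B$ with $\varepsilon^2=1$, $F\varepsilon=-\varepsilon F$, $[\phi(a),\varepsilon]=0$, such that the maps $b\mapsto bF,\,Fb,\,\varepsilon b,\,b\varepsilon$; $(a,b)\mapsto\phi(a)b,\,b\phi(a)$; $a\mapsto\phi(a)(1-F^2),\,(1-F^2)\phi(a),\,[\phi(a),F]$ are $B$-valued and continuous as maps to $B$. With $P=\frac12(1+\varepsilon)$, $P^\perp=1-P$ and $W=\varepsilon(1-F^2)+PF+P^\perp F(2-F^2)$ one has $W^2=1$, and $Qh(\hat B,\phi,F)=(P\phi,\;WP^\perp\phi W):A\rightrightarrows\hat B\trianglerighteq B$ is a quasihomomorphism. \textbf{Proposition.} Let $\mathcal H$ be a complex Hilbert space, $p\ge 1$ a real number, $\mathcal L^p=\mathcal L^p(\mathcal H)$ the Schatten class, and $(B(\mathcal H),\phi,F)$ a locally convex Kasparov $(\mathbb C,\mathcal L^p)$-module with grading $\varepsilon$. Then $F$, viewed as an odd operator on $\phi(1)\mathcal H=P\phi(1)\mathcal H\oplus P^\perp\phi(1)\mathcal H$, is Fredholm from the even to the odd part, i.e. the operator $$P\phi(1)\mathcal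 H\to P^\perp\phi(1)\mathcal H,\qquad x\mapsto\phi(1)Fx,$$ is Fredholm; let $n$ be its Fredholm index. If $H$ is a split exact, diffotopy invariant and $\mathcal L^p$-stable functor from locally convex algebras to abelian groups, then for every locally convex algebra $A$ $$H\big(Qh(B(\mathcal H),\phi,F)\otimes_\pi A\big)=n\,\theta_A:\;H(A)\to H(A\otimes_\pi\mathcal L^p),$$ where $\mathbb C\otimes_\pi A$ is identified with $A$, and $\mathcal L^p\otimes_\pi A$ with $A\otimes_\pi\mathcal L^p$ by the flip. -/

import Mathlib

open CategoryTheory Topology Filter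
open scoped TensorProduct ENNReal

universe w

set_option linter.unusedSectionVars false

noncomputable section

/-! ## Locally convex algebras -/

/-- A locally convex algebra: a complete Hausdorff locally convex complex vector space which is an
associative, not necessarily unital algebra with jointly continuous multiplication. -/
class IsLCAlg (A : Type*) [NonUnitalRing A] [Module ℂ A] [UniformSpace A] : Prop extends
    IsUniformAddGroup A, ContinuousSMul ℂ A, LocallyConvexSpace ℝ A, T2Space A, CompleteSpace A,
    ContinuousMul A, IsScalarTower ℂ A A, SMulCommClass ℂ A A

/-- Morphisms of locally convex algebras: continuous complex algebra homomorphisms, no condition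
on units. -/
structure LCHom (A B : Type*) [NonUnitalRing A] [Module ℂ A] [UniformSpace A]
    [NonUnitalRing B] [Module ℂ B] [UniformSpace B] extends A →ₙₐ[ℂ] B where
  cont : Continuous toFun

namespace LCHom

variable {A B C : Type*} [NonUnitalRing A] [Module ℂ A] [UniformSpace A]
  [NonUnitalRing B] [Module ℂ B] [UniformSpace B] [NonUnitalRing C] [Module ℂ C] [UniformSpace C]

instance : FunLike (LCHom A B) A B where
  coe f := f.toFun
  coe_injective f g h := by
    cases f; cases g; congr 1; exact DFunLike.coe_injective h

instance : NonUnitalAlgHomClass (LCHom A B) ℂ A B where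
  map_smulₛₗ f := f.map_smul'
  map_add f := f.map_add'
  map_zero f := f.map_zero'
  map_mul f := f.map_mul'

theorem continuous (f : LCHom A B) : Continuous f := f.cont

@[ext] theorem ext {f g : LCHom A B} (h : ∀ x, f x = g x) : f = g := DFunLike.ext _ _ h

def id (A : Type*) [NonUnitalRing A] [Module ℂ A] [UniformSpace A] : LCHom A A where
  __ := NonUnitalAlgHom.id ℂ A
  cont := continuous_id

def comp (g : LCHom B C) (f : LCHom A B) : LCHom A C where
  __ := g.toNonUnitalAlgHom.comp f.toNonUnitalAlgHom
  cont := g.cont.comp f.cont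

@[simp] theorem id_apply (x : A) : LCHom.id A x = x := rfl
@[simp] theorem comp_apply (g : LCHom B C) (f : LCHom A B) (x : A) : g.comp f x = g (f x) := rfl

/-- The underlying continuous linear map. -/
def toCLM (f : LCHom A B) : A →L[ℂ] B where
  toFun := f
  map_add' := f.map_add'
  map_smul' := f.map_smul'
  cont := f.cont

@[simp] theorem toCLM_apply (f : LCHom A B) (x : A) : f.toCLM x = f x := rfl

/-- A multiplicative continuous linear map as a morphism. -/
def ofCLM (f : A →L[ℂ] B) (h : ∀ x y, f (x * y) = f x * f y) : LCHom A B where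
  toFun := f
  map_smul' := f.map_smul
  map_zero' := f.map_zero
  map_add' := f.map_add
  map_mul' := h
  cont := f.continuous

@[simp] theorem ofCLM_apply (f : A →L[ℂ] B) (h) (x : A) : ofCLM f h x = f x := rfl

end LCHom

/-- The category of locally convex algebras. -/
structure LCAlg : Type 1 where
  carrier : Type
  [ring : NonUnitalRing carrier]
  [module : Module ℂ carrier]
  [unif : UniformSpace carrier]
  [isLC : IsLCAlg carrier]

namespace LCAlg

instance : CoeSort LCAlg Type := ⟨LCAlg.carrier⟩

attribute [instance] LCAlg.ring LCAlg.module LCAlg.unif LCAlg.isLC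

/-- Bundle a locally convex algebra. -/
abbrev of (A : Type) [NonUnitalRing A] [Module ℂ A] [UniformSpace A] [IsLCAlg A] : LCAlg :=
  ⟨A⟩

instance : Category LCAlg where
  Hom A B := LCHom A B
  id A := LCHom.id A
  comp f g := LCHom.comp g f

/-- A morphism of locally convex algebras, as an arrow of the category. -/
abbrev ofHom {A B : LCAlg} (f : LCHom A B) : A ⟶ B := f

end LCAlg

instance : IsLCAlg ℂ where

/-! ## The completed projective tensor product -/

section Seminorms

variable {A B C : Type*} [AddCommGroup A] [Module ℂ A] [AddCommGroup B] [Module ℂ B]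
  [AddCommGroup C] [Module ℂ C]

/-- The values `∑ p (vᵢ) q (wᵢ)` over all representations `x = ∑ vᵢ ⊗ wᵢ`. -/
def projValues (p : Seminorm ℂ A) (q : Seminorm ℂ B) (x : A ⊗[ℂ] B) : Set ℝ :=
  {c | ∃ l : List (A × B), x = (l.map fun y => y.1 ⊗ₜ[ℂ] y.2).sum ∧
    c = (l.map fun y => p y.1 * q y.2).sum}

theorem projValues_nonneg {p : Seminorm ℂ A} {q : Seminorm ℂ B} {x : A ⊗[ℂ] B} {c : ℝ}
    (h : c ∈ projValues p q x) : 0 ≤ c := by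
  obtain ⟨l, -, rfl⟩ := h
  refine List.sum_nonneg fun y hy => ?_
  obtain ⟨z, -, rfl⟩ := List.mem_map.1 hy
  positivity

theorem projValues_bddBelow (p : Seminorm ℂ A) (q : Seminorm ℂ B) (x : A ⊗[ℂ] B) :
    BddBelow (projValues p q x) := ⟨0, fun _ h => projValues_nonneg h⟩

theorem projValues_nonempty (p : Seminorm ℂ A) (q : Seminorm ℂ B) (x : A ⊗[ℂ] B) :
    (projValues p q x).Nonempty := by
  induction x using TensorProduct.induction_on with
  | zero => exact ⟨0, [], by simp⟩
  | tmul a b => exact ⟨_, [(a, b)], by simp, rfl⟩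
  | add x y hx hy =>
    obtain ⟨_, l, hl, -⟩ := hx
    obtain ⟨_, m, hm, -⟩ := hy
    exact ⟨_, l ++ m, by simp [hl, hm], rfl⟩

/-- The seminorm `p ⊙ q` on the algebraic tensor product:
`(p ⊙ q) x = inf {∑ p (vᵢ) q (wᵢ) | x = ∑ vᵢ ⊗ wᵢ}`. -/
def projSeminorm (p : Seminorm ℂ A) (q : Seminorm ℂ B) : Seminorm ℂ (A ⊗[ℂ] B) :=
  Seminorm.ofSMulLE (fun x => sInf (projValues p q x))
    (le_antisymm (csInf_le (projValues_bddBelow p q 0) ⟨[], by simp⟩)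
      (Real.sInf_nonneg fun _ h => projValues_nonneg h))
    (fun x y => by
      refine le_of_forall_pos_le_add fun ε hε => ?_
      obtain ⟨_, ⟨l, hl, rfl⟩, hx⟩ := Real.lt_sInf_add_pos (projValues_nonempty p q x) (half_pos hε)
      obtain ⟨_, ⟨m, hm, rfl⟩, hy⟩ := Real.lt_sInf_add_pos (projValues_nonempty p q y) (half_pos hε)
      have : sInf (projValues p q (x + y)) ≤ _ :=
        csInf_le (projValues_bddBelow p q (x + y)) ⟨l ++ m, by simp [← hl, ← hm], rfl⟩
      rw [List.map_append, List.sum_append] at this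
      linarith)
    (fun r x => by
      refine le_of_forall_pos_le_add fun ε hε => ?_
      have hr : 0 < ‖r‖ + 1 := by positivity
      obtain ⟨_, ⟨l, hl, rfl⟩, hx⟩ :=
        Real.lt_sInf_add_pos (projValues_nonempty p q x) (div_pos hε hr)
      have : sInf (projValues p q (r • x)) ≤ ‖r‖ * (l.map fun y => p y.1 * q y.2).sum := by
        refine csInf_le (projValues_bddBelow p q _) ⟨l.map fun y => (r • y.1, y.2), ?_, ?_⟩
        · rw [hl, List.smul_sum]; simp [Function.comp_def, TensorProduct.smul_tmul']
        · simp [Function.comp_def, map_smul_eq_mul, mul_assoc, List.sum_map_mul_left]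
      refine this.trans ((mul_le_mul_of_nonneg_left hx.le (norm_nonneg r)).trans ?_)
      rw [mul_add]
      gcongr
      rw [mul_div_assoc', div_le_iff₀ hr]
      nlinarith)

theorem projSeminorm_tmul_le (p : Seminorm ℂ A) (q : Seminorm ℂ B) (a : A) (b : B) :
    projSeminorm p q (a ⊗ₜ b) ≤ p a * q b :=
  csInf_le (projValues_bddBelow p q _) ⟨[(a, b)], by simp, by simp⟩

/-- `p ⊙ q` is the largest seminorm with `(p ⊙ q) (a ⊗ b) ≤ p a * q b`. -/
theorem le_projSeminorm (p : Seminorm ℂ A) (q : Seminorm ℂ B) (r : Seminorm ℂ (A ⊗[ℂ] B))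
    {K : ℝ} (hK : 0 ≤ K) (h : ∀ a b, r (a ⊗ₜ b) ≤ K * (p a * q b)) (x : A ⊗[ℂ] B) :
    r x ≤ K * projSeminorm p q x := by
  have key : ∀ l : List (A × B), r (l.map fun y => y.1 ⊗ₜ[ℂ] y.2).sum ≤
      K * (l.map fun y => p y.1 * q y.2).sum := by
    intro l
    induction l with
    | nil => simp
    | cons y l ih =>
      simp only [List.map_cons, List.sum_cons, mul_add]
      exact (map_add_le_add r _ _).trans (add_le_add (h _ _) ih)
  refine le_of_forall_pos_le_add fun ε hε => ?_
  have hr : 0 < K + 1 := by positivity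
  obtain ⟨_, ⟨l, hl, rfl⟩, hx⟩ := Real.lt_sInf_add_pos (projValues_nonempty p q x) (div_pos hε hr)
  rw [hl]
  refine (key l).trans ((mul_le_mul_of_nonneg_left hx.le hK).trans ?_)
  rw [mul_add, ← hl]
  change K * projSeminorm p q x + _ ≤ _
  gcongr
  rw [mul_div_assoc', div_le_iff₀ hr]
  nlinarith

theorem polynormable_of_locallyConvex (A : Type*) [AddCommGroup A] [Module ℂ A]
    [TopologicalSpace A] [IsTopologicalAddGroup A] [ContinuousSMul ℂ A]
    [LocallyConvexSpace ℝ A] : PolynormableSpace ℂ A := by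
  open scoped ComplexOrder in
  have : ContinuousSMul ℝ A := IsScalarTower.continuousSMul ℂ
  have : LocallyConvexSpace ℂ A :=
    LocallyConvexSpace.ofBasisZero ℂ A _ _ (LocallyConvexSpace.convex_basis_zero ℝ A)
      fun s hs => convex_of_nonneg_surjective_algebraMap _
        (fun _ h => RCLike.nonneg_iff_exists_ofReal.mp h) hs.2
  infer_instance

/-- Unit balls of continuous seminorms form a neighbourhood basis of zero. -/
theorem exists_seminorm_lt_one [TopologicalSpace A] [IsTopologicalAddGroup A] [ContinuousSMul ℂ A]
    [LocallyConvexSpace ℝ A] {U : Set A} (hU : U ∈ 𝓝 0) :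
    ∃ p : Seminorm ℂ A, Continuous p ∧ ∀ a, p a < 1 → a ∈ U := by
  obtain ⟨⟨s, ε⟩, hε, hs⟩ :=
    (polynormable_of_locallyConvex A).withSeminorms'.hasBasis_zero_ball.mem_iff.1 hU
  set P : Seminorm ℂ A := s.sup fun p : {p : Seminorm ℂ A // Continuous p} => p.1 with hP
  have hc : Continuous P := by
    clear hs hε
    rw [hP]
    clear_value P
    clear hP
    induction s using Finset.cons_induction with
    | empty => exact (continuous_const : Continuous fun _ : A => (0 : ℝ))
    | cons a t ha ih =>
      rw [Finset.sup_cons]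
      exact a.2.sup ih
  refine ⟨Real.toNNReal ε⁻¹ • P, hc.const_smul (Real.toNNReal ε⁻¹), fun a ha => hs ?_⟩
  · rw [Seminorm.mem_ball_zero]
    have h : (Real.toNNReal ε⁻¹ : ℝ) * P a < 1 := ha
    rw [Real.coe_toNNReal _ (by positivity)] at h
    rwa [inv_mul_lt_iff₀ hε, mul_one] at h

/-- A continuous bilinear map into a locally convex space is bounded by products of continuous
seminorms. -/
theorem exists_seminorm_bound [TopologicalSpace A] [IsTopologicalAddGroup A] [ContinuousSMul ℂ A]
    [LocallyConvexSpace ℝ A] [TopologicalSpace B] [IsTopologicalAddGroup B] [ContinuousSMul ℂ B]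
    [LocallyConvexSpace ℝ B] [TopologicalSpace C]
    (f : A →ₗ[ℂ] B →ₗ[ℂ] C) (hf : Continuous fun x : A × B => f x.1 x.2)
    (r : Seminorm ℂ C) (hr : Continuous r) :
    ∃ p : Seminorm ℂ A, Continuous p ∧ ∃ q : Seminorm ℂ B, Continuous q ∧
      ∀ a b, r (f a b) ≤ p a * q b := by
  have hU : {x : A × B | r (f x.1 x.2) < 1} ∈ 𝓝 ((0, 0) : A × B) :=
    (isOpen_lt (hr.comp hf) continuous_const).mem_nhds (by simp)
  rw [nhds_prod_eq, mem_prod_iff] at hU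
  obtain ⟨U, hU, V, hV, hUV⟩ := hU
  obtain ⟨p, hp, hpU⟩ := exists_seminorm_lt_one hU
  obtain ⟨q, hq, hqV⟩ := exists_seminorm_lt_one hV
  refine ⟨p, hp, q, hq, fun a b => ?_⟩
  have key : ∀ δ : ℝ, 0 < δ → r (f a b) ≤ (p a + δ) * (q b + δ) := by
    intro δ hδ
    have hs : 0 < p a + δ := by positivity
    have ht : 0 < q b + δ := by positivity
    have h1 : p (((p a + δ)⁻¹ : ℝ) • a) < 1 := by
      rw [← Complex.coe_smul, map_smul_eq_mul, Complex.norm_real, Real.norm_of_nonneg (by positivity),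
        inv_mul_lt_iff₀ hs]
      linarith
    have h2 : q (((q b + δ)⁻¹ : ℝ) • b) < 1 := by
      rw [← Complex.coe_smul, map_smul_eq_mul, Complex.norm_real, Real.norm_of_nonneg (by positivity),
        inv_mul_lt_iff₀ ht]
      linarith
    have h3 : r (f (((p a + δ)⁻¹ : ℝ) • a) (((q b + δ)⁻¹ : ℝ) • b)) < 1 :=
      hUV (Set.mk_mem_prod (hpU _ h1) (hqV _ h2))
    rw [← Complex.coe_smul, ← Complex.coe_smul, LinearMap.map_smul, LinearMap.map_smul,
      LinearMap.smul_apply,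
      map_smul_eq_mul, map_smul_eq_mul, Complex.norm_real, Complex.norm_real,
      Real.norm_of_nonneg (by positivity), Real.norm_of_nonneg (by positivity),
      inv_mul_lt_iff₀ ht, inv_mul_lt_iff₀ hs] at h3
    nlinarith
  have hlim : Tendsto (fun δ : ℝ => (p a + δ) * (q b + δ)) (𝓝[>] 0) (𝓝 ((p a + 0) * (q b + 0))) :=
    (Continuous.tendsto (by fun_prop) 0).mono_left nhdsWithin_le_nhds
  rw [add_zero, add_zero] at hlim
  exact ge_of_tendsto hlim (eventually_mem_nhdsWithin.mono fun δ hδ => key δ hδ)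

end Seminorms

/-- The algebraic tensor product with the projective topology. -/
def AlgTensor (A B : Type*) [NonUnitalRing A] [Module ℂ A] [NonUnitalRing B] [Module ℂ B] :
    Type _ := A ⊗[ℂ] B

namespace AlgTensor

variable (A B : Type*) [NonUnitalRing A] [Module ℂ A] [UniformSpace A] [IsLCAlg A]
  [NonUnitalRing B] [Module ℂ B] [UniformSpace B] [IsLCAlg B]

instance : NonUnitalRing (AlgTensor A B) := inferInstanceAs (NonUnitalRing (A ⊗[ℂ] B))
instance : Module ℂ (AlgTensor A B) := inferInstanceAs (Module ℂ (A ⊗[ℂ] B))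
instance : IsScalarTower ℂ (AlgTensor A B) (AlgTensor A B) :=
  inferInstanceAs (IsScalarTower ℂ (A ⊗[ℂ] B) (A ⊗[ℂ] B))
instance : SMulCommClass ℂ (AlgTensor A B) (AlgTensor A B) :=
  inferInstanceAs (SMulCommClass ℂ (A ⊗[ℂ] B) (A ⊗[ℂ] B))

/-- The seminorms `p ⊙ q`, for `p`, `q` continuous seminorms. -/
def family : SeminormFamily ℂ (AlgTensor A B)
    ({p : Seminorm ℂ A // Continuous p} × {q : Seminorm ℂ B // Continuous q}) :=
  fun i => projSeminorm i.1.1 i.2.1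

instance : Nonempty ({p : Seminorm ℂ A // Continuous p} × {q : Seminorm ℂ B // Continuous q}) :=
  ⟨⟨0, (continuous_const : Continuous fun _ : A => (0 : ℝ))⟩,
    ⟨0, (continuous_const : Continuous fun _ : B => (0 : ℝ))⟩⟩

instance : TopologicalSpace (AlgTensor A B) := (family A B).moduleFilterBasis.topology

theorem withSeminorms : WithSeminorms (family A B) := ⟨rfl⟩

instance : IsTopologicalAddGroup (AlgTensor A B) := (withSeminorms A B).topologicalAddGroup
instance : ContinuousSMul ℂ (AlgTensor A B) := (withSeminorms A B).continuousSMul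
instance : UniformSpace (AlgTensor A B) := IsTopologicalAddGroup.rightUniformSpace _
instance : IsUniformAddGroup (AlgTensor A B) := isUniformAddGroup_of_addCommGroup
instance : UniformContinuousConstSMul ℂ (AlgTensor A B) :=
  uniformContinuousConstSMul_of_continuousConstSMul _ _
instance : LocallyConvexSpace ℝ (AlgTensor A B) := (withSeminorms A B).toLocallyConvexSpace

variable {A B}

/-- The pure tensor `a ⊗ b`. -/
def tmul (a : A) (b : B) : AlgTensor A B := a ⊗ₜ[ℂ] b

theorem continuous_family (i) : Continuous (family A B i) :=
  (withSeminorms A B).continuous_seminorm i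

/-- The linear map on the algebraic tensor product induced by a bilinear map. -/
def lift {C : Type*} [AddCommGroup C] [Module ℂ C] (f : A →ₗ[ℂ] B →ₗ[ℂ] C) :
    AlgTensor A B →ₗ[ℂ] C := TensorProduct.lift f

theorem lift_tmul {C : Type*} [AddCommGroup C] [Module ℂ C] (f : A →ₗ[ℂ] B →ₗ[ℂ] C) (a : A)
    (b : B) : lift f (tmul a b) = f a b := TensorProduct.lift.tmul a b

theorem continuous_lift {C : Type*} [AddCommGroup C] [Module ℂ C] [TopologicalSpace C]
    [IsTopologicalAddGroup C] [ContinuousSMul ℂ C] [LocallyConvexSpace ℝ C]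
    (f : A →ₗ[ℂ] B →ₗ[ℂ] C) (hf : Continuous fun x : A × B => f x.1 x.2) :
    Continuous (lift f) := by
  refine WithSeminorms.continuous_of_isBounded (withSeminorms A B)
    (polynormable_of_locallyConvex C).withSeminorms' _ fun r => ?_
  obtain ⟨p, hp, q, hq, h⟩ := exists_seminorm_bound f hf r.1 r.2
  refine ⟨{(⟨p, hp⟩, ⟨q, hq⟩)}, 1, fun x => ?_⟩
  have := le_projSeminorm p q (r.1.comp (lift f)) zero_le_one (fun a b => by
    rw [one_mul]; exact (congrArg r.1 (lift_tmul f a b)).trans_le (h a b)) x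
  rw [Finset.sup_singleton, one_smul]
  rwa [one_mul] at this

theorem continuous_tmul : Continuous fun x : A × B => tmul x.1 x.2 := by
  have h : ∀ i : {p : Seminorm ℂ A // Continuous p} × {q : Seminorm ℂ B // Continuous q},
      ∀ a b, family A B i (tmul a b) ≤ i.1.1 a * i.2.1 b :=
    fun i a b => projSeminorm_tmul_le _ _ a b
  have key : ∀ x₀ : A × B, Tendsto (fun x : A × B => tmul x.1 x.2) (𝓝 x₀)
      (𝓝 (tmul x₀.1 x₀.2)) := by
    rintro ⟨a, b⟩
    rw [(withSeminorms A B).tendsto_nhds]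
    intro i ε hε
    have hlim : Tendsto (fun x : A × B => i.1.1 (x.1 - a) * i.2.1 x.2 + i.1.1 a * i.2.1 (x.2 - b))
        (𝓝 (a, b)) (𝓝 (i.1.1 (a - a) * i.2.1 b + i.1.1 a * i.2.1 (b - b))) := by
      have h1 := i.1.2
      have h2 := i.2.2
      exact Continuous.tendsto (f := fun x : A × B =>
        i.1.1 (x.1 - a) * i.2.1 x.2 + i.1.1 a * i.2.1 (x.2 - b)) (by fun_prop) (a, b)
    simp only [sub_self, map_zero, zero_mul, mul_zero, add_zero] at hlim
    filter_upwards [hlim.eventually_lt_const hε] with x hx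
    have e : tmul x.1 x.2 - tmul a b = tmul (x.1 - a) x.2 + tmul a (x.2 - b) := by
      simp only [tmul, TensorProduct.sub_tmul, TensorProduct.tmul_sub]
      exact (sub_add_sub_cancel (x.1 ⊗ₜ[ℂ] x.2) (a ⊗ₜ[ℂ] x.2) (a ⊗ₜ[ℂ] b)).symm
    rw [e]
    exact ((map_add_le_add _ _ _).trans (add_le_add (h i _ _) (h i _ _))).trans_lt hx
  exact continuous_iff_continuousAt.2 key

theorem tmul_mul_tmul (a a' : A) (b b' : B) :
    tmul a b * tmul a' b' = tmul (a * a') (b * b') :=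
  Algebra.TensorProduct.tmul_mul_tmul a a' b b'

theorem induction {P : AlgTensor A B → Prop} (h0 : P 0) (ht : ∀ a b, P (tmul a b))
    (ha : ∀ x y, P x → P y → P (x + y)) (x : AlgTensor A B) : P x :=
  TensorProduct.induction_on x h0 ht ha

theorem exists_mul_bound (p : Seminorm ℂ A) (hp : Continuous p) :
    ∃ q : Seminorm ℂ A, Continuous q ∧ ∀ a a', p (a * a') ≤ q a * q a' := by
  obtain ⟨q, hq, r, hr, h⟩ := exists_seminorm_bound (LinearMap.mul ℂ A) continuous_mul p hp
  refine ⟨q ⊔ r, hq.sup hr, fun a a' => (h a a').trans ?_⟩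
  gcongr
  · exact le_sup_left (a := q) (b := r) a
  · exact le_sup_right (a := q) (b := r) a'

instance : ContinuousMul (AlgTensor A B) := by
  have bound : ∀ i, ∃ j, ∀ x y : AlgTensor A B,
      family A B i (x * y) ≤ family A B j x * family A B j y := by
    rintro ⟨⟨p, hp⟩, ⟨q, hq⟩⟩
    obtain ⟨p', hp', hpp⟩ := exists_mul_bound p hp
    obtain ⟨q', hq', hqq⟩ := exists_mul_bound q hq
    refine ⟨(⟨p', hp'⟩, ⟨q', hq'⟩), fun x y => ?_⟩
    have h1 : ∀ a b (y : AlgTensor A B), projSeminorm p q (tmul a b * y) ≤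
        (p' a * q' b) * projSeminorm p' q' y := fun a b y =>
      le_projSeminorm p' q' ((projSeminorm p q).comp (LinearMap.mulLeft ℂ (tmul a b)))
        (by positivity) (fun c d => by
          change projSeminorm p q (tmul a b * tmul c d) ≤ _
          rw [tmul_mul_tmul]
          refine (projSeminorm_tmul_le p q _ _).trans ?_
          calc p (a * c) * q (b * d) ≤ (p' a * p' c) * (q' b * q' d) := by
                gcongr
                exacts [hpp a c, hqq b d]
            _ = _ := by ring) y
    have h2 := le_projSeminorm p' q' ((projSeminorm p q).comp (LinearMap.mulRight ℂ y))
      (apply_nonneg (projSeminorm p' q') y) (fun a b => by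
        change projSeminorm p q (tmul a b * y) ≤ _
        exact (h1 a b y).trans_eq (mul_comm _ _)) x
    exact h2.trans_eq (mul_comm _ _)
  refine ⟨continuous_iff_continuousAt.2 ?_⟩
  rintro ⟨a, b⟩
  rw [ContinuousAt, (withSeminorms A B).tendsto_nhds]
  intro i ε hε
  obtain ⟨j, hj⟩ := bound i
  have hlim : Tendsto (fun x : AlgTensor A B × AlgTensor A B => family A B j (x.1 - a) *
      family A B j x.2 + family A B j a * family A B j (x.2 - b)) (𝓝 (a, b))
      (𝓝 (family A B j (a - a) * family A B j b + family A B j a * family A B j (b - b))) := by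
    have h1 := continuous_family (A := A) (B := B) j
    exact Continuous.tendsto (f := fun x : AlgTensor A B × AlgTensor A B =>
      family A B j (x.1 - a) * family A B j x.2 + family A B j a * family A B j (x.2 - b))
      (by fun_prop) (a, b)
  simp only [sub_self, map_zero, zero_mul, mul_zero, add_zero] at hlim
  filter_upwards [hlim.eventually_lt_const hε] with x hx
  have e : x.1 * x.2 - a * b = (x.1 - a) * x.2 + a * (x.2 - b) := by
    rw [sub_mul, mul_sub]; abel
  rw [e]
  exact ((map_add_le_add _ _ _).trans (add_le_add (hj _ _) (hj _ _))).trans_lt hx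

end AlgTensor

section Completion

open UniformSpace

variable (R : Type*) [NonUnitalRing R] [UniformSpace R] [IsUniformAddGroup R] [ContinuousMul R]

/-- The extension of the multiplication to the completion. -/
@[reducible] def completionMul : Mul (Completion R) :=
  ⟨fun x y => (Completion.isDenseInducing_coe.prodMap Completion.isDenseInducing_coe).extend
    (fun z : R × R => ((z.1 * z.2 : R) : Completion R)) (x, y)⟩

attribute [local instance] completionMul

theorem completion_coe_mul (x y : R) : ((x * y : R) : Completion R) = x * y :=
  ((Completion.isDenseInducing_coe.prodMap Completion.isDenseInducing_coe).extend_eq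
    ((Completion.continuous_coe R).comp continuous_mul) (x, y)).symm

theorem completion_continuousMul : ContinuousMul (Completion R) where
  continuous_mul := by
    let f : R →+ R →+ Completion R :=
      (AddMonoidHom.mul : R →+ R →+ R).compr₂ Completion.toCompl
    have hf : Continuous fun p : R × R => f p.1 p.2 :=
      (Completion.continuous_coe R).comp continuous_mul
    have di : IsDenseInducing (Completion.toCompl : R → Completion R) :=
      Completion.isDenseInducing_coe
    exact di.extend_Z_bilin di hf

/-- The completion of a not necessarily unital topological ring. -/
@[reducible] def completionNonUnitalRing : NonUnitalRing (Completion R) :=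
  have := completion_continuousMul R
  { (inferInstance : AddCommGroup (Completion R)), completionMul R with
    zero_mul x := Completion.induction_on x
      (isClosed_eq (continuous_const.mul continuous_id) continuous_const)
      fun x => by rw [← Completion.coe_zero, ← completion_coe_mul, zero_mul]
    mul_zero x := Completion.induction_on x
      (isClosed_eq (continuous_id.mul continuous_const) continuous_const)
      fun x => by rw [← Completion.coe_zero, ← completion_coe_mul, mul_zero]
    mul_assoc x y z := Completion.induction_on₃ x y z
      (isClosed_eq (by fun_prop) (by fun_prop)) fun x y z => by
        rw [← completion_coe_mul, ← completion_coe_mul, ← completion_coe_mul,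
          ← completion_coe_mul, mul_assoc]
    left_distrib x y z := Completion.induction_on₃ x y z
      (isClosed_eq (by fun_prop) (by fun_prop)) fun x y z => by
        rw [← completion_coe_mul, ← completion_coe_mul, ← Completion.coe_add,
          ← completion_coe_mul, ← Completion.coe_add, mul_add]
    right_distrib x y z := Completion.induction_on₃ x y z
      (isClosed_eq (by fun_prop) (by fun_prop)) fun x y z => by
        rw [← completion_coe_mul, ← completion_coe_mul, ← Completion.coe_add,
          ← completion_coe_mul, ← Completion.coe_add, add_mul] }

end Completion

/-- The completed projective tensor product. -/
def ProjTensor (A B : Type*) [NonUnitalRing A] [Module ℂ A] [UniformSpace A] [IsLCAlg A]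
    [NonUnitalRing B] [Module ℂ B] [UniformSpace B] [IsLCAlg B] : Type _ :=
  UniformSpace.Completion (AlgTensor A B)

namespace ProjTensor

open UniformSpace

variable (A B : Type*) [NonUnitalRing A] [Module ℂ A] [UniformSpace A] [IsLCAlg A]
  [NonUnitalRing B] [Module ℂ B] [UniformSpace B] [IsLCAlg B]

instance : NonUnitalRing (ProjTensor A B) := completionNonUnitalRing (AlgTensor A B)
instance : UniformSpace (ProjTensor A B) :=
  inferInstanceAs (UniformSpace (Completion (AlgTensor A B)))
instance : Module ℂ (ProjTensor A B) :=
  inferInstanceAs (Module ℂ (Completion (AlgTensor A B)))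
instance : CompleteSpace (ProjTensor A B) :=
  inferInstanceAs (CompleteSpace (Completion (AlgTensor A B)))
instance : T2Space (ProjTensor A B) :=
  inferInstanceAs (T2Space (Completion (AlgTensor A B)))
instance : IsUniformAddGroup (ProjTensor A B) :=
  inferInstanceAs (IsUniformAddGroup (Completion (AlgTensor A B)))
instance : ContinuousMul (ProjTensor A B) := completion_continuousMul (AlgTensor A B)

variable {A B}

/-- The canonical map from the algebraic tensor product. -/
def coe : AlgTensor A B →ₗ[ℂ] ProjTensor A B where
  toFun x := (x : Completion (AlgTensor A B))
  map_add' := Completion.coe_add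
  map_smul' c x := Completion.coe_smul c x

theorem continuous_coe : Continuous (coe : AlgTensor A B → ProjTensor A B) :=
  Completion.continuous_coe _

theorem isDenseInducing_coe : IsDenseInducing (coe : AlgTensor A B → ProjTensor A B) :=
  Completion.isDenseInducing_coe

theorem dense_induction {P : ProjTensor A B → Prop} (hP : IsClosed {x | P x})
    (h : ∀ x, P (coe x)) (x : ProjTensor A B) : P x :=
  Completion.induction_on x hP h

theorem coe_mul (x y : AlgTensor A B) : (coe (x * y) : ProjTensor A B) = coe x * coe y :=
  completion_coe_mul _ x y

variable (A B) in
instance : ContinuousSMul ℂ (ProjTensor A B) := by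
  let f : ℂ →+ AlgTensor A B →+ ProjTensor A B :=
    AddMonoidHom.compr₂ (AddMonoidHom.smul : ℂ →+ AlgTensor A B →+ AlgTensor A B)
      (coe : AlgTensor A B →ₗ[ℂ] ProjTensor A B).toAddMonoidHom
  have hf : Continuous fun p : ℂ × AlgTensor A B => f p.1 p.2 :=
    continuous_coe.comp continuous_smul
  have di : IsDenseInducing
      ((coe : AlgTensor A B →ₗ[ℂ] ProjTensor A B).toAddMonoidHom) := isDenseInducing_coe
  have di' : IsDenseInducing (AddMonoidHom.id ℂ) := IsDenseEmbedding.id.toIsDenseInducing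
  have hc := di'.extend_Z_bilin di hf
  have hconst : ∀ c : ℂ, Continuous fun x : ProjTensor A B => c • x := fun c =>
    (uniformContinuous_const_smul (X := Completion (AlgTensor A B)) c).continuous
  have he : ∀ (c : ℂ) (x : ProjTensor A B),
      (di'.prodMap di).extend (fun p : ℂ × AlgTensor A B => f p.1 p.2) (c, x) = c • x := by
    intro c x
    refine dense_induction (P := fun x => (di'.prodMap di).extend
      (fun p : ℂ × AlgTensor A B => f p.1 p.2) (c, x) = c • x)
      (isClosed_eq (hc.comp (by fun_prop)) (hconst c)) (fun y => ?_) x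
    exact ((di'.prodMap di).extend_eq hf (c, y)).trans (map_smul coe c y)
  refine ⟨?_⟩
  have : (fun p : ℂ × ProjTensor A B => p.1 • p.2) =
      (di'.prodMap di).extend (fun p : ℂ × AlgTensor A B => f p.1 p.2) :=
    funext fun p => (he p.1 p.2).symm
  rw [this]
  exact hc

variable (A B) in
instance : LocallyConvexSpace ℝ (ProjTensor A B) := by
  rw [locallyConvexSpace_iff_exists_convex_subset_zero]
  intro U hU
  obtain ⟨V, hV, hVc, hVU⟩ := exists_mem_nhds_isClosed_subset hU
  have hV' : (coe : AlgTensor A B → ProjTensor A B) ⁻¹' V ∈ 𝓝 0 :=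
    continuous_coe.continuousAt.preimage_mem_nhds (by simpa using hV)
  obtain ⟨W, hW, hWc, hWV⟩ :=
    (locallyConvexSpace_iff_exists_convex_subset_zero ℝ (AlgTensor A B)).1 inferInstance _ hV'
  refine ⟨closure (coe '' W), ?_, ?_, ?_⟩
  · simpa using isDenseInducing_coe.closure_image_mem_nhds hW
  · have := hWc.linear_image ((coe : AlgTensor A B →ₗ[ℂ] ProjTensor A B).restrictScalars ℝ)
    have : ContinuousSMul ℝ (ProjTensor A B) := IsScalarTower.continuousSMul ℂ
    exact Convex.closure ‹_›
  · exact (closure_minimal (Set.image_subset_iff.2 hWV) hVc).trans hVU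

theorem dense_induction₂ {P : ProjTensor A B → ProjTensor A B → Prop}
    (hP : IsClosed {x : ProjTensor A B × ProjTensor A B | P x.1 x.2})
    (h : ∀ x y, P (coe x) (coe y)) (x y : ProjTensor A B) : P x y :=
  dense_induction (P := fun x => P x y) (hP.preimage (by fun_prop : Continuous fun x => (x, y)))
    (fun x => dense_induction (P := fun y => P (coe x) y)
      (hP.preimage (by fun_prop : Continuous fun y => (coe x, y))) (h x) y) x

theorem smul_mul_aux (c : ℂ) (x y : ProjTensor A B) : (c • x) * y = c • (x * y) :=
  dense_induction₂ (P := fun x y => (c • x) * y = c • (x * y))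
    (isClosed_eq ((continuous_fst.const_smul c).mul continuous_snd)
      ((continuous_fst.mul continuous_snd).const_smul c))
    (fun x y => by
      change (c • coe x) * coe y = c • (coe x * coe y)
      rw [← map_smul, ← coe_mul, ← coe_mul, ← map_smul, smul_mul_assoc]) x y

theorem mul_smul_aux (c : ℂ) (x y : ProjTensor A B) : c • (x * y) = x * (c • y) :=
  dense_induction₂ (P := fun x y => c • (x * y) = x * (c • y))
    (isClosed_eq ((continuous_fst.mul continuous_snd).const_smul c)
      (continuous_fst.mul (continuous_snd.const_smul c)))
    (fun x y => by
      change c • (coe x * coe y) = coe x * (c • coe y)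
      rw [← map_smul, ← coe_mul, ← coe_mul, ← map_smul, mul_smul_comm]) x y

instance : IsLCAlg (ProjTensor A B) where
  smul_assoc := smul_mul_aux
  smul_comm := mul_smul_aux

/-- The pure tensor `a ⊗ b` in the completed tensor product. -/
def tmul (a : A) (b : B) : ProjTensor A B := coe (AlgTensor.tmul a b)

theorem continuous_tmul : Continuous fun x : A × B => (tmul x.1 x.2 : ProjTensor A B) :=
  continuous_coe.comp AlgTensor.continuous_tmul

theorem tmul_mul_tmul (a a' : A) (b b' : B) :
    (tmul a b * tmul a' b' : ProjTensor A B) = tmul (a * a') (b * b') := by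
  rw [tmul, tmul, ← coe_mul, AlgTensor.tmul_mul_tmul]; rfl

/-- The pure tensor as a bilinear map. -/
def tmulBilin : A →ₗ[ℂ] B →ₗ[ℂ] ProjTensor A B :=
  LinearMap.mk₂ ℂ tmul
    (fun a a' b => (congrArg coe (TensorProduct.add_tmul a a' b)).trans (map_add coe _ _))
    (fun c a b => (congrArg coe (TensorProduct.smul_tmul' c a b).symm).trans (map_smul coe _ _))
    (fun a b b' => (congrArg coe (TensorProduct.tmul_add a b b')).trans (map_add coe _ _))
    (fun c a b => (congrArg coe (TensorProduct.tmul_smul c a b)).trans (map_smul coe _ _))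

@[simp] theorem tmulBilin_apply (a : A) (b : B) :
    (tmulBilin a b : ProjTensor A B) = tmul a b := rfl

/-- To prove a closed additive property, it suffices to prove it for pure tensors. -/
theorem induction {P : ProjTensor A B → Prop} (hP : IsClosed {x | P x})
    (ht : ∀ a b, P (tmul a b)) (ha : ∀ x y, P x → P y → P (x + y)) (x : ProjTensor A B) :
    P x := by
  refine dense_induction hP (fun y => ?_) x
  refine AlgTensor.induction (P := fun y => P (coe y)) ?_ ht (fun x y hx hy => ?_) y
  · have := ht 0 0
    rw [← tmulBilin_apply, map_zero] at this
    rwa [map_zero]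
  · rw [map_add]; exact ha _ _ hx hy

section Lift

variable {C : Type*} [AddCommGroup C] [Module ℂ C] [UniformSpace C] [IsUniformAddGroup C]
  [ContinuousSMul ℂ C] [LocallyConvexSpace ℝ C] [CompleteSpace C] [T2Space C]

/-- The universal property: the continuous linear map on the completed projective tensor product
induced by a continuous bilinear map. -/
def lift (f : A →ₗ[ℂ] B →ₗ[ℂ] C) (hf : Continuous fun x : A × B => f x.1 x.2) :
    ProjTensor A B →L[ℂ] C where
  toFun := (AlgTensor.lift f).toAddMonoidHom.extension (AlgTensor.continuous_lift f hf)
  map_add' := map_add _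
  map_smul' c x := by
    refine dense_induction (P := fun x => (AlgTensor.lift f).toAddMonoidHom.extension
      (AlgTensor.continuous_lift f hf) (c • x) = c • (AlgTensor.lift f).toAddMonoidHom.extension
      (AlgTensor.continuous_lift f hf) x) (isClosed_eq ?_ ?_) (fun x => ?_) x
    · exact (AddMonoidHom.continuous_extension _ _).comp (continuous_const_smul c)
    · exact (AddMonoidHom.continuous_extension _ _).const_smul c
    · rw [← map_smul]
      erw [AddMonoidHom.extension_coe, AddMonoidHom.extension_coe]
      exact map_smul (AlgTensor.lift f) c x
  cont := AddMonoidHom.continuous_extension _ _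

@[simp] theorem lift_tmul (f : A →ₗ[ℂ] B →ₗ[ℂ] C) (hf : Continuous fun x : A × B => f x.1 x.2)
    (a : A) (b : B) : lift f hf (tmul a b) = f a b :=
  (AddMonoidHom.extension_coe (AlgTensor.lift f).toAddMonoidHom
    (AlgTensor.continuous_lift f hf) (AlgTensor.tmul a b)).trans (AlgTensor.lift_tmul f a b)

theorem ext_tmul {f g : ProjTensor A B →L[ℂ] C} (h : ∀ a b, f (tmul a b) = g (tmul a b)) :
    f = g :=
  ContinuousLinearMap.ext fun x => induction (isClosed_eq f.continuous g.continuous) h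
    (fun x y hx hy => by rw [map_add, map_add, hx, hy]) x

end Lift

section Map

variable {A' B' : Type*} [NonUnitalRing A'] [Module ℂ A'] [UniformSpace A'] [IsLCAlg A']
  [NonUnitalRing B'] [Module ℂ B'] [UniformSpace B'] [IsLCAlg B']

theorem map_mul_of_tmul {C : Type*} [NonUnitalRing C] [Module ℂ C] [UniformSpace C] [IsLCAlg C]
    (f : ProjTensor A B →L[ℂ] C)
    (h : ∀ a b a' b', f (tmul a b * tmul a' b') = f (tmul a b) * f (tmul a' b'))
    (x y : ProjTensor A B) : f (x * y) = f x * f y := by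
  refine induction (P := fun x => f (x * y) = f x * f y)
    (isClosed_eq (by fun_prop) (by fun_prop)) (fun a b => ?_)
    (fun x x' hx hx' => by rw [add_mul, map_add, map_add, hx, hx', add_mul]) x
  exact induction (P := fun y => f (tmul a b * y) = f (tmul a b) * f y)
    (isClosed_eq (by fun_prop) (by fun_prop)) (fun a' b' => h a b a' b')
    (fun x x' hx hx' => by rw [mul_add, map_add, map_add, hx, hx', mul_add]) y

/-- The tensor product of continuous linear maps. -/
def mapCLM (f : A →L[ℂ] A') (g : B →L[ℂ] B') : ProjTensor A B →L[ℂ] ProjTensor A' B' :=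
  lift (tmulBilin.compl₁₂ (f : A →ₗ[ℂ] A') (g : B →ₗ[ℂ] B'))
    (continuous_tmul.comp ((f.continuous.comp continuous_fst).prodMk
      (g.continuous.comp continuous_snd)))

@[simp] theorem mapCLM_tmul (f : A →L[ℂ] A') (g : B →L[ℂ] B') (a : A) (b : B) :
    mapCLM f g (tmul a b) = tmul (f a) (g b) := lift_tmul _ _ a b

/-- The tensor product of morphisms of locally convex algebras. -/
def map (f : LCHom A A') (g : LCHom B B') : LCHom (ProjTensor A B) (ProjTensor A' B') :=
  .ofCLM (mapCLM f.toCLM g.toCLM) (map_mul_of_tmul _ fun a b a' b' => by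
    simp [tmul_mul_tmul])

@[simp] theorem map_tmul (f : LCHom A A') (g : LCHom B B') (a : A) (b : B) :
    map f g (tmul a b) = tmul (f a) (g b) := mapCLM_tmul _ _ a b

variable (A B) in
/-- The flip `a ⊗ b ↦ b ⊗ a` as a continuous linear map. -/
def flipCLM : ProjTensor A B →L[ℂ] ProjTensor B A :=
  lift tmulBilin.flip (continuous_tmul.comp (continuous_snd.prodMk continuous_fst))

@[simp] theorem flipCLM_tmul (a : A) (b : B) : flipCLM A B (tmul a b) = tmul b a :=
  lift_tmul _ _ a b

variable (A B) in
/-- The flip `a ⊗ b ↦ b ⊗ a`. -/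
def flip : LCHom (ProjTensor A B) (ProjTensor B A) :=
  .ofCLM (flipCLM A B) (map_mul_of_tmul _ fun a b a' b' => by simp [tmul_mul_tmul])

variable (A) in
/-- The morphism `a ↦ a ⊗ e` attached to an idempotent `e`. -/
def tmulRight (e : B) (he : e * e = e) : LCHom A (ProjTensor A B) :=
  .ofCLM ⟨tmulBilin.flip e, continuous_tmul.comp (continuous_id.prodMk continuous_const)⟩
    fun a a' => by
      change tmul (a * a') e = tmul a e * tmul a' e
      rw [tmul_mul_tmul, he]

variable (B) in
/-- The morphism `b ↦ e ⊗ b` attached to an idempotent `e`. -/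
def tmulLeft (e : A) (he : e * e = e) : LCHom B (ProjTensor A B) :=
  .ofCLM ⟨tmulBilin e, continuous_tmul.comp (continuous_const.prodMk continuous_id)⟩
    fun a a' => by
      change tmul e (a * a') = tmul e a * tmul e a'
      rw [tmul_mul_tmul, he]

variable (A) in
/-- The map `ℂ ⊗ A → A`, `c ⊗ a ↦ c a` as a continuous linear map. -/
def unitLeftCLM : ProjTensor ℂ A →L[ℂ] A :=
  lift (LinearMap.lsmul ℂ A) (continuous_fst.smul continuous_snd)

@[simp] theorem unitLeftCLM_tmul (c : ℂ) (a : A) : unitLeftCLM A (tmul c a) = c • a :=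
  lift_tmul _ _ c a

variable (A) in
/-- The canonical morphism `ℂ ⊗ A → A`, `c ⊗ a ↦ c a`. -/
def unitLeft : LCHom (ProjTensor ℂ A) A :=
  .ofCLM (unitLeftCLM A) (map_mul_of_tmul _ fun a b a' b' => by
    simp [tmul_mul_tmul, smul_mul_smul_comm])

end Map

end ProjTensor

/-- The completed projective tensor product as an object of the category. -/
abbrev LCAlg.tensor (A B : LCAlg) : LCAlg := .of (ProjTensor A B)

/-- The canonical isomorphism `ℂ ⊗ A ≅ A`. -/
def LCAlg.leftUnitor (A : LCAlg) : (LCAlg.of ℂ).tensor A ≅ A where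
  hom := LCAlg.ofHom (ProjTensor.unitLeft A)
  inv := LCAlg.ofHom (ProjTensor.tmulLeft A (1 : ℂ) (one_mul 1))
  hom_inv_id := by
    refine LCHom.ext fun x => ?_
    refine ProjTensor.induction (P := fun x => ProjTensor.tmul (1 : ℂ) (ProjTensor.unitLeftCLM A x)
      = x) (isClosed_eq ?_ continuous_id) (fun c a => ?_) (fun x y hx hy => ?_) x
    · exact ProjTensor.continuous_tmul.comp
        (continuous_const.prodMk (ProjTensor.unitLeftCLM A).continuous)
    · rw [ProjTensor.unitLeftCLM_tmul, ← ProjTensor.tmulBilin_apply, ← ProjTensor.tmulBilin_apply,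
        map_smul, ← LinearMap.smul_apply, ← map_smul, smul_eq_mul, mul_one]
    · rw [← ProjTensor.tmulBilin_apply] at hx hy ⊢
      rw [map_add, map_add, hx, hy]
  inv_hom_id := LCHom.ext fun a => (ProjTensor.unitLeftCLM_tmul 1 a).trans (one_smul ℂ a)

/-! ## Smooth functions on the unit interval with flat ends -/

section FlatSmooth

open unitInterval MeasureTheory

section Deriv

variable {B : Type*} [AddCommGroup B] [Module ℝ B] [TopologicalSpace B]

/-- `g` is the derivative of `f : [0,1] → B`, one-sided at the end points. -/
def HasDerivOnI (f g : I → B) : Prop :=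
  ∀ t : I, Tendsto (fun s : I => ((s : ℝ) - t)⁻¹ • (f s - f t)) (𝓝[≠] t) (𝓝 (g t))

/-- `d` is the sequence of the iterated derivatives of `d 0`, all of which, from the first on,
vanish at both end points. -/
def IsFlatJet (d : ℕ → I → B) : Prop :=
  ∀ k, HasDerivOnI (d k) (d (k + 1)) ∧ d (k + 1) 0 = 0 ∧ d (k + 1) 1 = 0

instance (t : I) : (𝓝[≠] t).NeBot := inferInstance

variable {f f' g g' : I → B}

theorem HasDerivOnI.unique [T2Space B] (h : HasDerivOnI f g) (h' : HasDerivOnI f g') : g = g' :=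
  funext fun t => tendsto_nhds_unique (h t) (h' t)

theorem IsFlatJet.unique [T2Space B] {d e : ℕ → I → B} (hd : IsFlatJet d) (he : IsFlatJet e)
    (h : d 0 = e 0) : d = e := by
  funext k
  induction k with
  | zero => exact h
  | succ k ih =>
    have := (hd k).1
    rw [ih] at this
    exact this.unique (he k).1

theorem HasDerivOnI.add [IsTopologicalAddGroup B] (h : HasDerivOnI f g) (h' : HasDerivOnI f' g') :
    HasDerivOnI (f + f') (g + g') := fun t => by
  refine ((h t).add (h' t)).congr fun s => ?_
  rw [← smul_add, Pi.add_apply, Pi.add_apply, add_sub_add_comm]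

theorem HasDerivOnI.zero : HasDerivOnI (0 : I → B) 0 := fun t => by
  simpa using tendsto_const_nhds

theorem HasDerivOnI.const (b : B) : HasDerivOnI (fun _ : I => b) 0 := fun t => by
  simpa using tendsto_const_nhds

theorem HasDerivOnI.map {C : Type*} [AddCommGroup C] [Module ℝ C] [TopologicalSpace C]
    (h : HasDerivOnI f g) (l : B →L[ℝ] C) :
    HasDerivOnI (fun t => l (f t)) (fun t => l (g t)) := fun t => by
  refine ((l.continuous.tendsto _).comp (h t)).congr fun s => ?_
  simp

theorem HasDerivOnI.continuous [IsTopologicalAddGroup B] [ContinuousSMul ℝ B]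
    (h : HasDerivOnI f g) : Continuous f := by
  refine continuous_iff_continuousAt.2 fun t => ?_
  rw [continuousAt_iff_punctured_nhds]
  have h1 : Tendsto (fun s : I => (s : ℝ) - t) (𝓝[≠] t) (𝓝 ((t : ℝ) - t)) :=
    (Continuous.tendsto (by fun_prop) t).mono_left nhdsWithin_le_nhds
  have h2 := (h1.smul (h t)).add_const (f t)
  rw [sub_self, zero_smul, zero_add] at h2
  refine h2.congr' (eventually_mem_nhdsWithin.mono fun s hs => ?_)
  have : (s : ℝ) - t ≠ 0 := sub_ne_zero.2 fun e => hs (Subtype.ext e)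
  rw [smul_inv_smul₀ this, sub_add_cancel]

theorem IsFlatJet.continuous [IsTopologicalAddGroup B] [ContinuousSMul ℝ B] {d : ℕ → I → B}
    (h : IsFlatJet d) (k : ℕ) : Continuous (d k) := (h k).1.continuous

end Deriv

section Closed

variable {B : Type*} [AddCommGroup B] [Module ℝ B] [TopologicalSpace B]
  [IsTopologicalAddGroup B] [ContinuousSMul ℝ B] [LocallyConvexSpace ℝ B]

/-- The integral of a continuous real function on the unit interval between two points. -/
def intI (s t : ℝ) (h : C(I, ℝ)) : ℝ := ∫ u in s..t, h (Set.projIcc 0 1 zero_le_one u)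

theorem continuous_integrand (h : C(I, ℝ)) :
    Continuous fun u : ℝ => h (Set.projIcc 0 1 zero_le_one u) :=
  h.continuous.comp continuous_projIcc

theorem continuous_intI (s t : ℝ) : Continuous (intI s t) := by
  let L : C(I, ℝ) →ₗ[ℝ] ℝ :=
    { toFun := intI s t
      map_add' := fun h k => intervalIntegral.integral_add
        ((continuous_integrand h).intervalIntegrable _ _)
        ((continuous_integrand k).intervalIntegrable _ _)
      map_smul' := fun c h => intervalIntegral.integral_smul c _ }
  exact (L.mkContinuous |t - s| fun h => by
    rw [mul_comm]
    exact intervalIntegral.norm_integral_le_of_norm_le_const fun u _ => h.norm_coe_le_norm _).continuous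

theorem average_lt {h : ℝ → ℝ} (hh : Continuous h) {a b K : ℝ} (hab : a ≠ b)
    (hK : ∀ u ∈ Set.uIcc a b, h u < K) : (b - a)⁻¹ * ∫ u in a..b, h u < K := by
  have key : ∀ a b : ℝ, a < b → (∀ u ∈ Set.Icc a b, h u < K) → ∫ u in a..b, h u < K * (b - a) := by
    intro a b hab hK
    have h1 : 0 < ∫ u in a..b, (K - h u) :=
      intervalIntegral.intervalIntegral_pos_of_pos_on
        ((continuous_const.sub hh).intervalIntegrable _ _)
        (fun u hu => sub_pos.2 (hK u ⟨hu.1.le, hu.2.le⟩)) hab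
    rw [intervalIntegral.integral_sub (continuous_const.intervalIntegrable _ _)
      (hh.intervalIntegrable _ _), intervalIntegral.integral_const, smul_eq_mul] at h1
    linarith
  rcases lt_or_gt_of_ne hab with h1 | h1
  · rw [inv_mul_lt_iff₀ (sub_pos.2 h1), mul_comm]
    exact key a b h1 (by rwa [Set.uIcc_of_le h1.le] at hK)
  · rw [intervalIntegral.integral_symm, ← neg_sub a b, inv_neg, neg_mul_neg,
      inv_mul_lt_iff₀ (sub_pos.2 h1), mul_comm]
    exact key b a h1 (by rwa [Set.uIcc_of_ge h1.le] at hK)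

/-- Differentiation tested on continuous functionals, in integrated form. -/
theorem hasDerivOnI_iff (f g : C(I, B)) : HasDerivOnI f g ↔
    ∀ (l : B →L[ℝ] ℝ) (s t : I), l (f t) - l (f s) = intI s t ((l : C(B, ℝ)).comp g) := by
  constructor
  · intro h l
    have key : ∀ s t : I, s ≤ t → l (f t) - l (f s) = intI s t ((l : C(B, ℝ)).comp g) := by
      intro s t hst
      let F : ℝ → ℝ := fun u => l (f (Set.projIcc 0 1 zero_le_one u))
      have hF : Continuous F := l.continuous.comp (f.continuous.comp continuous_projIcc)
      have hd : ∀ x ∈ Set.Ioo (s : ℝ) t,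
          HasDerivAt F (((l : C(B, ℝ)).comp g) (Set.projIcc 0 1 zero_le_one x)) x := by
        intro x hx
        have hx0 : 0 < x := s.2.1.trans_lt hx.1
        have hx1 : x < 1 := hx.2.trans_le t.2.2
        have hxI : x ∈ I := ⟨hx0.le, hx1.le⟩
        rw [hasDerivAt_iff_tendsto_slope]
        have hp : Tendsto (Set.projIcc (0 : ℝ) 1 zero_le_one) (𝓝[≠] x) (𝓝[≠] (⟨x, hxI⟩ : I)) := by
          refine tendsto_nhdsWithin_iff.2 ⟨?_, ?_⟩
          · have := (continuous_projIcc (h := zero_le_one (α := ℝ))).tendsto x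
            rw [Set.projIcc_of_mem zero_le_one hxI] at this
            exact this.mono_left nhdsWithin_le_nhds
          · have : ∀ᶠ y in 𝓝[≠] x, y ∈ Set.Ioo (0 : ℝ) 1 :=
              nhdsWithin_le_nhds (Ioo_mem_nhds hx0 hx1)
            filter_upwards [this, eventually_mem_nhdsWithin] with y hy hyx
            rw [Set.projIcc_of_mem zero_le_one ⟨hy.1.le, hy.2.le⟩]
            exact fun e => hyx (congrArg Subtype.val e)
        have := (h.map l ⟨x, hxI⟩).comp hp
        rw [Set.projIcc_of_mem zero_le_one hxI]
        refine this.congr' ?_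
        have : ∀ᶠ y in 𝓝[≠] x, y ∈ Set.Ioo (0 : ℝ) 1 :=
          nhdsWithin_le_nhds (Ioo_mem_nhds hx0 hx1)
        filter_upwards [this] with y hy
        simp only [Function.comp_apply, slope_def_module, F, smul_eq_mul,
          Set.projIcc_of_mem zero_le_one (show y ∈ Set.Icc (0 : ℝ) 1 from ⟨hy.1.le, hy.2.le⟩),
          Set.projIcc_of_mem zero_le_one (show x ∈ Set.Icc (0 : ℝ) 1 from hxI)]
      have := intervalIntegral.integral_eq_sub_of_hasDerivAt_of_le hst hF.continuousOn hd
        ((continuous_integrand _).intervalIntegrable _ _)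
      rw [intI, this]
      simp [F]
    intro s t
    rcases le_total s t with hst | hst
    · exact key s t hst
    · have := key t s hst
      rw [intI, intervalIntegral.integral_symm, ← intI, ← this, neg_sub]
  · intro h t
    rw [tendsto_def]
    intro U hU
    have hU0 : (fun x => x + g t) ⁻¹' U ∈ 𝓝 (0 : B) :=
      (continuous_add_const (g t)).continuousAt.preimage_mem_nhds (by simpa using hU)
    obtain ⟨C, ⟨hC0, hCo, hCc⟩, hCU⟩ :=
      (LocallyConvexSpace.convex_open_basis_zero ℝ B).mem_iff.1 hU0
    have hC' : IsOpen {x : B | x - g t ∈ C} := hCo.preimage (continuous_id.sub continuous_const)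
    have hCc' : Convex ℝ {x : B | x - g t ∈ C} := by
      have := hCc.translate_preimage_left (-g t)
      simpa [Set.preimage, sub_eq_add_neg] using this
    have hn : g ⁻¹' {x : B | x - g t ∈ C} ∈ 𝓝 t :=
      g.continuous.continuousAt.preimage_mem_nhds (hC'.mem_nhds (by simpa using hC0))
    obtain ⟨δ, hδ, hball⟩ := Metric.mem_nhds_iff.1 hn
    have hnear : ∀ᶠ s in 𝓝[≠] t, s ∈ Metric.ball t δ :=
      nhdsWithin_le_nhds (Metric.ball_mem_nhds t hδ)
    filter_upwards [hnear, eventually_mem_nhdsWithin] with s hs hst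
    have hst' : (t : ℝ) ≠ s := fun e => hst (Subtype.ext e.symm)
    by_contra hx
    have hx' : ((s : ℝ) - t)⁻¹ • (f s - f t) ∉ {x : B | x - g t ∈ C} := fun hm => hx (by
      have := hCU hm
      simpa using this)
    obtain ⟨l, hl⟩ := geometric_hahn_banach_open_point hCc' hC' hx'
    have := average_lt (K := l (((s : ℝ) - t)⁻¹ • (f s - f t)))
      (continuous_integrand ((l : C(B, ℝ)).comp g)) hst' fun u hu => by
        refine hl _ (hball ?_)
        have huI : u ∈ I :=
          (Set.uIcc_subset_Icc t.2 s.2) hu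
        rw [Set.projIcc_of_mem zero_le_one huI, Metric.mem_ball]
        rw [Metric.mem_ball] at hs
        refine lt_of_le_of_lt ?_ hs
        rw [Subtype.dist_eq, Subtype.dist_eq, Real.dist_eq, Real.dist_eq]
        exact Set.abs_sub_left_of_mem_uIcc hu
    rw [← intI, ← h l t s, map_smul, map_sub, smul_eq_mul] at this
    exact lt_irrefl _ this

theorem isClosed_hasDerivOnI : IsClosed {x : C(I, B) × C(I, B) | HasDerivOnI x.1 x.2} := by
  simp only [hasDerivOnI_iff, Set.ofPred_forall]
  refine isClosed_iInter fun l => isClosed_iInter fun s => isClosed_iInter fun t =>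
    isClosed_eq ?_ ?_
  · exact (l.continuous.comp ((continuous_eval_const t).comp continuous_fst)).sub
      (l.continuous.comp ((continuous_eval_const s).comp continuous_fst))
  · exact (continuous_intI s t).comp
      ((ContinuousMap.continuous_postcomp _).comp continuous_snd)

theorem isClosed_isFlatJet [T2Space B] :
    IsClosed {d : ℕ → C(I, B) | IsFlatJet fun k => d k} := by
  simp only [IsFlatJet, Set.ofPred_forall]
  refine isClosed_iInter fun k => IsClosed.inter ?_ (IsClosed.inter ?_ ?_)
  · exact isClosed_hasDerivOnI.preimage
      ((continuous_apply k).prodMk (continuous_apply (k + 1)) :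
        Continuous fun d : ℕ → C(I, B) => (d k, d (k + 1)))
  · exact isClosed_eq ((continuous_eval_const _).comp (continuous_apply _))
      continuous_const
  · exact isClosed_eq ((continuous_eval_const _).comp (continuous_apply _))
      continuous_const

end Closed

section Algebra

instance (priority := low) IsLCAlg.continuousSMul_real (B : Type*) [NonUnitalRing B] [Module ℂ B]
    [UniformSpace B] [IsLCAlg B] : ContinuousSMul ℝ B := IsScalarTower.continuousSMul ℂ

variable {B : Type*} [NonUnitalRing B] [Module ℂ B] [UniformSpace B] [IsLCAlg B]

theorem HasDerivOnI.mul {f f' g g' : I → B} (h : HasDerivOnI f g) (h' : HasDerivOnI f' g') :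
    HasDerivOnI (f * f') (g * f' + f * g') := fun t => by
  have hc : Tendsto f' (𝓝[≠] t) (𝓝 (f' t)) :=
    (h'.continuous.tendsto t).mono_left nhdsWithin_le_nhds
  refine (((h t).mul hc).add ((h' t).const_mul (f t))).congr fun s => ?_
  rw [smul_mul_assoc, mul_smul_comm, ← smul_add, Pi.mul_apply, Pi.mul_apply, sub_mul, mul_sub,
    sub_add_sub_cancel]

theorem HasDerivOnI.smul {f g : I → B} (c : ℂ) (h : HasDerivOnI f g) :
    HasDerivOnI (c • f) (c • g) :=
  h.map (c • ContinuousLinearMap.id ℝ B)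

theorem HasDerivOnI.sum {ι : Type*} (s : Finset ι) (n : ι → ℕ) {f g : ι → I → B}
    (h : ∀ i ∈ s, HasDerivOnI (f i) (g i)) :
    HasDerivOnI (∑ i ∈ s, n i • f i) (∑ i ∈ s, n i • g i) := by
  classical
  induction s using Finset.induction_on with
  | empty => simpa using HasDerivOnI.zero
  | insert a s ha ih =>
    rw [Finset.sum_insert ha, Finset.sum_insert ha]
    refine HasDerivOnI.add ?_ (ih fun i hi => h i (Finset.mem_insert_of_mem hi))
    have := (h a (Finset.mem_insert_self a s)).smul (n a : ℂ)
    rwa [Nat.cast_smul_eq_nsmul, Nat.cast_smul_eq_nsmul] at this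

/-- The iterated derivatives of a product, by the Leibniz rule. -/
def leibniz (d e : ℕ → I → B) (k : ℕ) : I → B :=
  ∑ ij ∈ Finset.HasAntidiagonal.antidiagonal k, k.choose ij.1 • (d ij.1 * e ij.2)

theorem IsFlatJet.mul {d e : ℕ → I → B} (hd : IsFlatJet d) (he : IsFlatJet e) :
    IsFlatJet (leibniz d e) := by
  have hL : ∀ k, leibniz d e (k + 1) = ∑ ij ∈ Finset.HasAntidiagonal.antidiagonal k,
      k.choose ij.1 • (d (ij.1 + 1) * e ij.2 + d ij.1 * e (ij.2 + 1)) := by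
    intro k
    rw [leibniz, Finset.sum_antidiagonal_choose_succ_nsmul (fun i j => d i * e j)]
    simp only [smul_add, Finset.sum_add_distrib]
    rw [add_comm]
    congr 1
    refine Finset.sum_congr rfl fun ij hij => ?_
    rw [Nat.choose_symm_of_eq_add (Finset.HasAntidiagonal.mem_antidiagonal.1 hij).symm]
  intro k
  have hz : ∀ t : I, (∀ j, d (j + 1) t = 0 ∧ e (j + 1) t = 0) → leibniz d e (k + 1) t = 0 := by
    intro t ht
    rw [hL, Finset.sum_apply]
    refine Finset.sum_eq_zero fun ij _ => ?_
    simp [(ht ij.1).1, (ht ij.2).2]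
  refine ⟨?_, hz 0 fun j => ⟨(hd j).2.1, (he j).2.1⟩, hz 1 fun j => ⟨(hd j).2.2, (he j).2.2⟩⟩
  rw [hL]
  exact HasDerivOnI.sum _ _ fun ij _ => (hd ij.1).1.mul (he ij.2).1

variable (B) in
/-- Smooth functions `[0,1] → B` all of whose derivatives vanish at both end points. -/
def flatSmooth : NonUnitalSubalgebra ℂ (I → B) where
  carrier := {f | ∃ d, IsFlatJet d ∧ d 0 = f}
  zero_mem' := ⟨0, fun _ => ⟨HasDerivOnI.zero, rfl, rfl⟩, rfl⟩
  add_mem' := by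
    rintro _ _ ⟨d, hd, rfl⟩ ⟨e, he, rfl⟩
    refine ⟨d + e, fun k => ⟨(hd k).1.add (he k).1, ?_, ?_⟩, rfl⟩
    · simp [(hd k).2.1, (he k).2.1]
    · simp [(hd k).2.2, (he k).2.2]
  smul_mem' := by
    rintro c _ ⟨d, hd, rfl⟩
    refine ⟨c • d, fun k => ⟨(hd k).1.smul c, ?_, ?_⟩, rfl⟩
    · simp [(hd k).2.1]
    · simp [(hd k).2.2]
  mul_mem' := by
    rintro _ _ ⟨d, hd, rfl⟩ ⟨e, he, rfl⟩
    exact ⟨leibniz d e, hd.mul he, by simp [leibniz]⟩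

variable (B) in
/-- The algebra of smooth functions `[0,1] → B` all of whose derivatives vanish at both end
points, with the topology of uniform convergence of all derivatives. -/
def FlatSmooth : Type _ := flatSmooth B

namespace FlatSmooth

instance : NonUnitalRing (FlatSmooth B) := inferInstanceAs (NonUnitalRing (flatSmooth B))
instance : Module ℂ (FlatSmooth B) := inferInstanceAs (Module ℂ (flatSmooth B))
instance : IsScalarTower ℂ (FlatSmooth B) (FlatSmooth B) :=
  inferInstanceAs (IsScalarTower ℂ (flatSmooth B) (flatSmooth B))
instance : SMulCommClass ℂ (FlatSmooth B) (FlatSmooth B) :=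
  inferInstanceAs (SMulCommClass ℂ (flatSmooth B) (flatSmooth B))

/-- The underlying function. -/
def val : FlatSmooth B →ₙₐ[ℂ] (I → B) := NonUnitalSubalgebraClass.subtype (flatSmooth B)

theorem val_injective : Function.Injective (val : FlatSmooth B → I → B) := Subtype.val_injective

theorem exists_jet (f : FlatSmooth B) : ∃ d, IsFlatJet d ∧ d 0 = val f := f.2

/-- The `k`-th derivative of `f`. -/
def iterDeriv (f : FlatSmooth B) (k : ℕ) : C(I, B) :=
  ⟨(exists_jet f).choose k, (exists_jet f).choose_spec.1.continuous k⟩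

theorem isFlatJet (f : FlatSmooth B) : IsFlatJet fun k => (iterDeriv f k : I → B) :=
  (exists_jet f).choose_spec.1

theorem iterDeriv_zero (f : FlatSmooth B) : (iterDeriv f 0 : I → B) = val f :=
  (exists_jet f).choose_spec.2

theorem iterDeriv_eq {f : FlatSmooth B} {d : ℕ → I → B} (hd : IsFlatJet d) (h : d 0 = val f)
    (k : ℕ) : (iterDeriv f k : I → B) = d k :=
  congrFun ((isFlatJet f).unique hd ((iterDeriv_zero f).trans h.symm)) k

/-- All derivatives of `f`. -/
def jets : FlatSmooth B →ₗ[ℂ] ℕ → C(I, B) where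
  toFun := iterDeriv
  map_add' f g := by
    funext k
    refine DFunLike.coe_injective (iterDeriv_eq (d := fun k => iterDeriv f k + iterDeriv g k)
      (fun k => ⟨(isFlatJet f k).1.add (isFlatJet g k).1, ?_, ?_⟩) ?_ k)
    · exact (congrArg₂ _ (isFlatJet f k).2.1 (isFlatJet g k).2.1).trans (add_zero 0)
    · exact (congrArg₂ _ (isFlatJet f k).2.2 (isFlatJet g k).2.2).trans (add_zero 0)
    · change ⇑(iterDeriv f 0) + ⇑(iterDeriv g 0) = _
      rw [iterDeriv_zero, iterDeriv_zero, map_add]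
  map_smul' c f := by
    funext k
    refine DFunLike.coe_injective (iterDeriv_eq (d := fun k => c • ⇑(iterDeriv f k))
      (fun k => ⟨(isFlatJet f k).1.smul c, ?_, ?_⟩) ?_ k)
    · exact (congrArg (c • ·) (isFlatJet f k).2.1).trans (smul_zero c)
    · exact (congrArg (c • ·) (isFlatJet f k).2.2).trans (smul_zero c)
    · change c • ⇑(iterDeriv f 0) = _
      rw [iterDeriv_zero, map_smul]

theorem jets_mul (f g : FlatSmooth B) (k : ℕ) :
    jets (f * g) k = ∑ ij ∈ Finset.HasAntidiagonal.antidiagonal k, k.choose ij.1 • (jets f ij.1 * jets g ij.2) := by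
  refine DFunLike.coe_injective ((iterDeriv_eq ((isFlatJet f).mul (isFlatJet g)) ?_ k).trans ?_)
  · rw [map_mul, ← iterDeriv_zero, ← iterDeriv_zero]
    simp [leibniz]
  · ext t
    simp only [leibniz, Finset.sum_apply, ContinuousMap.coe_sum]
    rfl

theorem jets_injective : Function.Injective (jets : FlatSmooth B → ℕ → C(I, B)) := fun f g h =>
  val_injective (by rw [← iterDeriv_zero, ← iterDeriv_zero]; exact congrArg (⇑) (congrFun h 0))

theorem range_jets :
    Set.range (jets : FlatSmooth B → ℕ → C(I, B)) = {d | IsFlatJet fun k => (d k : I → B)} := by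
  ext d
  constructor
  · rintro ⟨f, rfl⟩
    exact isFlatJet f
  · intro hd
    exact ⟨⟨d 0, _, hd, rfl⟩, funext fun k => DFunLike.coe_injective (iterDeriv_eq hd rfl k)⟩

/-- The topology of uniform convergence of all derivatives. -/
instance : UniformSpace (FlatSmooth B) := UniformSpace.comap jets inferInstance

theorem isUniformInducing_jets : IsUniformInducing (jets : FlatSmooth B → ℕ → C(I, B)) := ⟨rfl⟩

theorem isInducing_jets : IsInducing (jets : FlatSmooth B → ℕ → C(I, B)) :=
  isUniformInducing_jets.isInducing

instance : ContinuousMul (FlatSmooth B) where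
  continuous_mul := by
    rw [isInducing_jets.continuous_iff]
    refine continuous_pi fun k => ?_
    simp only [Function.comp_apply, jets_mul]
    refine continuous_finsetSum _ fun ij _ => ?_
    have h1 : Continuous fun a : FlatSmooth B × FlatSmooth B => jets a.1 ij.1 :=
      (continuous_apply _).comp (isInducing_jets.continuous.comp continuous_fst)
    have h2 : Continuous fun a : FlatSmooth B × FlatSmooth B => jets a.2 ij.2 :=
      (continuous_apply _).comp (isInducing_jets.continuous.comp continuous_snd)
    exact (h1.mul h2).const_smul (k.choose ij.1)

theorem isUniformAddGroup_C : IsUniformAddGroup C(I, B) :=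
  let f : C(I, B) →+ UniformOnFun I B {K | IsCompact K} :=
    { toFun := ContinuousMap.toUniformOnFunIsCompact
      map_zero' := rfl
      map_add' := fun _ _ => rfl }
  IsUniformInducing.isUniformAddGroup f
    ContinuousMap.isUniformEmbedding_toUniformOnFunIsCompact.isUniformInducing

instance : IsLCAlg (FlatSmooth B) where
  toIsUniformAddGroup :=
    have := isUniformAddGroup_C (B := B)
    IsUniformAddGroup.comap (jets : FlatSmooth B →ₗ[ℂ] ℕ → C(I, B))
  toContinuousSMul := isInducing_jets.continuousSMul continuous_id (map_smul jets _ _)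
  toLocallyConvexSpace := IsInducing.locallyConvexSpace
    (f := (jets : FlatSmooth B →ₗ[ℂ] ℕ → C(I, B)).restrictScalars ℝ) isInducing_jets
  toT2Space := T2Space.of_injective_continuous jets_injective isInducing_jets.continuous
  toCompleteSpace := by
    rw [completeSpace_iff_isComplete_range isUniformInducing_jets, range_jets]
    exact isClosed_isFlatJet.isComplete

/-- Evaluation at a point of the interval. -/
def eval (t : I) : LCHom (FlatSmooth B) B where
  toFun f := val f t
  map_smul' c f := rfl
  map_zero' := rfl
  map_add' f g := rfl
  map_mul' f g := rfl
  cont := by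
    have : (fun f : FlatSmooth B => val f t) = fun f => jets f 0 t :=
      funext fun f => (congrFun (iterDeriv_zero f) t).symm
    change Continuous fun f : FlatSmooth B => val f t
    rw [this]
    exact (continuous_eval_const t).comp ((continuous_apply 0).comp isInducing_jets.continuous)

end FlatSmooth

end Algebra

end FlatSmooth

/-- The algebra of smooth functions `[0,1] → B` with flat ends, as an object of the category. -/
abbrev LCAlg.flat (B : LCAlg) : LCAlg := .of (FlatSmooth B)

/-! ## Schatten classes -/

section Schatten

variable {E : Type*} [NormedAddCommGroup E] [InnerProductSpace ℂ E]

/-- The Schatten `p`-norm, for `p ≥ 1`: the supremum of `(∑ |⟨eᵢ, T fᵢ⟩| ^ p) ^ (1 / p)` over all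
finite orthonormal families `(eᵢ)`, `(fᵢ)`; it equals the `ℓ^p`-norm of the sequence of singular
values, and is infinite if `T` is not compact. -/
def schattenENorm (p : ℝ) (T : E →L[ℂ] E) : ℝ≥0∞ :=
  ⨆ (n : ℕ) (e : {e : Fin n → E // Orthonormal ℂ e}) (f : {f : Fin n → E // Orthonormal ℂ f}),
    (∑ i, ‖inner ℂ (e.1 i) (T (f.1 i))‖ₑ ^ p) ^ (1 / p)

variable {p : ℝ}

theorem le_schattenENorm (T : E →L[ℂ] E) {n : ℕ} {e f : Fin n → E} (he : Orthonormal ℂ e)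
    (hf : Orthonormal ℂ f) :
    (∑ i, ‖inner ℂ (e i) (T (f i))‖ₑ ^ p) ^ (1 / p) ≤ schattenENorm p T :=
  le_iSup_of_le n (le_iSup_of_le ⟨e, he⟩ (le_iSup_of_le ⟨f, hf⟩ le_rfl))

theorem schattenENorm_le {T : E →L[ℂ] E} {C : ℝ≥0∞}
    (h : ∀ (n : ℕ) (e f : Fin n → E), Orthonormal ℂ e → Orthonormal ℂ f →
      (∑ i, ‖inner ℂ (e i) (T (f i))‖ₑ ^ p) ^ (1 / p) ≤ C) : schattenENorm p T ≤ C :=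
  iSup_le fun n => iSup_le fun e => iSup_le fun f => h n e.1 f.1 e.2 f.2

theorem schattenENorm_zero (hp : 1 ≤ p) : schattenENorm p (0 : E →L[ℂ] E) = 0 := by
  have hp0 : 0 < p := by linarith
  refine le_antisymm (schattenENorm_le fun n e f he hf => ?_) zero_le
  simp [hp0]

theorem schattenENorm_add_le (hp : 1 ≤ p) (S T : E →L[ℂ] E) :
    schattenENorm p (S + T) ≤ schattenENorm p S + schattenENorm p T := by
  have hp0 : 0 < p := by linarith
  refine schattenENorm_le fun n e f he hf => ?_
  refine le_trans ?_ ((ENNReal.Lp_add_le Finset.univ (fun i => ‖inner ℂ (e i) (S (f i))‖ₑ)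
    (fun i => ‖inner ℂ (e i) (T (f i))‖ₑ) hp).trans
    (add_le_add (le_schattenENorm S he hf) (le_schattenENorm T he hf)))
  gcongr with i
  rw [_root_.add_apply, inner_add_right]
  exact enorm_add_le _ _

theorem schattenENorm_smul_le (hp : 1 ≤ p) (c : ℂ) (T : E →L[ℂ] E) :
    schattenENorm p (c • T) ≤ ‖c‖ₑ * schattenENorm p T := by
  have hp0 : 0 < p := by linarith
  refine schattenENorm_le fun n e f he hf => ?_
  refine le_trans (le_of_eq ?_) (mul_le_mul_right (le_schattenENorm T he hf) ‖c‖ₑ)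
  simp only [_root_.smul_apply, inner_smul_right, enorm_mul,
    ENNReal.mul_rpow_of_nonneg _ _ hp0.le]
  rw [← Finset.mul_sum, ENNReal.mul_rpow_of_nonneg _ _ (by positivity), ← ENNReal.rpow_mul,
    mul_one_div_cancel hp0.ne', ENNReal.rpow_one]

theorem enorm_inner_le_schattenENorm (hp : 1 ≤ p) (T : E →L[ℂ] E) {x y : E} (hx : ‖x‖ = 1)
    (hy : ‖y‖ = 1) : ‖inner ℂ x (T y)‖ₑ ≤ schattenENorm p T := by
  have hp0 : 0 < p := by linarith
  have h1 : ∀ z : E, ‖z‖ = 1 → Orthonormal ℂ fun _ : Fin 1 => z := fun z hz =>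
    ⟨fun _ => hz, fun i j hij => absurd (Subsingleton.elim i j) hij⟩
  have := le_schattenENorm (p := p) T (h1 x hx) (h1 y hy)
  rwa [Fin.sum_univ_one, ← ENNReal.rpow_mul, mul_one_div_cancel hp0.ne', ENNReal.rpow_one] at this

/-- The operator norm is bounded by the Schatten norm. -/
theorem enorm_le_schattenENorm (hp : 1 ≤ p) (T : E →L[ℂ] E) : ‖T‖ₑ ≤ schattenENorm p T := by
  by_cases htop : schattenENorm p T = ∞
  · rw [htop]; exact le_top
  rw [← ENNReal.ofReal_toReal htop, ← ofReal_norm]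
  refine ENNReal.ofReal_le_ofReal (T.opNorm_le_bound ENNReal.toReal_nonneg fun y => ?_)
  rcases eq_or_ne y 0 with rfl | hy
  · simp
  rcases eq_or_ne (T y) 0 with hT | hT
  · rw [hT, norm_zero]; positivity
  have hy' : ‖y‖ ≠ 0 := norm_ne_zero_iff.2 hy
  have hT' : ‖T y‖ ≠ 0 := norm_ne_zero_iff.2 hT
  have h := enorm_inner_le_schattenENorm hp T (x := ((‖T y‖⁻¹ : ℝ) : ℂ) • T y)
    (y := ((‖y‖⁻¹ : ℝ) : ℂ) • y) (by rw [norm_smul]; simp [hT']) (by rw [norm_smul]; simp [hy'])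
  rw [← ofReal_norm, ENNReal.ofReal_le_iff_le_toReal htop, map_smul, inner_smul_left,
    inner_smul_right, inner_self_eq_norm_sq_to_K] at h
  simp only [Complex.conj_ofReal, norm_mul, Complex.norm_real, norm_inv, norm_norm, norm_pow,
    Complex.coe_algebraMap] at h
  have e : ‖T y‖⁻¹ * (‖y‖⁻¹ * ‖T y‖ ^ 2) = ‖T y‖ / ‖y‖ := by
    field_simp
  rw [e, div_le_iff₀ (lt_of_le_of_ne (norm_nonneg _) hy'.symm)] at h
  exact h

variable [CompleteSpace E]

theorem schattenENorm_unitary_mul (u : unitary (E →L[ℂ] E)) (T : E →L[ℂ] E) :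
    schattenENorm p ((u : E →L[ℂ] E) * T) ≤ schattenENorm p T := by
  refine schattenENorm_le fun n e f he hf => ?_
  have h : Orthonormal ℂ fun i => (star (u : E →L[ℂ] E)) (e i) := by
    rw [orthonormal_iff_ite] at he ⊢
    intro i j
    rw [← he i j, ContinuousLinearMap.star_eq_adjoint, ContinuousLinearMap.adjoint_inner_left,
      ← ContinuousLinearMap.star_eq_adjoint, ← mul_apply_eq_comp,
      Unitary.mul_star_self_of_mem u.2, one_apply_eq_self]
  refine le_trans (le_of_eq ?_) (le_schattenENorm T h hf)
  simp [ContinuousLinearMap.star_eq_adjoint, ContinuousLinearMap.adjoint_inner_left]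

theorem schattenENorm_mul_unitary (u : unitary (E →L[ℂ] E)) (T : E →L[ℂ] E) :
    schattenENorm p (T * (u : E →L[ℂ] E)) ≤ schattenENorm p T := by
  refine schattenENorm_le fun n e f he hf => ?_
  have h : Orthonormal ℂ fun i => (u : E →L[ℂ] E) (f i) := by
    rw [orthonormal_iff_ite] at hf ⊢
    intro i j
    rw [← hf i j, ← ContinuousLinearMap.adjoint_inner_right,
      ← ContinuousLinearMap.star_eq_adjoint, ← mul_apply_eq_comp,
      Unitary.star_mul_self_of_mem u.2, one_apply_eq_self]
  exact le_schattenENorm T he h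

theorem schattenENorm_sum_le (hp : 1 ≤ p) {ι : Type*} (s : Finset ι) (T : ι → E →L[ℂ] E) :
    schattenENorm p (∑ i ∈ s, T i) ≤ ∑ i ∈ s, schattenENorm p (T i) := by
  classical
  induction s using Finset.induction_on with
  | empty => simp [schattenENorm_zero hp]
  | insert a s ha ih =>
    rw [Finset.sum_insert ha, Finset.sum_insert ha]
    exact (schattenENorm_add_le hp _ _).trans (add_le_add le_rfl ih)

theorem schattenENorm_mul_le (hp : 1 ≤ p) (S T : E →L[ℂ] E) :
    schattenENorm p (S * T) ≤ 2 * (schattenENorm p S * schattenENorm p T) := by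
  obtain ⟨u, c, hS, hc⟩ := CStarAlgebra.exists_sum_four_unitary S
  have hc' : ∀ i, ‖c i‖ₑ ≤ ‖S‖ₑ / 2 := fun i => by
    rw [← ofReal_norm, ← ofReal_norm, ← ENNReal.ofReal_ofNat 2,
      ← ENNReal.ofReal_div_of_pos two_pos]
    exact ENNReal.ofReal_le_ofReal (hc i)
  have h1 : schattenENorm p (S * T) ≤ ∑ _i : Fin 4, ‖S‖ₑ / 2 * schattenENorm p T := by
    nth_rewrite 1 [hS]
    rw [Finset.sum_mul]
    refine (schattenENorm_sum_le hp _ _).trans (Finset.sum_le_sum fun i _ => ?_)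
    rw [smul_mul_assoc]
    exact (schattenENorm_smul_le hp _ _).trans
      (mul_le_mul' (hc' i) (schattenENorm_unitary_mul (u i) T))
  refine h1.trans ?_
  rw [Finset.sum_const, Finset.card_univ, Fintype.card_fin, nsmul_eq_mul, ← mul_assoc, ← mul_assoc]
  refine mul_le_mul' ?_ le_rfl
  refine le_trans (le_of_eq ?_) (mul_le_mul' le_rfl (enorm_le_schattenENorm hp S))
  rw [← mul_div_assoc, mul_comm, mul_div_assoc, mul_comm]
  congr 1
  rw [ENNReal.div_eq_inv_mul, show ((4 : ℕ) : ℝ≥0∞) = 2 * 2 by norm_num, ← mul_assoc,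
    ENNReal.inv_mul_cancel (by norm_num) (by norm_num), one_mul]

/-- The Schatten class as a subalgebra of the bounded operators. -/
def schattenSubalgebra (p : ℝ) (E : Type*) [NormedAddCommGroup E] [InnerProductSpace ℂ E]
    [CompleteSpace E] [hp : Fact (1 ≤ p)] : NonUnitalSubalgebra ℂ (E →L[ℂ] E) where
  carrier := {T | schattenENorm p T < ∞}
  zero_mem' := by
    change schattenENorm p 0 < ∞
    rw [schattenENorm_zero hp.out]; exact ENNReal.zero_lt_top
  add_mem' hS hT := (schattenENorm_add_le hp.out _ _).trans_lt (ENNReal.add_lt_top.2 ⟨hS, hT⟩)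
  smul_mem' c _ hT := (schattenENorm_smul_le hp.out c _).trans_lt (ENNReal.mul_lt_top (by simp) hT)
  mul_mem' hS hT := (schattenENorm_mul_le hp.out _ _).trans_lt
    (ENNReal.mul_lt_top (by simp) (ENNReal.mul_lt_top hS hT))

/-- The Schatten class `L^p` of a Hilbert space, with the Schatten norm. -/
def Schatten (p : ℝ) (E : Type*) [NormedAddCommGroup E] [InnerProductSpace ℂ E]
    [CompleteSpace E] [Fact (1 ≤ p)] : Type _ := schattenSubalgebra p E

namespace Schatten

variable [hp : Fact (1 ≤ p)]

instance : NonUnitalRing (Schatten p E) := inferInstanceAs (NonUnitalRing (schattenSubalgebra p E))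
instance : Module ℂ (Schatten p E) := inferInstanceAs (Module ℂ (schattenSubalgebra p E))
instance : IsScalarTower ℂ (Schatten p E) (Schatten p E) :=
  inferInstanceAs (IsScalarTower ℂ (schattenSubalgebra p E) (schattenSubalgebra p E))
instance : SMulCommClass ℂ (Schatten p E) (Schatten p E) :=
  inferInstanceAs (SMulCommClass ℂ (schattenSubalgebra p E) (schattenSubalgebra p E))

/-- The inclusion of the Schatten class in the bounded operators. -/
def incl (p : ℝ) (E : Type*) [NormedAddCommGroup E] [InnerProductSpace ℂ E]
    [CompleteSpace E] [Fact (1 ≤ p)] : Schatten p E →ₙₐ[ℂ] (E →L[ℂ] E) :=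
  NonUnitalSubalgebraClass.subtype (schattenSubalgebra p E)

theorem incl_injective : Function.Injective (incl p E) := Subtype.val_injective

theorem lt_top (T : Schatten p E) : schattenENorm p (incl p E T) < ∞ := T.2

instance : Norm (Schatten p E) := ⟨fun T => (schattenENorm p (incl p E T)).toReal⟩

theorem norm_def (T : Schatten p E) : ‖T‖ = (schattenENorm p (incl p E T)).toReal := rfl

theorem norm_incl_le (T : Schatten p E) : ‖incl p E T‖ ≤ ‖T‖ := by
  rw [norm_def, ← toReal_enorm]
  exact ENNReal.toReal_mono (lt_top T).ne (enorm_le_schattenENorm hp.out _)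

theorem norm_smul_le' (c : ℂ) (T : Schatten p E) : ‖c • T‖ ≤ ‖c‖ * ‖T‖ := by
  rw [norm_def, norm_def, map_smul, ← toReal_enorm c, ← ENNReal.toReal_mul]
  exact ENNReal.toReal_mono (ENNReal.mul_lt_top (by simp) (lt_top T)).ne
    (schattenENorm_smul_le hp.out c _)

theorem core : NormedSpace.Core ℂ (Schatten p E) where
  norm_nonneg T := ENNReal.toReal_nonneg
  norm_smul c T := by
    refine le_antisymm (norm_smul_le' c T) ?_
    rcases eq_or_ne c 0 with rfl | hc
    · rw [norm_zero, zero_mul]; exact ENNReal.toReal_nonneg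
    have := norm_smul_le' c⁻¹ (c • T)
    rwa [inv_smul_smul₀ hc, norm_inv, ← div_eq_inv_mul,
      le_div_iff₀ (norm_pos_iff.2 hc), mul_comm] at this
  norm_triangle S T := by
    rw [norm_def, norm_def, norm_def, map_add, ← ENNReal.toReal_add (lt_top S).ne (lt_top T).ne]
    exact ENNReal.toReal_mono (ENNReal.add_lt_top.2 ⟨lt_top S, lt_top T⟩).ne
      (schattenENorm_add_le hp.out _ _)
  norm_eq_zero_iff T := by
    constructor
    · intro h
      have := norm_incl_le T
      rw [h] at this
      exact incl_injective (by rw [map_zero]; exact norm_le_zero_iff.1 this)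
    · rintro rfl
      rw [norm_def, map_zero, schattenENorm_zero hp.out, ENNReal.toReal_zero]

instance : NormedAddCommGroup (Schatten p E) := NormedAddCommGroup.ofCore core
instance : NormedSpace ℂ (Schatten p E) := NormedSpace.ofCore core

theorem norm_mul_le' (S T : Schatten p E) : ‖S * T‖ ≤ 2 * ‖S‖ * ‖T‖ := by
  rw [norm_def, norm_def, norm_def, map_mul, mul_assoc, ← ENNReal.toReal_mul,
    ← ENNReal.toReal_ofNat 2, ← ENNReal.toReal_mul]
  exact ENNReal.toReal_mono (ENNReal.mul_lt_top (by simp)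
    (ENNReal.mul_lt_top (lt_top S) (lt_top T))).ne (schattenENorm_mul_le hp.out _ _)

instance : ContinuousMul (Schatten p E) where
  continuous_mul := ((LinearMap.mul ℂ (Schatten p E)).mkContinuous₂ 2 norm_mul_le').continuous₂

/-- The Schatten norm is lower semicontinuous for the operator norm. -/
theorem schattenENorm_le_of_tendsto {u : ℕ → E →L[ℂ] E} {T : E →L[ℂ] E}
    (hu : Tendsto u atTop (𝓝 T)) {C : ℝ≥0∞}
    (h : ∀ᶠ n in atTop, schattenENorm p (u n) ≤ C) : schattenENorm p T ≤ C := by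
  refine schattenENorm_le fun n e f he hf => ?_
  have hc : Continuous fun S : E →L[ℂ] E =>
      (∑ i, ‖inner ℂ (e i) (S (f i))‖ₑ ^ p) ^ (1 / p) := by
    have h1 : ∀ i, Continuous fun S : E →L[ℂ] E => inner ℂ (e i) (S (f i)) := fun i =>
      continuous_const.inner (ContinuousLinearMap.apply ℂ E (f i)).continuous
    exact ENNReal.continuous_rpow_const.comp (continuous_finsetSum _ fun i _ =>
      ENNReal.continuous_rpow_const.comp (h1 i).enorm)
  exact le_of_tendsto ((hc.tendsto T).comp hu)
    (h.mono fun k hk => (le_schattenENorm (u k) he hf).trans hk)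

instance : CompleteSpace (Schatten p E) := by
  refine Metric.complete_of_cauchySeq_tendsto fun u hu => ?_
  have hd : ∀ a b, ‖incl p E (u a) - incl p E (u b)‖ ≤ dist (u a) (u b) := fun a b => by
    rw [← map_sub, dist_eq_norm]; exact norm_incl_le _
  have hc : CauchySeq fun n => incl p E (u n) := by
    rw [Metric.cauchySeq_iff'] at hu ⊢
    intro ε hε
    obtain ⟨N, hN⟩ := hu ε hε
    exact ⟨N, fun n hn => by rw [dist_eq_norm]; exact (hd n N).trans_lt (hN n hn)⟩
  obtain ⟨T, hT⟩ := cauchySeq_tendsto_of_complete hc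
  have key : ∀ ε : ℝ, 0 < ε → ∃ N, ∀ n ≥ N,
      schattenENorm p (incl p E (u n) - T) ≤ ENNReal.ofReal ε := by
    intro ε hε
    obtain ⟨N, hN⟩ := Metric.cauchySeq_iff.1 hu ε hε
    refine ⟨N, fun n hn => schattenENorm_le_of_tendsto (hT.const_sub (incl p E (u n))) ?_⟩
    filter_upwards [eventually_ge_atTop N] with m hm
    have h := (hN n hn m hm).le
    rw [dist_eq_norm, norm_def, map_sub] at h
    have ht := lt_top (u n - u m)
    rw [map_sub] at ht
    rwa [ENNReal.le_ofReal_iff_toReal_le ht.ne hε.le]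
  have hTmem : schattenENorm p T < ∞ := by
    obtain ⟨N, hN⟩ := key 1 one_pos
    have h1 : incl p E (u N) + (-1 : ℂ) • (incl p E (u N) - T) = T := by
      rw [neg_one_smul]; abel
    rw [← h1]
    exact (schattenENorm_add_le hp.out _ _).trans_lt (ENNReal.add_lt_top.2 ⟨lt_top _,
      (schattenENorm_smul_le hp.out _ _).trans_lt (ENNReal.mul_lt_top (by simp)
        ((hN N le_rfl).trans_lt ENNReal.ofReal_lt_top))⟩)
  let S : Schatten p E := ⟨T, hTmem⟩
  have hS : incl p E S = T := rfl
  refine ⟨S, Metric.tendsto_atTop.2 fun ε hε => ?_⟩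
  obtain ⟨N, hN⟩ := key (ε / 2) (half_pos hε)
  refine ⟨N, fun n hn => ?_⟩
  rw [dist_eq_norm, norm_def, map_sub, hS]
  exact (ENNReal.toReal_le_of_le_ofReal (half_pos hε).le (hN n hn)).trans_lt (half_lt_self hε)

instance : IsLCAlg (Schatten p E) where

end Schatten

end Schatten

/-! ## Functors on locally convex algebras -/

/-- `0 → B → D → A → 0` is an extension of locally convex algebras, split by the morphism `s`:
`ι` is a homeomorphism onto the kernel of `π`, and `π ∘ s = id`. -/
structure IsSplitExtension {B D A : Type*} [NonUnitalRing B] [Module ℂ B] [UniformSpace B]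
    [NonUnitalRing D] [Module ℂ D] [UniformSpace D] [NonUnitalRing A] [Module ℂ A]
    [UniformSpace A] (ι : LCHom B D) (π : LCHom D A) (s : LCHom A D) : Prop where
  isEmbedding : IsEmbedding ι
  exact : ∀ x, π x = 0 ↔ x ∈ Set.range ι
  split : ∀ a, π (s a) = a

/-- A functor to abelian groups is split exact if it maps every split extension
`0 → B → D → A → 0` to a short exact sequence. -/
def SplitExact (H : LCAlg ⥤ AddCommGrpCat.{w}) : Prop :=
  ∀ ⦃B D A : LCAlg⦄ (ι : LCHom B D) (π : LCHom D A) (s : LCHom A D), IsSplitExtension ι π s →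
    Function.Injective (H.map (LCAlg.ofHom ι)) ∧
    (∀ x, H.map (LCAlg.ofHom π) x = 0 ↔ x ∈ Set.range (H.map (LCAlg.ofHom ι))) ∧
    Function.Surjective (H.map (LCAlg.ofHom π))

/-- A functor is diffotopy invariant if the evaluations at `0` and `1` of every morphism
`A → 𝒵B` have the same image. -/
def DiffotopyInvariant (H : LCAlg ⥤ AddCommGrpCat.{w}) : Prop :=
  ∀ ⦃A B : LCAlg⦄ (φ : LCHom A (FlatSmooth B)),
    H.map (LCAlg.ofHom ((FlatSmooth.eval 0).comp φ)) =
      H.map (LCAlg.ofHom ((FlatSmooth.eval 1).comp φ))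

/-- The stabilisation map `H(A) → H(A ⊗ J)` induced by `a ↦ a ⊗ e`, for an idempotent `e` of
`J`. -/
def stabMap (H : LCAlg ⥤ AddCommGrpCat.{w}) {J : LCAlg} (e : J) (he : e * e = e) (A : LCAlg) :
    H.obj A ⟶ H.obj (A.tensor J) :=
  H.map (LCAlg.ofHom (ProjTensor.tmulRight A e he))

/-- A functor is stable for `J`, with respect to the idempotent `e` of `J`, if all stabilisation
maps are isomorphisms. -/
def IsStable (H : LCAlg ⥤ AddCommGrpCat.{w}) {J : LCAlg} (e : J) (he : e * e = e) : Prop :=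
  ∀ A : LCAlg, IsIso (stabMap H e he A)

namespace IsSplitExtension

variable {B D A : Type*} [NonUnitalRing B] [Module ℂ B] [UniformSpace B]
    [NonUnitalRing D] [Module ℂ D] [UniformSpace D] [NonUnitalRing A] [Module ℂ A]
    [UniformSpace A] {ι : LCHom B D} {π : LCHom D A} {s : LCHom A D}

theorem exists_retract [IsLCAlg D] [IsLCAlg B] (h : IsSplitExtension ι π s) (x : D) :
    ∃ b, ι b = x - s (π x) :=
  (h.exact _).1 (by rw [map_sub, h.split, sub_self])

/-- A continuous linear retraction of `ι`. -/
theorem exists_retraction [IsLCAlg D] [IsLCAlg B] (h : IsSplitExtension ι π s) :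
    ∃ r : D →L[ℂ] B, ∀ x, ι (r x) = x - s (π x) := by
  choose r hr using h.exists_retract
  have hi := h.isEmbedding.injective
  refine ⟨⟨⟨⟨r, fun x y => hi ?_⟩, fun c x => hi ?_⟩, ?_⟩, hr⟩
  · rw [map_add, hr, hr, hr, map_add, map_add]; abel
  · change ι (r (c • x)) = ι (c • r x)
    rw [map_smul, hr, hr, map_smul, map_smul, smul_sub]
  · refine h.isEmbedding.isInducing.continuous_iff.2 ?_
    change Continuous fun x => ι (r x)
    simp only [hr]
    exact continuous_id.sub (s.continuous.comp π.continuous)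

/-- The completed projective tensor product preserves split extensions. -/
theorem tensor [IsLCAlg B] [IsLCAlg D] [IsLCAlg A] (h : IsSplitExtension ι π s) (C : Type*)
    [NonUnitalRing C] [Module ℂ C] [UniformSpace C] [IsLCAlg C] :
    IsSplitExtension (ProjTensor.map ι (LCHom.id C)) (ProjTensor.map π (LCHom.id C))
      (ProjTensor.map s (LCHom.id C)) := by
  obtain ⟨r, hr⟩ := h.exists_retraction
  have hi := h.isEmbedding.injective
  have hπι : ∀ b, π (ι b) = 0 := fun b => (h.exact _).2 ⟨b, rfl⟩
  have hrι : ∀ b, r (ι b) = b := fun b => hi (by rw [hr, hπι, map_zero, sub_zero])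
  have key : ∀ x : ProjTensor D C, ProjTensor.map ι (LCHom.id C)
      (ProjTensor.mapCLM r (LCHom.id C).toCLM x) =
        x - ProjTensor.map s (LCHom.id C) (ProjTensor.map π (LCHom.id C) x) := by
    intro x
    have := ProjTensor.ext_tmul (A := D) (B := C)
      (f := (ProjTensor.map ι (LCHom.id C)).toCLM.comp (ProjTensor.mapCLM r (LCHom.id C).toCLM))
      (g := ContinuousLinearMap.id ℂ _ - (ProjTensor.map s (LCHom.id C)).toCLM.comp
        (ProjTensor.map π (LCHom.id C)).toCLM) (fun d c => by
          simp only [ContinuousLinearMap.comp_apply, LCHom.toCLM_apply, ProjTensor.mapCLM_tmul,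
            ProjTensor.map_tmul, LCHom.id_apply, hr, _root_.sub_apply,
            ContinuousLinearMap.id_apply]
          exact LinearMap.map_sub₂ ProjTensor.tmulBilin d (s (π d)) c)
    exact DFunLike.congr_fun this x
  have key' : ∀ x : ProjTensor B C, ProjTensor.mapCLM r (LCHom.id C).toCLM
      (ProjTensor.map ι (LCHom.id C) x) = x := by
    intro x
    have := ProjTensor.ext_tmul (A := B) (B := C)
      (f := (ProjTensor.mapCLM r (LCHom.id C).toCLM).comp (ProjTensor.map ι (LCHom.id C)).toCLM)
      (g := ContinuousLinearMap.id ℂ _) (fun b c => by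
          simp only [ContinuousLinearMap.comp_apply, LCHom.toCLM_apply, ProjTensor.mapCLM_tmul,
            ProjTensor.map_tmul, LCHom.id_apply, hrι, ContinuousLinearMap.id_apply])
    exact DFunLike.congr_fun this x
  have key'' : ∀ x : ProjTensor B C, ProjTensor.map π (LCHom.id C)
      (ProjTensor.map ι (LCHom.id C) x) = 0 := by
    intro x
    have := ProjTensor.ext_tmul (A := B) (B := C)
      (f := (ProjTensor.map π (LCHom.id C)).toCLM.comp (ProjTensor.map ι (LCHom.id C)).toCLM)
      (g := 0) (fun b c => by
          simp only [ContinuousLinearMap.comp_apply, LCHom.toCLM_apply,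
            ProjTensor.map_tmul, LCHom.id_apply, hπι, _root_.zero_apply]
          exact LinearMap.map_zero₂ ProjTensor.tmulBilin c)
    exact DFunLike.congr_fun this x
  refine ⟨IsEmbedding.of_leftInverse key' (ContinuousLinearMap.continuous _)
    (LCHom.continuous _), fun x => ⟨fun hx => ⟨_, (key x).trans ?_⟩, ?_⟩, fun x => ?_⟩
  · rw [hx, map_zero, sub_zero]
  · rintro ⟨y, rfl⟩
    exact key'' y
  · have := ProjTensor.ext_tmul (A := A) (B := C)
      (f := (ProjTensor.map π (LCHom.id C)).toCLM.comp (ProjTensor.map s (LCHom.id C)).toCLM)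
      (g := ContinuousLinearMap.id ℂ _) (fun b c => by
          simp only [ContinuousLinearMap.comp_apply, LCHom.toCLM_apply,
            ProjTensor.map_tmul, LCHom.id_apply, h.split, ContinuousLinearMap.id_apply])
    exact DFunLike.congr_fun this x

end IsSplitExtension

/-- A double split extension: an extension `0 → B → D → A → 0` with two splitting morphisms. -/
structure DoubleSplitExt (A B : LCAlg) where
  D : LCAlg
  ι : LCHom B D
  π : LCHom D A
  α : LCHom A D
  β : LCHom A D
  split_α : IsSplitExtension ι π α
  split_β : IsSplitExtension ι π β

namespace DoubleSplitExt

variable {A B : LCAlg}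

/-- The tensor product of a double split extension with a locally convex algebra. -/
def tensor (S : DoubleSplitExt A B) (C : LCAlg) : DoubleSplitExt (A.tensor C) (B.tensor C) where
  D := S.D.tensor C
  ι := ProjTensor.map S.ι (LCHom.id C)
  π := ProjTensor.map S.π (LCHom.id C)
  α := ProjTensor.map S.α (LCHom.id C)
  β := ProjTensor.map S.β (LCHom.id C)
  split_α := S.split_α.tensor C
  split_β := S.split_β.tensor C

variable (S : DoubleSplitExt A B) (H : LCAlg ⥤ AddCommGrpCat.{w})

/-- The difference `H(α) - H(β)`. -/
def diff : H.obj A ⟶ H.obj S.D := H.map (LCAlg.ofHom S.α) - H.map (LCAlg.ofHom S.β)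

theorem diff_mem (hH : SplitExact H) (x : H.obj A) : S.diff H x ∈ (H.map (LCAlg.ofHom S.ι)).hom.range := by
  obtain ⟨-, h, -⟩ := hH S.ι S.π S.α S.split_α
  refine (h _).1 ?_
  have h1 : (LCAlg.ofHom S.α) ≫ (LCAlg.ofHom S.π) = 𝟙 A := LCHom.ext S.split_α.split
  have h2 : (LCAlg.ofHom S.β) ≫ (LCAlg.ofHom S.π) = 𝟙 A := LCHom.ext S.split_β.split
  have : S.diff H ≫ H.map (LCAlg.ofHom S.π) = 0 := by
    rw [diff, Preadditive.sub_comp, ← H.map_comp, ← H.map_comp, h1, h2, sub_self]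
  exact ConcreteCategory.congr_hom this x

/-- The homomorphism `H(ι)⁻¹ ∘ (H(α) - H(β)) : H(A) → H(B)` induced by a double split extension
under a split exact functor. -/
def induced (hH : SplitExact H) : H.obj A ⟶ H.obj B :=
  AddCommGrpCat.ofHom
    ((AddMonoidHom.ofInjective (f := (H.map (LCAlg.ofHom S.ι)).hom)
      (hH S.ι S.π S.α S.split_α).1).symm.toAddMonoidHom.comp
        ((S.diff H).hom.codRestrict _ (S.diff_mem H hH)))

theorem induced_comp (hH : SplitExact H) : S.induced H hH ≫ H.map (LCAlg.ofHom S.ι) =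
    H.map (LCAlg.ofHom S.α) - H.map (LCAlg.ofHom S.β) := by
  ext x
  exact AddMonoidHom.apply_ofInjective_symm (f := (H.map (LCAlg.ofHom S.ι)).hom)
    (hH S.ι S.π S.α S.split_α).1 ⟨S.diff H x, S.diff_mem H hH x⟩

end DoubleSplitExt

/-! ## Quasihomomorphisms -/

section Quasihomomorphisms

/-- A map to `M` is `B`-valued and continuous as a map to `B`; here `B` is a subalgebra of `M` via
the injective homomorphism `j`, and carries its own topology. -/
def ContValued {X B M : Type*} [TopologicalSpace X] [TopologicalSpace B] [NonUnitalRing B]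
    [Module ℂ B] [NonUnitalRing M] [Module ℂ M] (j : B →ₙₐ[ℂ] M) (f : X → M) : Prop :=
  ∃ g : X → B, Continuous g ∧ ∀ x, j (g x) = f x

/-- A quasihomomorphism `(α, β)` from `A` to `B`, relative to an algebra `M` which contains `B` as
a subalgebra via `j`; no topology on `M` is involved. -/
structure LCQuasihom (A B M : Type*) [NonUnitalRing A] [Module ℂ A] [UniformSpace A]
    [NonUnitalRing B] [Module ℂ B] [UniformSpace B] [NonUnitalRing M] [Module ℂ M]
    (j : B →ₙₐ[ℂ] M) where
  inj : Function.Injective j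
  α : A →ₙₐ[ℂ] M
  β : A →ₙₐ[ℂ] M
  diff : ContValued j fun a => α a - β a
  left : ContValued j fun x : A × B => α x.1 * j x.2
  right : ContValued j fun x : B × A => j x.1 * α x.2

namespace LCQuasihom

variable {A B M : Type*} [NonUnitalRing A] [Module ℂ A] [UniformSpace A] [IsLCAlg A]
    [NonUnitalRing B] [Module ℂ B] [UniformSpace B] [IsLCAlg B] [NonUnitalRing M] [Module ℂ M]
    [IsScalarTower ℂ M M] [SMulCommClass ℂ M M] {j : B →ₙₐ[ℂ] M} (Q : LCQuasihom A B M j)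

/-- `α(a) - β(a)` as an element of `B`. -/
def diffB (a : A) : B := Q.diff.choose a
/-- `α(a) b` as an element of `B`. -/
def leftB (x : A × B) : B := Q.left.choose x
/-- `b α(a)` as an element of `B`. -/
def rightB (x : B × A) : B := Q.right.choose x

theorem continuous_diffB : Continuous Q.diffB := Q.diff.choose_spec.1
theorem continuous_leftB : Continuous Q.leftB := Q.left.choose_spec.1
theorem continuous_rightB : Continuous Q.rightB := Q.right.choose_spec.1
theorem j_diffB (a : A) : j (Q.diffB a) = Q.α a - Q.β a := Q.diff.choose_spec.2 a
theorem j_leftB (x : A × B) : j (Q.leftB x) = Q.α x.1 * j x.2 := Q.left.choose_spec.2 x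
theorem j_rightB (x : B × A) : j (Q.rightB x) = j x.1 * Q.α x.2 := Q.right.choose_spec.2 x

/-- The algebra `D_α`: the topological direct sum `A ⊕ B` with multiplication
`(a, b) (a', b') = (a a', α(a) b' + b α(a') + b b')`. -/
def D (_ : LCQuasihom A B M j) : Type _ := A × B

namespace D

instance : AddCommGroup Q.D := inferInstanceAs (AddCommGroup (A × B))
instance : Module ℂ Q.D := inferInstanceAs (Module ℂ (A × B))
instance : UniformSpace Q.D := inferInstanceAs (UniformSpace (A × B))
instance : IsUniformAddGroup Q.D := inferInstanceAs (IsUniformAddGroup (A × B))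
instance : ContinuousSMul ℂ Q.D := inferInstanceAs (ContinuousSMul ℂ (A × B))
instance : LocallyConvexSpace ℝ Q.D := inferInstanceAs (LocallyConvexSpace ℝ (A × B))
instance : T2Space Q.D := inferInstanceAs (T2Space (A × B))
instance : CompleteSpace Q.D := inferInstanceAs (CompleteSpace (A × B))

instance : Mul Q.D :=
  ⟨fun x y => (x.1 * y.1, Q.leftB (x.1, y.2) + Q.rightB (x.2, y.1) + x.2 * y.2)⟩

variable {Q}

theorem fst_mul (x y : Q.D) : (x * y).1 = x.1 * y.1 := rfl
theorem snd_mul (x y : Q.D) :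
    (x * y).2 = Q.leftB (x.1, y.2) + Q.rightB (x.2, y.1) + x.2 * y.2 := rfl
theorem fst_add (x y : Q.D) : (x + y).1 = x.1 + y.1 := rfl
theorem snd_add (x y : Q.D) : (x + y).2 = x.2 + y.2 := rfl
theorem fst_zero : (0 : Q.D).1 = 0 := rfl
theorem snd_zero : (0 : Q.D).2 = 0 := rfl
theorem fst_smul (c : ℂ) (x : Q.D) : (c • x).1 = c • x.1 := rfl
theorem snd_smul (c : ℂ) (x : Q.D) : (c • x).2 = c • x.2 := rfl

/-- The homomorphism `(a, b) ↦ α(a) + b` to `M`. -/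
def toM (x : Q.D) : M := Q.α x.1 + j x.2

theorem ext' {x y : Q.D} (h1 : x.1 = y.1) (h2 : toM x = toM y) : x = y := by
  refine Prod.ext h1 (Q.inj ?_)
  rw [toM, toM, h1] at h2
  exact add_left_cancel h2

theorem toM_add (x y : Q.D) : toM (x + y) = toM x + toM y := by
  simp only [toM, fst_add, snd_add, map_add]; abel

theorem toM_zero : toM (0 : Q.D) = 0 := by simp [toM, fst_zero, snd_zero]

theorem toM_smul (c : ℂ) (x : Q.D) : toM (c • x) = c • toM x := by
  simp only [toM, fst_smul, snd_smul, map_smul, smul_add]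

theorem toM_mul (x y : Q.D) : toM (x * y) = toM x * toM y := by
  simp only [toM, fst_mul, snd_mul, map_add, map_mul, j_leftB, j_rightB, add_mul, mul_add]; abel

instance : NonUnitalRing Q.D where
  __ := (inferInstance : AddCommGroup Q.D)
  __ := (inferInstance : Mul Q.D)
  left_distrib x y z := ext' (mul_add _ _ _) (by simp only [toM_mul, toM_add, mul_add])
  right_distrib x y z := ext' (add_mul _ _ _) (by simp only [toM_mul, toM_add, add_mul])
  zero_mul x := ext' (zero_mul _) (by simp only [toM_mul, toM_zero, zero_mul])
  mul_zero x := ext' (mul_zero _) (by simp only [toM_mul, toM_zero, mul_zero])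
  mul_assoc x y z := ext' (mul_assoc _ _ _) (by simp only [toM_mul, mul_assoc])

instance : IsLCAlg Q.D where
  smul_assoc c x y := ext' (smul_assoc c x.1 y.1) (by
    simp only [smul_eq_mul, toM_mul, toM_smul, smul_mul_assoc])
  smul_comm c x y := ext' (smul_comm c x.1 y.1) (by
    simp only [smul_eq_mul, toM_mul, toM_smul, mul_smul_comm])
  continuous_mul := by
    have h1 : Continuous fun x : (A × B) × (A × B) => x.1.1 * x.2.1 := by fun_prop
    have h2 : Continuous fun x : (A × B) × (A × B) =>
        Q.leftB (x.1.1, x.2.2) + Q.rightB (x.1.2, x.2.1) + x.1.2 * x.2.2 :=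
      ((Q.continuous_leftB.comp (by fun_prop)).add (Q.continuous_rightB.comp (by fun_prop))).add
        (by fun_prop)
    exact h1.prodMk h2

variable (Q)

/-- The element `(a, b)`. -/
def mk (a : A) (b : B) : Q.D := (a, b)

theorem toM_mk (a : A) (b : B) : toM (mk Q a b) = Q.α a + j b := rfl

theorem continuous_mk : Continuous fun x : A × B => mk Q x.1 x.2 := continuous_id

/-- The inclusion `b ↦ (0, b)`. -/
def inc : LCHom B Q.D where
  toFun b := mk Q 0 b
  map_smul' c b := ext' (smul_zero c).symm (by
    rw [toM_smul, toM_mk, toM_mk, map_zero, zero_add, zero_add]; exact map_smul j c b)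
  map_zero' := rfl
  map_add' b b' := ext' (add_zero 0).symm (by
    rw [toM_add, toM_mk, toM_mk, toM_mk, map_zero, zero_add, zero_add, zero_add, map_add])
  map_mul' b b' := ext' (mul_zero (0 : A)).symm (by
    rw [toM_mul, toM_mk, toM_mk, toM_mk, map_zero, zero_add, zero_add, zero_add, map_mul])
  cont := (continuous_mk Q).comp (continuous_const.prodMk continuous_id)

/-- The projection `(a, b) ↦ a`. -/
def proj : LCHom Q.D A where
  toFun x := x.1
  map_smul' _ _ := rfl
  map_zero' := rfl
  map_add' _ _ := rfl
  map_mul' _ _ := rfl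
  cont := (continuous_fst : Continuous fun x : A × B => x.1)

/-- The splitting `a ↦ (a, 0)`. -/
def secα : LCHom A Q.D where
  toFun a := mk Q a 0
  map_smul' c a := ext' rfl (by
    rw [toM_smul, toM_mk, toM_mk, map_zero, add_zero, add_zero]; exact map_smul Q.α c a)
  map_zero' := rfl
  map_add' a a' := ext' rfl (by
    rw [toM_add, toM_mk, toM_mk, toM_mk, map_zero, add_zero, add_zero, add_zero, map_add])
  map_mul' a a' := ext' rfl (by
    rw [toM_mul, toM_mk, toM_mk, toM_mk, map_zero, add_zero, add_zero, add_zero, map_mul])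
  cont := (continuous_mk Q).comp (continuous_id.prodMk continuous_const)

theorem toM_β (a : A) : toM (mk Q a (-Q.diffB a)) = Q.β a := by
  rw [toM_mk, map_neg, j_diffB]; abel

/-- The splitting `a ↦ (a, β(a) - α(a))`. -/
def secβ : LCHom A Q.D where
  toFun a := mk Q a (-Q.diffB a)
  map_smul' c a := ext' rfl (by rw [toM_smul, toM_β, toM_β]; exact map_smul Q.β c a)
  map_zero' := ext' rfl (by rw [toM_zero, toM_β, map_zero])
  map_add' a a' := ext' rfl (by rw [toM_add, toM_β, toM_β, toM_β, map_add])
  map_mul' a a' := ext' rfl (by rw [toM_mul, toM_β, toM_β, toM_β, map_mul])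
  cont := (continuous_mk Q).comp (continuous_id.prodMk Q.continuous_diffB.neg)

theorem isEmbedding_inc : IsEmbedding (inc Q) :=
  IsEmbedding.of_leftInverse (f := fun x : Q.D => x.2) (fun _ => rfl)
    (continuous_snd : Continuous fun x : A × B => x.2) (LCHom.continuous _)

theorem exact (x : Q.D) : proj Q x = 0 ↔ x ∈ Set.range (inc Q) :=
  ⟨fun h => ⟨x.2, Prod.ext h.symm rfl⟩, by rintro ⟨b, rfl⟩; rfl⟩

end D

end LCQuasihom

/-- The double split extension `0 → B → D_α → A → 0` of a quasihomomorphism. -/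
def LCQuasihom.doubleSplit {A B : LCAlg} {M : Type*} [NonUnitalRing M] [Module ℂ M]
    [IsScalarTower ℂ M M] [SMulCommClass ℂ M M] {j : B →ₙₐ[ℂ] M} (Q : LCQuasihom A B M j) :
    DoubleSplitExt A B where
  D := .of Q.D
  ι := LCQuasihom.D.inc Q
  π := LCQuasihom.D.proj Q
  α := LCQuasihom.D.secα Q
  β := LCQuasihom.D.secβ Q
  split_α := ⟨LCQuasihom.D.isEmbedding_inc Q, LCQuasihom.D.exact Q, fun _ => rfl⟩
  split_β := ⟨LCQuasihom.D.isEmbedding_inc Q, LCQuasihom.D.exact Q, fun _ => rfl⟩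

end Quasihomomorphisms

/-! ## Kasparov modules -/

/-- A locally convex Kasparov `(A, B)`-module `(M, φ, F)` with grading `ε`: here `M` is a unital
algebra which contains `B` as a subalgebra via `j`. -/
structure LCKasparovModule (A B M : Type*) [NonUnitalRing A] [Module ℂ A] [UniformSpace A]
    [NonUnitalRing B] [Module ℂ B] [UniformSpace B] [Ring M] [Algebra ℂ M]
    (j : B →ₙₐ[ℂ] M) where
  inj : Function.Injective j
  ε : M
  F : M
  φ : A →ₙₐ[ℂ] M
  ε_sq : ε * ε = 1
  F_odd : F * ε = -(ε * F)
  φ_even : ∀ a, φ a * ε = ε * φ a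
  mul_F : ContValued j fun b => j b * F
  F_mul : ContValued j fun b => F * j b
  ε_mul : ContValued j fun b => ε * j b
  mul_ε : ContValued j fun b => j b * ε
  φ_mul : ContValued j fun x : A × B => φ x.1 * j x.2
  mul_φ : ContValued j fun x : A × B => j x.2 * φ x.1
  φ_defect : ContValued j fun a => φ a * (1 - F * F)
  defect_φ : ContValued j fun a => (1 - F * F) * φ a
  commutator : ContValued j fun a => φ a * F - F * φ a

namespace ContValued

variable {X B M : Type*} [TopologicalSpace X] [NonUnitalRing B] [Module ℂ B] [UniformSpace B]
  [IsLCAlg B] [Ring M] [Algebra ℂ M] {j : B →ₙₐ[ℂ] M} {f g : X → M} {m n : M}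

theorem congr (hf : ContValued j f) (h : ∀ x, f x = g x) : ContValued j g :=
  let ⟨u, hu, e⟩ := hf
  ⟨u, hu, fun x => (e x).trans (h x)⟩

theorem add (hf : ContValued j f) (hg : ContValued j g) : ContValued j fun x => f x + g x :=
  let ⟨u, hu, e⟩ := hf
  let ⟨v, hv, e'⟩ := hg
  ⟨fun x => u x + v x, hu.add hv, fun x => by rw [map_add, e, e']⟩

theorem sub (hf : ContValued j f) (hg : ContValued j g) : ContValued j fun x => f x - g x :=
  let ⟨u, hu, e⟩ := hf
  let ⟨v, hv, e'⟩ := hg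
  ⟨fun x => u x - v x, hu.sub hv, fun x => by rw [map_sub, e, e']⟩

theorem smul (c : ℂ) (hf : ContValued j f) : ContValued j fun x => c • f x :=
  let ⟨u, hu, e⟩ := hf
  ⟨fun x => c • u x, hu.const_smul c, fun x => (map_smul j c (u x)).trans (congrArg (c • ·) (e x))⟩

theorem mul_left (hf : ContValued j f) (hm : ContValued j fun b => m * j b) :
    ContValued j fun x => m * f x :=
  let ⟨u, hu, e⟩ := hf
  let ⟨v, hv, e'⟩ := hm
  ⟨fun x => v (u x), hv.comp hu, fun x => (e' (u x)).trans (congrArg (m * ·) (e x))⟩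

theorem mul_right (hf : ContValued j f) (hm : ContValued j fun b => j b * m) :
    ContValued j fun x => f x * m :=
  let ⟨u, hu, e⟩ := hf
  let ⟨v, hv, e'⟩ := hm
  ⟨fun x => v (u x), hv.comp hu, fun x => (e' (u x)).trans (congrArg (· * m) (e x))⟩

theorem left_one : ContValued j fun b => (1 : M) * j b :=
  ⟨fun b => b, continuous_id, fun _ => (one_mul _).symm⟩

theorem right_one : ContValued j fun b => j b * (1 : M) :=
  ⟨fun b => b, continuous_id, fun _ => (mul_one _).symm⟩

theorem left_add (hm : ContValued j fun b => m * j b) (hn : ContValued j fun b => n * j b) :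
    ContValued j fun b => (m + n) * j b :=
  (hm.add hn).congr fun _ => (add_mul _ _ _).symm

theorem left_sub (hm : ContValued j fun b => m * j b) (hn : ContValued j fun b => n * j b) :
    ContValued j fun b => (m - n) * j b :=
  (hm.sub hn).congr fun _ => (sub_mul _ _ _).symm

theorem left_mul (hm : ContValued j fun b => m * j b) (hn : ContValued j fun b => n * j b) :
    ContValued j fun b => (m * n) * j b :=
  (hn.mul_left hm).congr fun _ => (mul_assoc _ _ _).symm

theorem left_smul (c : ℂ) (hm : ContValued j fun b => m * j b) :
    ContValued j fun b => (c • m) * j b :=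
  (hm.smul c).congr fun _ => (smul_mul_assoc _ _ _).symm

theorem left_two : ContValued j fun b => (2 : M) * j b :=
  (left_one.left_add left_one).congr fun _ => by rw [one_add_one_eq_two]

theorem right_add (hm : ContValued j fun b => j b * m) (hn : ContValued j fun b => j b * n) :
    ContValued j fun b => j b * (m + n) :=
  (hm.add hn).congr fun _ => (mul_add _ _ _).symm

theorem right_sub (hm : ContValued j fun b => j b * m) (hn : ContValued j fun b => j b * n) :
    ContValued j fun b => j b * (m - n) :=
  (hm.sub hn).congr fun _ => (mul_sub _ _ _).symm

theorem right_mul (hm : ContValued j fun b => j b * m) (hn : ContValued j fun b => j b * n) :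
    ContValued j fun b => j b * (m * n) :=
  (hm.mul_right hn).congr fun _ => mul_assoc _ _ _

theorem right_smul (c : ℂ) (hm : ContValued j fun b => j b * m) :
    ContValued j fun b => j b * (c • m) :=
  (hm.smul c).congr fun _ => (mul_smul_comm _ _ _).symm

theorem right_two : ContValued j fun b => j b * (2 : M) :=
  (right_one.right_add right_one).congr fun _ => by rw [one_add_one_eq_two]

end ContValued

namespace LCKasparovModule

variable {A B M : Type*} [NonUnitalRing A] [Module ℂ A] [UniformSpace A] [IsLCAlg A]
    [NonUnitalRing B] [Module ℂ B] [UniformSpace B] [IsLCAlg B] [Ring M] [Algebra ℂ M]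
    {j : B →ₙₐ[ℂ] M} (K : LCKasparovModule A B M j)

/-- `P = (1 + ε) / 2`. -/
def P : M := (1 / 2 : ℂ) • (1 + K.ε)

/-- `P^⊥ = 1 - P`. -/
def Pperp : M := 1 - K.P

/-- `W = ε (1 - F²) + P F + P^⊥ F (2 - F²)`. -/
def W : M := K.ε * (1 - K.F * K.F) + K.P * K.F + K.Pperp * K.F * (2 - K.F * K.F)

theorem ε_eq : K.ε = K.P + K.P - 1 := by
  rw [P, ← add_smul]; norm_num

theorem P_sq : K.P * K.P = K.P := by
  simp only [P, smul_mul_assoc, mul_smul_comm, mul_add, add_mul, mul_one, one_mul, K.ε_sq]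
  module

theorem F_mul_P : K.F * K.P = K.F - K.P * K.F := by
  simp only [P, smul_mul_assoc, mul_smul_comm, mul_add, add_mul, mul_one, one_mul, K.F_odd]
  module

theorem φ_mul_P (a : A) : K.φ a * K.P = K.P * K.φ a := by
  simp only [P, smul_mul_assoc, mul_smul_comm, mul_add, add_mul, mul_one, one_mul, K.φ_even]

theorem W_eq : K.W = (K.P + K.P - 1) * (1 - K.F * K.F) + K.P * K.F +
    (1 - K.P) * K.F * (2 - K.F * K.F) := by
  rw [W, Pperp, ε_eq]

theorem W_sq : K.W * K.W = 1 := by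
  have h1 := K.P_sq
  have h2 := K.F_mul_P
  have h3 : ∀ x, K.P * (K.P * x) = K.P * x := fun x => by rw [← mul_assoc, h1]
  have h4 : ∀ x, K.F * (K.P * x) = K.F * x - K.P * (K.F * x) := fun x => by
    rw [← mul_assoc, h2, sub_mul, mul_assoc]
  rw [W_eq, ← one_add_one_eq_two]
  simp only [mul_add, add_mul, mul_sub, sub_mul, mul_assoc, mul_one, one_mul, h1, h2, h3, h4]
  abel

theorem left_P : ContValued j fun b => K.P * j b :=
  ((ContValued.left_one (j := j)).left_add K.ε_mul).left_smul (1 / 2)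

theorem left_Pperp : ContValued j fun b => K.Pperp * j b :=
  (ContValued.left_one (j := j)).left_sub K.left_P

theorem left_FF : ContValued j fun b => K.F * K.F * j b := K.F_mul.left_mul K.F_mul

theorem left_W : ContValued j fun b => K.W * j b :=
  ((K.ε_mul.left_mul ((ContValued.left_one (j := j)).left_sub K.left_FF)).left_add
    (K.left_P.left_mul K.F_mul)).left_add
    ((K.left_Pperp.left_mul K.F_mul).left_mul (ContValued.left_two.left_sub K.left_FF))

theorem right_P : ContValued j fun b => j b * K.P :=
  ((ContValued.right_one (j := j)).right_add K.mul_ε).right_smul (1 / 2)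

theorem right_Pperp : ContValued j fun b => j b * K.Pperp :=
  (ContValued.right_one (j := j)).right_sub K.right_P

theorem right_FF : ContValued j fun b => j b * (K.F * K.F) := K.mul_F.right_mul K.mul_F

theorem right_W : ContValued j fun b => j b * K.W :=
  ((K.mul_ε.right_mul ((ContValued.right_one (j := j)).right_sub K.right_FF)).right_add
    (K.right_P.right_mul K.mul_F)).right_add
    ((K.right_Pperp.right_mul K.mul_F).right_mul (ContValued.right_two.right_sub K.right_FF))

theorem Pφ_mul_W (a : A) : K.P * K.φ a * K.W - K.W * (K.Pperp * K.φ a) =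
    K.P * (K.φ a * (1 - K.F * K.F)) + K.Pperp * ((1 - K.F * K.F) * K.φ a) +
      K.P * (K.φ a * K.F - K.F * K.φ a) := by
  have h5 := K.φ_mul_P a
  have h3 : ∀ x, K.P * (K.P * x) = K.P * x := fun x => by rw [← mul_assoc, K.P_sq]
  have h4 : ∀ x, K.F * (K.P * x) = K.F * x - K.P * (K.F * x) := fun x => by
    rw [← mul_assoc, K.F_mul_P, sub_mul, mul_assoc]
  have h6 : ∀ x, K.φ a * (K.P * x) = K.P * (K.φ a * x) := fun x => by
    rw [← mul_assoc, h5, mul_assoc]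
  rw [W_eq, Pperp, ← one_add_one_eq_two]
  simp only [mul_add, add_mul, mul_sub, sub_mul, mul_assoc, mul_one, one_mul, h3, h4, h5, h6]
  abel

/-- The homomorphism `P φ`. -/
def evenPart : A →ₙₐ[ℂ] M where
  toFun := fun a => K.P * K.φ a
  map_smul' := fun c a => by
    rw [← mul_smul_comm]; exact congrArg (K.P * ·) (map_smul K.φ c a)
  map_zero' := by rw [map_zero, mul_zero]
  map_add' := fun a b => by rw [map_add, mul_add]
  map_mul' := fun a b => by
    rw [map_mul, mul_assoc, ← mul_assoc (K.φ a), K.φ_mul_P, ← mul_assoc, ← mul_assoc,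
      ← mul_assoc, K.P_sq]

/-- The homomorphism `W P^⊥ φ W`. -/
def twistedPart : A →ₙₐ[ℂ] M where
  toFun := fun a => K.W * (K.Pperp * K.φ a) * K.W
  map_smul' := fun c a => by
    rw [← smul_mul_assoc, ← mul_smul_comm, ← mul_smul_comm]
    exact congrArg (fun x => K.W * (K.Pperp * x) * K.W) (map_smul K.φ c a)
  map_zero' := by rw [map_zero, mul_zero, mul_zero, zero_mul]
  map_add' := fun a b => by rw [map_add, mul_add, mul_add, add_mul]
  map_mul' := fun a b => by
    have h : K.W * (K.Pperp * K.φ a) * K.W * (K.W * (K.Pperp * K.φ b) * K.W) =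
        K.W * (K.Pperp * K.φ a) * (K.W * K.W) * (K.Pperp * K.φ b) * K.W := by
      simp only [mul_assoc]
    have h3 : ∀ x, K.P * (K.P * x) = K.P * x := fun x => by rw [← mul_assoc, K.P_sq]
    have h6 : ∀ x, K.φ a * (K.P * x) = K.P * (K.φ a * x) := fun x => by
      rw [← mul_assoc, K.φ_mul_P, mul_assoc]
    have h7 : K.Pperp * K.φ a * (K.Pperp * K.φ b) = K.Pperp * K.φ (a * b) := by
      simp only [Pperp, map_mul, sub_mul, mul_sub, one_mul, mul_assoc, h3, h6]
      abel
    rw [h, K.W_sq, mul_one, ← h7]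
    simp only [mul_assoc]

theorem evenPart_apply (a : A) : K.evenPart a = K.P * K.φ a := rfl

theorem twistedPart_apply (a : A) : K.twistedPart a = K.W * (K.Pperp * K.φ a) * K.W := rfl

/-- The quasihomomorphism `Qh(M, φ, F) = (P φ, W P^⊥ φ W)` of a Kasparov module; `W` is its own
inverse. -/
def Qh : LCQuasihom A B M j where
  inj := K.inj
  α := K.evenPart
  β := K.twistedPart
  diff := by
    have h := (((K.φ_defect.mul_left K.left_P).add (K.defect_φ.mul_left K.left_Pperp)).add
      (K.commutator.mul_left K.left_P)).mul_right K.right_W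
    refine h.congr fun a => ?_
    rw [← K.Pφ_mul_W, sub_mul, mul_assoc _ K.W K.W, K.W_sq, mul_one, evenPart_apply,
      twistedPart_apply]
  left := (K.φ_mul.mul_left K.left_P).congr fun x => (mul_assoc _ _ _).symm
  right := by
    obtain ⟨g, hg, h⟩ := K.right_P
    obtain ⟨f, hf, h'⟩ := K.mul_φ
    refine ⟨fun x => f (x.2, g x.1), hf.comp (continuous_snd.prodMk (hg.comp continuous_fst)),
      fun x => ?_⟩
    rw [h']
    dsimp only
    rw [h, mul_assoc]
    rfl

end LCKasparovModule

/-! ## Fredholm index -/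

/-- The index `dim ker u - dim coker u` of a Fredholm operator `u`. -/
def fredholmIndex {X Y : Type*} [AddCommGroup X] [Module ℂ X] [TopologicalSpace X]
    [AddCommGroup Y] [Module ℂ Y] [TopologicalSpace Y] (u : X →L[ℂ] Y) : ℤ :=
  (Module.finrank ℂ u.ker : ℤ) - Module.finrank ℂ (Y ⧸ u.range)

/-- A minimal projection in the Schatten class: an orthogonal projection of rank one. -/
def IsMinimalProjection {p : ℝ} {E : Type*} [NormedAddCommGroup E] [InnerProductSpace ℂ E]
    [CompleteSpace E] [Fact (1 ≤ p)] (e : Schatten p E) : Prop :=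
  IsStarProjection (Schatten.incl p E e) ∧ Module.finrank ℂ (Schatten.incl p E e).range = 1

theorem IsMinimalProjection.mul_self {p : ℝ} {E : Type*} [NormedAddCommGroup E]
    [InnerProductSpace ℂ E] [CompleteSpace E] [Fact (1 ≤ p)] {e : Schatten p E}
    (he : IsMinimalProjection e) : e * e = e :=
  Schatten.incl_injective ((map_mul _ _ _).trans he.1.isIdempotentElem)

namespace LCKasparovModule

variable {B E : Type*} [NonUnitalRing B] [Module ℂ B] [UniformSpace B] [IsLCAlg B] [NormedAddCommGroup E]
  [NormedSpace ℂ E] {j : B →ₙₐ[ℂ] (E →L[ℂ] E)} (K : LCKasparovModule ℂ B (E →L[ℂ] E) j)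

/-- The even part of `φ(1) E`, i.e. the range of `P φ(1)`. -/
def evenSpace : Submodule ℂ E := (K.P * K.φ 1).range

/-- The odd part of `φ(1) E`, i.e. the range of `P^⊥ φ(1)`. -/
def oddSpace : Submodule ℂ E := (K.Pperp * K.φ 1).range

/-- The operator `F` viewed as an operator on `φ(1) E = P φ(1) E ⊕ P^⊥ φ(1) E`: as `F` is odd, it
is determined by its components between the two summands, and this is the one from the even to the
odd part, `x ↦ P^⊥ φ(1) F x = φ(1) F x`. -/
def oddPart : K.evenSpace →L[ℂ] K.oddSpace :=
  ((K.Pperp * K.φ 1 * K.F).comp K.evenSpace.subtypeL).codRestrict K.oddSpace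
    fun x => ⟨K.F x, rfl⟩

theorem oddPart_apply (x : K.evenSpace) : (K.oddPart x : E) = K.φ 1 (K.F x) := by
  obtain ⟨_, y, rfl⟩ := x
  have h3 : ∀ x, K.P * (K.P * x) = K.P * x := fun x => by rw [← mul_assoc, K.P_sq]
  have h4 : ∀ x, K.F * (K.P * x) = K.F * x - K.P * (K.F * x) := fun x => by
    rw [← mul_assoc, K.F_mul_P, sub_mul, mul_assoc]
  have h6 : ∀ x, K.φ 1 * (K.P * x) = K.P * (K.φ 1 * x) := fun x => by
    rw [← mul_assoc, K.φ_mul_P, mul_assoc]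
  have : K.Pperp * K.φ 1 * K.F * (K.P * K.φ 1) = K.φ 1 * (K.F * (K.P * K.φ 1)) := by
    simp only [Pperp, sub_mul, mul_sub, one_mul, mul_assoc, h3, h4, h6]
    abel
  exact DFunLike.congr_fun this y

end LCKasparovModule

/-- The homomorphism `H(A) → H(L ⊗ A) → H(A ⊗ L)`, where the first map is induced by the
quasihomomorphism `Q ⊗ A : ℂ ⊗ A ⇉ L ⊗ A` and the identification `ℂ ⊗ A = A`, the second one by
the flip. -/
def LCQuasihom.inducedTensor {L : LCAlg} {M : Type*} [NonUnitalRing M] [Module ℂ M]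
    [IsScalarTower ℂ M M] [SMulCommClass ℂ M M] {j : L →ₙₐ[ℂ] M}
    (Q : LCQuasihom (LCAlg.of ℂ) L M j) (H : LCAlg ⥤ AddCommGrpCat.{w}) (hH : SplitExact H)
    (A : LCAlg) : H.obj A ⟶ H.obj (A.tensor L) :=
  H.map A.leftUnitor.inv ≫ (Q.doubleSplit.tensor A).induced H hH ≫
    H.map (LCAlg.ofHom (ProjTensor.flip L A))

end

/-!
For an idempotent `x` of a locally convex algebra `D`, let the class `[x] : H(A) → H(D ⊗ A)` be the
homomorphism induced by `a ↦ x ⊗ a` (`idemClass`). With `q = P φ(1)` and `q' = P^⊥ φ(1)`, the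
quasihomomorphism of the Kasparov module consists of the homomorphisms of `ℂ` with the images `q`
and `W q' W` of `1`, so that `H(Qh ⊗ A)` is determined by `[q] - [W q' W]`, computed in the algebra
`D_α`. Classes are invariant under smooth paths of idempotents by diffotopy invariance, and
additive on orthogonal idempotents by split exactness (`SplitExact.idemClass_add`).

The components `q' F q` and `q F q'` of `F` are inverse to each other modulo the Schatten class. Its
elements are limits of operators of finite rank (`Schatten.exists_finiteRange_norm_sub_le`), hence
`T = q' F q`, seen as an operator from the even to the odd part, is Fredholm
(`LCKasparovModule.isFredholm_oddPart`), and it has a generalised inverse `S`, for which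
`r = q - S T` and `r' = q' - T S` are idempotents of finite rank, with the dimensions of kernel and
cokernel as their ranks. As `S` agrees with `q F q'` modulo the Schatten class, and `F`
commutes with `φ(1)` modulo the Schatten class, `F` differs from
`G = T + S + (1 - φ(1)) F (1 - φ(1))` by an operator of Schatten class. Along the segment from `F`
to `G`, which consists of odd operators, the formula for `W` yields involutions, and therefore a
path of idempotents in `D_α` which starts with `W q' W` and ends with `S T + r' = (q - r) + r'`
(`involutionOf_conj`, `LCKasparovModule.exists_path`). It follows that
`[q] - [W q' W] = [r] - [r']`.

Two idempotents of rank one are joined by segments of idempotents, since idempotents with the same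
range or the same kernel are (`idemClass_eq_of_rank_one`). By additivity the class of an idempotent
of finite rank is then its rank times the class of `e` (`idemClass_eq_finrank_smul`), and
`[r] - [r']` is the index times the class of `e`.
-/

/-! ### Smooth paths with flat ends -/

section FlatPaths

open unitInterval

variable {B C : Type*} [NonUnitalRing B] [Module ℂ B] [UniformSpace B] [IsLCAlg B]
  [NonUnitalRing C] [Module ℂ C] [UniformSpace C] [IsLCAlg C]

theorem IsFlatJet.map_clm {X Y : Type*} [AddCommGroup X] [Module ℝ X] [TopologicalSpace X]
    [AddCommGroup Y] [Module ℝ Y] [TopologicalSpace Y] {d : ℕ → I → X} (hd : IsFlatJet d)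
    (l : X →L[ℝ] Y) : IsFlatJet fun k t => l (d k t) := fun k =>
  ⟨(hd k).1.map l, by simp [(hd k).2.1], by simp [(hd k).2.2]⟩

theorem const_mem_flatSmooth (b : B) : (fun _ => b) ∈ flatSmooth B := by
  refine ⟨fun k => if k = 0 then fun _ => b else 0, fun k => ⟨?_, by simp, by simp⟩, by simp⟩
  rcases k with _ | k
  · simpa using HasDerivOnI.const b
  · simpa using HasDerivOnI.zero

theorem clm_comp_mem_flatSmooth (l : B →L[ℂ] C) {f : I → B} (hf : f ∈ flatSmooth B) :
    (fun t => l (f t)) ∈ flatSmooth C := by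
  obtain ⟨d, hd, rfl⟩ := hf
  exact ⟨_, hd.map_clm (l.restrictScalars ℝ), rfl⟩

/-- `Real.smoothTransition` has flat ends: it is locally constant outside `[0, 1]`, so that its
derivatives vanish there, and at `0` and `1` by continuity. -/
theorem isFlatJet_smoothTransition :
    IsFlatJet fun k (t : I) => iteratedDeriv k Real.smoothTransition t := by
  have hs : ∀ n : ℕ, ContDiff ℝ n Real.smoothTransition := fun n =>
    Real.smoothTransition.contDiff (n := (n : ℕ∞))
  have hc : ∀ k, Continuous (iteratedDeriv k Real.smoothTransition) := fun k =>
    (hs k).continuous_iteratedDeriv k le_rfl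
  have hconst : ∀ (k : ℕ) (c : ℝ) (U : Set ℝ), IsOpen U →
      (∀ x ∈ U, Real.smoothTransition x = c) →
      ∀ x ∈ closure U, iteratedDeriv (k + 1) Real.smoothTransition x = 0 := by
    intro k c U hU hUc x hx
    have hcl : IsClosed {x | iteratedDeriv (k + 1) Real.smoothTransition x = 0} :=
      isClosed_eq (hc (k + 1)) continuous_const
    refine closure_minimal (fun y hy => ?_) hcl hx
    have h : Real.smoothTransition =ᶠ[𝓝 y] fun _ => c :=
      (hU.mem_nhds hy : U ∈ 𝓝 y) |> Filter.mem_of_superset <| hUc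
    change iteratedDeriv (k + 1) Real.smoothTransition y = 0
    rw [h.iteratedDeriv_eq, iteratedDeriv_const, if_neg k.succ_ne_zero]
  intro k
  refine ⟨fun t => ?_, ?_, ?_⟩
  · have hd : HasDerivAt (iteratedDeriv k Real.smoothTransition)
        (iteratedDeriv (k + 1) Real.smoothTransition t) t := by
      rw [iteratedDeriv_succ]
      exact (((hs (k + 1)).differentiable_iteratedDeriv k
        (by exact_mod_cast Nat.lt_succ_self k)) t).hasDerivAt
    have hval : Tendsto (fun s : I => (s : ℝ)) (𝓝[≠] t) (𝓝[≠] (t : ℝ)) :=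
      tendsto_nhdsWithin_iff.2 ⟨(continuous_subtype_val.tendsto t).mono_left nhdsWithin_le_nhds,
        eventually_mem_nhdsWithin.mono fun s hs e => hs (Subtype.ext e)⟩
    refine ((hasDerivAt_iff_tendsto_slope.1 hd).comp hval).congr fun s => ?_
    simp [slope_def_module]
  · refine hconst k 0 (Set.Iio 0) isOpen_Iio
      (fun x hx => Real.smoothTransition.zero_of_nonpos hx.le) _ ?_
    simp
  · refine hconst k 1 (Set.Ioi 1) isOpen_Ioi
      (fun x hx => Real.smoothTransition.one_of_one_le hx.le) _ ?_
    simp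

/-- The path `t ↦ χ(t) b`, for the smooth transition function `χ`, has flat ends. -/
theorem smoothTransition_smul_mem_flatSmooth (b : B) :
    (fun t : I => (Real.smoothTransition t : ℂ) • b) ∈ flatSmooth B := by
  refine ⟨_, isFlatJet_smoothTransition.map_clm
    ((ContinuousLinearMap.id ℝ ℝ).smulRight b), funext fun t => ?_⟩
  simp [Complex.coe_smul]

/-- The morphism `a ↦ (t ↦ x(t) ⊗ a)` attached to a smooth path `x` of idempotents with flat
ends. -/
noncomputable def FlatSmooth.tensorPath (x : FlatSmooth B)
    (hx : ∀ t, val x t * val x t = val x t) (C : Type*) [NonUnitalRing C] [Module ℂ C]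
    [UniformSpace C] [IsLCAlg C] : LCHom C (FlatSmooth (ProjTensor B C)) :=
  have hjet (c : C) : IsFlatJet fun k t => ProjTensor.tmul (iterDeriv x k t) c :=
    (isFlatJet x).map_clm ((⟨ProjTensor.tmulBilin.flip c, ProjTensor.continuous_tmul.comp
      (continuous_id.prodMk continuous_const)⟩ : B →L[ℂ] ProjTensor B C).restrictScalars ℝ)
  have hmem (c : C) : (fun t => ProjTensor.tmul (val x t) c) ∈ flatSmooth (ProjTensor B C) :=
    ⟨_, hjet c, funext fun t => by rw [iterDeriv_zero]⟩
  { toFun c := ⟨fun t => ProjTensor.tmul (val x t) c, hmem c⟩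
    map_smul' r c := Subtype.ext (funext fun t => map_smul (ProjTensor.tmulBilin (val x t)) r c)
    map_zero' := Subtype.ext (funext fun t => map_zero (ProjTensor.tmulBilin (val x t)))
    map_add' c c' := Subtype.ext (funext fun t => map_add (ProjTensor.tmulBilin (val x t)) c c')
    map_mul' c c' := Subtype.ext (funext fun t => by
      change ProjTensor.tmul (val x t) (c * c') = ProjTensor.tmul (val x t) c *
        ProjTensor.tmul (val x t) c'
      rw [ProjTensor.tmul_mul_tmul, hx])
    cont := by
      refine isInducing_jets.continuous_iff.2 (continuous_pi fun k => ?_)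
      refine ContinuousMap.continuous_of_continuous_uncurry _ ?_
      have h : ∀ (c : C) (t : I), iterDeriv (⟨fun t => ProjTensor.tmul (val x t) c, hmem c⟩ :
          FlatSmooth (ProjTensor B C)) k t = ProjTensor.tmul (iterDeriv x k t) c := fun c t =>
        congrFun (iterDeriv_eq (hjet c) (funext fun t => by rw [iterDeriv_zero]; rfl) k) t
      refine (ProjTensor.continuous_tmul.comp (((iterDeriv x k).continuous.comp
        continuous_snd).prodMk continuous_fst) : Continuous fun z : C × I =>
          (ProjTensor.tmul (iterDeriv x k z.2) z.1 : ProjTensor B C)).congr fun z => ?_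
      exact (h z.1 z.2).symm }

end FlatPaths

/-! ### Classes of idempotents -/

section Classes

variable (H : LCAlg ⥤ AddCommGrpCat.{w})

/-- The homomorphism `H(A) → H(D ⊗ A)` induced by `a ↦ x ⊗ a`, for an idempotent `x` of `D`; it
plays the role of the class of `x`. -/
noncomputable def idemClass {D : LCAlg} (x : D) (hx : x * x = x) (A : LCAlg) :
    H.obj A ⟶ H.obj (D.tensor A) :=
  H.map (LCAlg.ofHom (ProjTensor.tmulLeft A x hx))

variable {H}

theorem idemClass_map {D D' : LCAlg} (f : LCHom D D') (x : D) (hx : x * x = x)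
    (hfx : f x * f x = f x) (A : LCAlg) :
    idemClass H (f x) hfx A =
      idemClass H x hx A ≫ H.map (LCAlg.ofHom (ProjTensor.map f (LCHom.id A))) := by
  rw [idemClass, idemClass, ← H.map_comp]
  congr 1
  exact LCHom.ext fun a => (ProjTensor.map_tmul f (LCHom.id A) x a).symm

theorem idemClass_congr {D : LCAlg} {x y : D} (h : x = y) (hx : x * x = x) (hy : y * y = y)
    (A : LCAlg) : idemClass H x hx A = idemClass H y hy A := by
  subst h; rfl

/-- The class of an idempotent is constant along smooth paths of idempotents with flat ends. -/
theorem DiffotopyInvariant.idemClass_eq (hdi : DiffotopyInvariant H) {D : LCAlg}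
    {g : unitInterval → D} (hg : g ∈ flatSmooth D) (hidem : ∀ t, g t * g t = g t) (A : LCAlg) :
    idemClass H (g 0) (hidem 0) A = idemClass H (g 1) (hidem 1) A :=
  hdi (B := D.tensor A) (FlatSmooth.tensorPath ⟨g, hg⟩ hidem A)

/-- If `r s + s r = r + s`, then the segment from `r` to `s` consists of idempotents. -/
theorem DiffotopyInvariant.idemClass_eq_of_segment (hdi : DiffotopyInvariant H) {D : LCAlg}
    {r s : D} (hr : r * r = r) (hs : s * s = s) (h : r * s + s * r = r + s) (A : LCAlg) :
    idemClass H r hr A = idemClass H s hs A := by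
  have hmem : (fun t : unitInterval => r + (Real.smoothTransition t : ℂ) • (s - r)) ∈
      flatSmooth (D : Type) :=
    add_mem (const_mem_flatSmooth r) (smoothTransition_smul_mem_flatSmooth (s - r))
  have hsr : s * r = r + s - r * s := by rw [← h]; abel
  have hidem : ∀ c : ℂ, (r + c • (s - r)) * (r + c • (s - r)) = r + c • (s - r) := fun c => by
    simp only [add_mul, mul_add, sub_mul, mul_sub, smul_mul_assoc, mul_smul_comm, hr, hs, hsr,
      smul_sub, smul_add]
    module
  have := hdi.idemClass_eq hmem (fun t => hidem _) A
  refine (idemClass_congr ?_ _ _ A).trans (this.trans (idemClass_congr ?_ _ _ A))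
  · simp
  · simp

namespace LCHom

variable {X Y Z : Type*} [NonUnitalRing X] [Module ℂ X] [UniformSpace X]
  [NonUnitalRing Y] [Module ℂ Y] [UniformSpace Y] [NonUnitalRing Z] [Module ℂ Z] [UniformSpace Z]

instance : Zero (LCHom X Y) := ⟨⟨0, continuous_const⟩⟩

/-- The morphism `x ↦ (f x, g x)`. -/
def prod (f : LCHom X Y) (g : LCHom X Z) : LCHom X (Y × Z) :=
  ⟨f.toNonUnitalAlgHom.prod g.toNonUnitalAlgHom, f.cont.prodMk g.cont⟩

variable (X Y)

/-- The first projection. -/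
def fst : LCHom (X × Y) X := ⟨NonUnitalAlgHom.fst ℂ X Y, continuous_fst⟩

/-- The second projection. -/
def snd : LCHom (X × Y) Y := ⟨NonUnitalAlgHom.snd ℂ X Y, continuous_snd⟩

end LCHom

instance LCAlg.isLCAlg_prod (A B : LCAlg) : IsLCAlg (A × B) where

/-- A split exact functor is additive on orthogonal sums of morphisms. -/
theorem SplitExact.map_add_of_orthogonal (hH : SplitExact H) {A B : LCAlg} (f g k : LCHom A B)
    (hfg : ∀ a a', f a * g a' = 0) (hgf : ∀ a a', g a * f a' = 0)
    (hk : ∀ a, k a = f a + g a) :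
    H.map (LCAlg.ofHom k) = H.map (LCAlg.ofHom f) + H.map (LCAlg.ofHom g) := by
  let P : LCAlg := .of (A × A)
  let i₁ : A ⟶ P := (LCHom.id A).prod 0
  let i₂ : A ⟶ P := (0 : LCHom A A).prod (LCHom.id A)
  let δ : A ⟶ P := (LCHom.id A).prod (LCHom.id A)
  let p₁ : P ⟶ A := LCHom.fst A A
  let p₂ : P ⟶ A := LCHom.snd A A
  let m : P ⟶ B := LCAlg.ofHom (A := P) (B := B) ⟨⟨⟨⟨fun a => f a.1 + g a.2, fun c a => by
      change f (c • a.1) + g (c • a.2) = c • (f a.1 + g a.2)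
      rw [map_smul, map_smul, smul_add]⟩,
    by
      change f 0 + g 0 = 0
      rw [map_zero, map_zero, add_zero], fun a b => by
      change f (a.1 + b.1) + g (a.2 + b.2) = f a.1 + g a.2 + (f b.1 + g b.2)
      rw [map_add, map_add]; abel⟩, fun a b => by
      change f (a.1 * b.1) + g (a.2 * b.2) = (f a.1 + g a.2) * (f b.1 + g b.2)
      rw [map_mul, map_mul, add_mul, mul_add, mul_add, hfg, hgf]; abel⟩,
    (f.continuous.comp continuous_fst).add (g.continuous.comp continuous_snd)⟩
  have e₁ : IsSplitExtension (A := A) (B := A) (D := A × A) i₁ p₂ i₂ :=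
    ⟨IsEmbedding.of_leftInverse (f := LCHom.fst A A) (fun _ => rfl) (LCHom.continuous _)
      (LCHom.continuous _), fun x => ⟨fun hx => ⟨x.1, Prod.ext rfl hx.symm⟩, by
        rintro ⟨y, rfl⟩; rfl⟩, fun _ => rfl⟩
  have e₂ : IsSplitExtension (A := A) (B := A) (D := A × A) i₂ p₁ i₁ :=
    ⟨IsEmbedding.of_leftInverse (f := LCHom.snd A A) (fun _ => rfl) (LCHom.continuous _)
      (LCHom.continuous _), fun x => ⟨fun hx => ⟨x.2, Prod.ext hx.symm rfl⟩, by
        rintro ⟨y, rfl⟩; rfl⟩, fun _ => rfl⟩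
  obtain ⟨-, ex₁, -⟩ := hH _ _ _ e₁
  obtain ⟨-, ex₂, -⟩ := hH _ _ _ e₂
  have happ : ∀ {X Y Z : LCAlg} (u : X ⟶ Y) (v : Y ⟶ Z) (x : H.obj X),
      H.map v (H.map u x) = H.map (u ≫ v) x := fun u v x => by rw [H.map_comp]; rfl
  have hid : ∀ {X : LCAlg} (u : X ⟶ X) (x : H.obj X), u = 𝟙 X → H.map u x = x := by
    rintro X _ x rfl
    rw [H.map_id]; rfl
  have d₁ : δ ≫ p₁ = 𝟙 A := LCHom.ext fun _ => rfl
  have d₂ : δ ≫ p₂ = 𝟙 A := LCHom.ext fun _ => rfl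
  have d₃ : i₂ ≫ p₂ = 𝟙 A := LCHom.ext fun _ => rfl
  have d₄ : i₁ ≫ p₁ = 𝟙 A := LCHom.ext fun _ => rfl
  have hδ : ∀ x : H.obj A, H.map δ x = H.map i₁ x + H.map i₂ x := by
    intro x
    have h0 : H.map p₂ (H.map δ x - H.map i₂ x) = 0 := by
      rw [map_sub, happ, happ, hid _ _ d₂, hid _ _ d₃, sub_self]
    obtain ⟨y, hy⟩ := (ex₁ _).1 h0
    have hz : H.map p₁ (H.map i₂ x) = 0 := (ex₂ _).2 ⟨x, rfl⟩
    have hyx : y = x := by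
      have h1 : H.map p₁ (H.map i₁ y) = H.map p₁ (H.map δ x - H.map i₂ x) :=
        congrArg (H.map p₁) hy
      rwa [map_sub, hz, happ, happ, hid _ _ d₄, hid _ _ d₁, sub_zero] at h1
    rw [hyx] at hy
    exact (sub_eq_iff_eq_add.1 hy.symm)
  have c₁ : i₁ ≫ m = LCAlg.ofHom f := LCHom.ext fun a => by
    change f a + g 0 = f a
    rw [map_zero, add_zero]
  have c₂ : i₂ ≫ m = LCAlg.ofHom g := LCHom.ext fun a => by
    change f 0 + g a = g a
    rw [map_zero, zero_add]
  have c₃ : δ ≫ m = LCAlg.ofHom k := LCHom.ext fun a => (hk a).symm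
  ext x
  have := congrArg (H.map m) (hδ x)
  rw [map_add, happ, happ, happ, c₁, c₂, c₃] at this
  exact this

theorem SplitExact.idemClass_add (hH : SplitExact H) {D : LCAlg} {x y : D} (hx : x * x = x)
    (hy : y * y = y) (hxy : x * y = 0) (hyx : y * x = 0) (h : (x + y) * (x + y) = x + y)
    (A : LCAlg) : idemClass H (x + y) h A = idemClass H x hx A + idemClass H y hy A := by
  have h0 : ∀ a : A, (ProjTensor.tmul (0 : D) a : ProjTensor D A) = 0 := fun a =>
    LinearMap.map_zero₂ ProjTensor.tmulBilin a
  refine hH.map_add_of_orthogonal (B := D.tensor A) _ _ _ (fun a a' => ?_) (fun a a' => ?_)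
    (fun a => ?_)
  · exact (ProjTensor.tmul_mul_tmul x y a a').trans (by rw [hxy, h0])
  · exact (ProjTensor.tmul_mul_tmul y x a a').trans (by rw [hyx, h0])
  · exact LinearMap.map_add₂ ProjTensor.tmulBilin x y a

theorem SplitExact.idemClass_zero (hH : SplitExact H) {D : LCAlg} (A : LCAlg)
    (h : (0 : D) * 0 = 0) : idemClass H (0 : D) h A = 0 := by
  have := hH.idemClass_add h h h h (by rw [add_zero, h]) A
  rw [idemClass_congr (add_zero (0 : D)) _ h] at this
  simpa using this

/-- If the orthogonal idempotents `x i` all have the class `c`, then the class of their sum is the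
corresponding multiple of `c`. -/
theorem SplitExact.idemClass_sum (hH : SplitExact H) {D : LCAlg} {ι : Type*} [DecidableEq ι]
    (s : Finset ι) (x : ι → D) (hx : ∀ i j, x i * x j = if i = j then x i else 0) (A : LCAlg)
    (c : H.obj A ⟶ H.obj (D.tensor A))
    (hc : ∀ i (hi : x i * x i = x i), idemClass H (x i) hi A = c)
    (h : (∑ i ∈ s, x i) * ∑ i ∈ s, x i = ∑ i ∈ s, x i) :
    idemClass H (∑ i ∈ s, x i) h A = s.card • c := by
  induction s using Finset.induction_on with
  | empty =>
    rw [Finset.card_empty, zero_smul, ← hH.idemClass_zero A (mul_zero (0 : D))]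
    exact idemClass_congr (by simp) _ _ A
  | insert a s ha ih =>
    have ha' : ∀ i ∈ s, i ≠ a := fun i hi e => ha (e ▸ hi)
    have haa : x a * x a = x a := by simp [hx]
    have hs : (∑ i ∈ s, x i) * ∑ i ∈ s, x i = ∑ i ∈ s, x i := by
      rw [Finset.sum_mul_sum]
      refine Finset.sum_congr rfl fun i hi => ?_
      simp [hx, hi]
    have h1 : x a * ∑ i ∈ s, x i = 0 := by
      rw [Finset.mul_sum]
      exact Finset.sum_eq_zero fun i hi => by rw [hx, if_neg (ha' i hi).symm]
    have h2 : (∑ i ∈ s, x i) * x a = 0 := by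
      rw [Finset.sum_mul]
      exact Finset.sum_eq_zero fun i hi => by rw [hx, if_neg (ha' i hi)]
    rw [Finset.card_insert_of_notMem ha, succ_nsmul', ← ih hs, ← hc a haa,
      ← hH.idemClass_add haa hs h1 h2 (by rw [← Finset.sum_insert ha]; exact h)]
    exact idemClass_congr (Finset.sum_insert ha) _ _ A

end Classes

/-! ### The Schatten class as an ideal -/

section SchattenIdeal

variable {E : Type*} [NormedAddCommGroup E] [InnerProductSpace ℂ E] [CompleteSpace E] {p : ℝ}

/-- Writing `S` as a linear combination of four unitary operators bounds both multiplications by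
`S` for the Schatten norm. -/
theorem exists_schattenENorm_mul_le (hp : 1 ≤ p) (S : E →L[ℂ] E) : ∃ C : ℝ, 0 ≤ C ∧
    ∀ T : E →L[ℂ] E, schattenENorm p (S * T) ≤ ENNReal.ofReal C * schattenENorm p T ∧
      schattenENorm p (T * S) ≤ ENNReal.ofReal C * schattenENorm p T := by
  obtain ⟨u, c, hS, -⟩ := CStarAlgebra.exists_sum_four_unitary S
  refine ⟨∑ i, ‖c i‖, by positivity, fun T => ?_⟩
  rw [ENNReal.ofReal_sum_of_nonneg fun _ _ => norm_nonneg _, Finset.sum_mul]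
  simp only [ofReal_norm]
  constructor
  · nth_rewrite 1 [hS]
    rw [Finset.sum_mul]
    refine (schattenENorm_sum_le hp _ _).trans (Finset.sum_le_sum fun i _ => ?_)
    rw [smul_mul_assoc]
    exact (schattenENorm_smul_le hp _ _).trans
      (mul_le_mul' le_rfl (schattenENorm_unitary_mul (u i) T))
  · nth_rewrite 1 [hS]
    rw [Finset.mul_sum]
    refine (schattenENorm_sum_le hp _ _).trans (Finset.sum_le_sum fun i _ => ?_)
    rw [mul_smul_comm]
    exact (schattenENorm_smul_le hp _ _).trans
      (mul_le_mul' le_rfl (schattenENorm_mul_unitary (u i) T))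

namespace Schatten

variable [hp : Fact (1 ≤ p)]

theorem exists_mulLeft (S : E →L[ℂ] E) :
    ∃ l : Schatten p E →L[ℂ] Schatten p E, ∀ T, incl p E (l T) = S * incl p E T := by
  obtain ⟨C, hC, h⟩ := exists_schattenENorm_mul_le hp.out S
  have hmem : ∀ T : Schatten p E, schattenENorm p (S * incl p E T) < ∞ := fun T =>
    (h _).1.trans_lt (ENNReal.mul_lt_top ENNReal.ofReal_lt_top (lt_top T))
  let l : Schatten p E →ₗ[ℂ] Schatten p E :=
    { toFun := fun T => ⟨S * incl p E T, hmem T⟩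
      map_add' := fun T T' => incl_injective (mul_add S (incl p E T) (incl p E T'))
      map_smul' := fun c T => incl_injective (mul_smul_comm c S (incl p E T)) }
  refine ⟨l.mkContinuous C fun T => ?_, fun T => rfl⟩
  rw [norm_def, norm_def, ← ENNReal.toReal_ofReal hC, ← ENNReal.toReal_mul]
  exact ENNReal.toReal_mono (ENNReal.mul_lt_top ENNReal.ofReal_lt_top (lt_top T)).ne (h _).1

theorem exists_mulRight (S : E →L[ℂ] E) :
    ∃ l : Schatten p E →L[ℂ] Schatten p E, ∀ T, incl p E (l T) = incl p E T * S := by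
  obtain ⟨C, hC, h⟩ := exists_schattenENorm_mul_le hp.out S
  have hmem : ∀ T : Schatten p E, schattenENorm p (incl p E T * S) < ∞ := fun T =>
    (h _).2.trans_lt (ENNReal.mul_lt_top ENNReal.ofReal_lt_top (lt_top T))
  let l : Schatten p E →ₗ[ℂ] Schatten p E :=
    { toFun := fun T => ⟨incl p E T * S, hmem T⟩
      map_add' := fun T T' => incl_injective (add_mul (incl p E T) (incl p E T') S)
      map_smul' := fun c T => incl_injective (smul_mul_assoc c (incl p E T) S) }
  refine ⟨l.mkContinuous C fun T => ?_, fun T => rfl⟩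
  rw [norm_def, norm_def, ← ENNReal.toReal_ofReal hC, ← ENNReal.toReal_mul]
  exact ENNReal.toReal_mono (ENNReal.mul_lt_top ENNReal.ofReal_lt_top (lt_top T)).ne (h _).2

theorem mul_mem_range_left (S : E →L[ℂ] E) {T : E →L[ℂ] E} (hT : T ∈ Set.range (incl p E)) :
    S * T ∈ Set.range (incl p E) := by
  obtain ⟨k, rfl⟩ := hT
  obtain ⟨l, hl⟩ := exists_mulLeft (p := p) S
  exact ⟨l k, hl k⟩

theorem mul_mem_range_right (S : E →L[ℂ] E) {T : E →L[ℂ] E} (hT : T ∈ Set.range (incl p E)) :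
    T * S ∈ Set.range (incl p E) := by
  obtain ⟨k, rfl⟩ := hT
  obtain ⟨l, hl⟩ := exists_mulRight (p := p) S
  exact ⟨l k, hl k⟩

theorem sub_mem_range {S T : E →L[ℂ] E} (hS : S ∈ Set.range (incl p E))
    (hT : T ∈ Set.range (incl p E)) : S - T ∈ Set.range (incl p E) := by
  obtain ⟨k, rfl⟩ := hS
  obtain ⟨l, rfl⟩ := hT
  exact ⟨k - l, map_sub _ _ _⟩

theorem orthonormal_fin_cons {n : ℕ} {e : Fin n → E} (he : Orthonormal ℂ e) {x : E}
    (hx : ‖x‖ = 1) (h : ∀ i, inner ℂ (e i) x = 0) :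
    Orthonormal ℂ (Fin.cons x e : Fin (n + 1) → E) := by
  rw [orthonormal_iff_ite] at he ⊢
  intro i j
  refine Fin.cases ?_ (fun i => ?_) i <;> refine Fin.cases ?_ (fun j => ?_) j
  · simp [inner_self_eq_norm_sq_to_K, hx]
  · simp only [Fin.cons_zero, Fin.cons_succ, (Fin.succ_ne_zero j).symm, if_false]
    rw [← inner_conj_symm, h, map_zero]
  · simp [Fin.succ_ne_zero, h]
  · simp [he]

/-- A Schatten class operator is a limit of operators of finite rank: take orthonormal families
`e`, `f`, as long as possible, such that all `|⟨eᵢ, T fᵢ⟩|` are at least `ε`. By maximality the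
compression of `T` to the orthogonal complements of the families has norm at most `ε`. -/
theorem exists_finiteRange_norm_sub_le (T : Schatten p E) {ε : ℝ} (hε : 0 < ε) :
    ∃ G : E →L[ℂ] E, (G : E →ₗ[ℂ] E).HasFiniteRange ∧ ‖incl p E T - G‖ ≤ ε := by
  set S := incl p E T with hS
  have hp0 : 0 < p := by linarith [hp.out]
  let P : ℕ → Prop := fun n => ∃ e f : Fin n → E, Orthonormal ℂ e ∧ Orthonormal ℂ f ∧
    ∀ i, ε ≤ ‖inner ℂ (e i) (S (f i))‖
  obtain ⟨n, hn, hn'⟩ : ∃ n, P n ∧ ¬ P (n + 1) := by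
    by_contra! hcon
    have hall : ∀ n, P n := fun n => by
      induction n with
      | zero => exact ⟨Fin.elim0, Fin.elim0, ⟨fun i => i.elim0, fun i => i.elim0⟩,
          ⟨fun i => i.elim0, fun i => i.elim0⟩, fun i => i.elim0⟩
      | succ n ih => exact hcon n ih
    obtain ⟨n, hn⟩ := exists_nat_gt ((‖T‖ / ε) ^ p)
    obtain ⟨e, f, he, hf, h⟩ := hall n
    have h1 : (∑ _i : Fin n, ENNReal.ofReal ε ^ p) ^ (1 / p) ≤ schattenENorm p S := by
      refine le_trans ?_ (le_schattenENorm S he hf)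
      gcongr with i
      rw [← ofReal_norm]
      exact ENNReal.ofReal_le_ofReal (h i)
    rw [Finset.sum_const, Finset.card_univ, Fintype.card_fin, nsmul_eq_mul,
      ENNReal.mul_rpow_of_nonneg _ _ (by positivity), ← ENNReal.rpow_mul,
      mul_one_div_cancel hp0.ne', ENNReal.rpow_one] at h1
    have h2 := ENNReal.toReal_mono (lt_top T).ne h1
    rw [ENNReal.toReal_mul, ENNReal.toReal_ofReal hε.le, ← ENNReal.toReal_rpow,
      ENNReal.toReal_natCast, ← norm_def, ← le_div_iff₀ hε] at h2
    have h3 := Real.rpow_le_rpow (by positivity) h2 hp0.le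
    rw [← Real.rpow_mul (by positivity), one_div_mul_cancel hp0.ne', Real.rpow_one] at h3
    exact absurd hn (not_lt.2 h3)
  obtain ⟨e, f, he, hf, h⟩ := hn
  set U := Submodule.span ℂ (Set.range e)
  set V := Submodule.span ℂ (Set.range f)
  have : FiniteDimensional ℂ U := FiniteDimensional.span_of_finite ℂ (Set.finite_range e)
  have : FiniteDimensional ℂ V := FiniteDimensional.span_of_finite ℂ (Set.finite_range f)
  have hfin : ∀ W : Submodule ℂ E, FiniteDimensional ℂ W →
      ∀ Q : E →L[ℂ] E, (∀ x, Q x ∈ W) → (Q : E →ₗ[ℂ] E).HasFiniteRange := by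
    intro W hW Q hQ
    have hle : (Q : E →ₗ[ℂ] E).range ≤ W := by rintro _ ⟨x, rfl⟩; exact hQ x
    have := Submodule.finiteDimensional_of_le hle
    exact Submodule.FG.of_finite
  refine ⟨S - (1 - U.starProjection) * S * (1 - V.starProjection), ?_, ?_⟩
  · have h1 := hfin U ‹_› U.starProjection fun x => by simp
    have h2 := hfin V ‹_› V.starProjection fun x => by simp
    have h3 := (h1.comp_right (S : E →ₗ[ℂ] E)).add
      (h2.comp_left ((1 - U.starProjection) * S : E →L[ℂ] E))
    have h4 : ((S - (1 - U.starProjection) * S * (1 - V.starProjection) : E →L[ℂ] E) :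
        E →ₗ[ℂ] E) = U.starProjection ∘ₗ (S : E →ₗ[ℂ] E) +
          ((1 - U.starProjection) * S : E →L[ℂ] E) ∘ₗ (V.starProjection : E →ₗ[ℂ] E) := by
      ext x
      simp
      abel
    rw [h4]
    exact h3
  · rw [sub_sub_cancel]
    refine ContinuousLinearMap.opNorm_le_bound _ hε.le fun y => ?_
    set z := y - V.starProjection y with hz
    set w := S z - U.starProjection (S z) with hw
    change ‖w‖ ≤ ε * ‖y‖
    have hzV : z ∈ Vᗮ := V.sub_starProjection_mem_orthogonal y
    have hwU : w ∈ Uᗮ := U.sub_starProjection_mem_orthogonal (S z)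
    have hzy : ‖z‖ ≤ ‖y‖ := by
      have : z = Vᗮ.starProjection y := by
        rw [Submodule.starProjection_orthogonal']; rfl
      rw [this]
      exact Submodule.norm_starProjection_apply_le _ _
    refine le_trans ?_ (mul_le_mul_of_nonneg_left hzy hε.le)
    by_contra! hlt
    have hw0 : 0 < ‖w‖ := lt_of_le_of_lt (by positivity) hlt
    have hz0 : 0 < ‖z‖ := by
      refine norm_pos_iff.2 fun h0 => ?_
      rw [h0, map_zero, map_zero, sub_zero] at hw
      rw [hw, norm_zero] at hw0
      exact lt_irrefl _ hw0
    have hin : inner ℂ w (S z) = (‖w‖ : ℂ) ^ 2 := by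
      have h1 : inner ℂ w (U.starProjection (S z)) = 0 :=
        Submodule.inner_left_of_mem_orthogonal (by simp) hwU
      rw [← sub_zero (inner ℂ w (S z)), ← h1, ← inner_sub_right, ← hw]
      exact inner_self_eq_norm_sq_to_K w
    refine hn' ⟨Fin.cons (((‖w‖⁻¹ : ℝ) : ℂ) • w) e, Fin.cons (((‖z‖⁻¹ : ℝ) : ℂ) • z) f,
      orthonormal_fin_cons he (by simp [norm_smul, hw0.ne']) fun i => ?_,
      orthonormal_fin_cons hf (by simp [norm_smul, hz0.ne']) fun i => ?_, fun i => ?_⟩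
    · rw [inner_smul_right, Submodule.inner_right_of_mem_orthogonal
        (Submodule.subset_span (Set.mem_range_self i)) hwU, mul_zero]
    · rw [inner_smul_right, Submodule.inner_right_of_mem_orthogonal
        (Submodule.subset_span (Set.mem_range_self i)) hzV, mul_zero]
    · refine Fin.cases ?_ (fun i => ?_) i
      · rw [Fin.cons_zero, Fin.cons_zero, map_smul, inner_smul_left, inner_smul_right, hin]
        simp only [Complex.conj_ofReal, norm_mul, Complex.norm_real, norm_inv, norm_norm, norm_pow]
        rw [show ‖w‖⁻¹ * (‖z‖⁻¹ * ‖w‖ ^ 2) = ‖w‖ / ‖z‖ by field_simp, le_div_iff₀ hz0]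
        exact hlt.le
      · simpa using h i

end Schatten

end SchattenIdeal

/-! ### Idempotents of finite rank -/

section FiniteRank

variable {E : Type} [NormedAddCommGroup E] [InnerProductSpace ℂ E] [CompleteSpace E] {p : ℝ}
  [hp : Fact (1 ≤ p)] {H : LCAlg ⥤ AddCommGrpCat.{w}} {e : Schatten p E}

theorem IsMinimalProjection.exists_eq_smulRight (he : IsMinimalProjection e) :
    ∃ (ψ : E →L[ℂ] ℂ) (ξ : E), ψ ξ = 1 ∧ Schatten.incl p E e = ψ.smulRight ξ := by
  obtain ⟨hproj, hrank⟩ := he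
  obtain ⟨⟨ξ, hξ⟩, hξ0, hspan⟩ := finrank_eq_one_iff'.1 hrank
  have hξ0' : ξ ≠ 0 := fun h => hξ0 (Subtype.ext h)
  obtain ⟨y, rfl⟩ := hξ
  set P := Schatten.incl p E e
  have hPP : ∀ x, P (P x) = P x := fun x => DFunLike.congr_fun hproj.isIdempotentElem x
  obtain ⟨ψ, hψ⟩ := SeparatingDual.exists_eq_one (R := ℂ) hξ0'
  refine ⟨ψ ∘L P, P y, ?_, ?_⟩
  · exact (congrArg ψ (hPP y)).trans hψ
  · ext x
    obtain ⟨c, hc⟩ := hspan ⟨P x, x, rfl⟩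
    have hc' : c • P y = P x := congrArg Subtype.val hc
    have hψ' : ψ (P y) = 1 := hψ
    simp [← hc', hψ']

/-- The Schatten class contains all operators of rank one, as it is an ideal which contains one of
them. -/
theorem IsMinimalProjection.smulRight_mem (he : IsMinimalProjection e) (φ : E →L[ℂ] ℂ) (b : E) :
    φ.smulRight b ∈ Set.range (Schatten.incl p E) := by
  obtain ⟨ψ, ξ, hψ, h⟩ := he.exists_eq_smulRight
  have : φ.smulRight b = ψ.smulRight b * Schatten.incl p E e * φ.smulRight ξ := by
    rw [h]
    ext x
    simp [hψ]
  rw [this]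
  exact Schatten.mul_mem_range_right _ (Schatten.mul_mem_range_left _ ⟨e, rfl⟩)

/-- All idempotents of rank one have the same class: two of them with the same range or the same
kernel are joined by a segment of idempotents, and the general case follows in three steps by means
of a functional `η` which vanishes on neither of the ranges. -/
theorem idemClass_eq_of_rank_one (he : IsMinimalProjection e) (hdi : DiffotopyInvariant H)
    {x y : LCAlg.of (Schatten p E)} (hx : x * x = x) (hy : y * y = y) {φ ψ : E →L[ℂ] ℂ} {b c : E}
    (hφ : φ b = 1) (hψ : ψ c = 1) (hxe : Schatten.incl p E x = φ.smulRight b)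
    (hye : Schatten.incl p E y = ψ.smulRight c) (A : LCAlg) :
    idemClass H x hx A = idemClass H y hy A := by
  have hb : b ≠ 0 := by rintro rfl; simp at hφ
  have hc : c ≠ 0 := by rintro rfl; simp at hψ
  obtain ⟨η, hηb, hηc⟩ : ∃ η : E →L[ℂ] ℂ, η b ≠ 0 ∧ η c ≠ 0 := by
    by_cases h : inner ℂ b c = 0
    · have h' : inner ℂ c b = 0 := by rw [← inner_conj_symm, h, map_zero]
      refine ⟨innerSL ℂ (b + c), ?_, ?_⟩
      · simpa [inner_add_left, h'] using hb
      · simpa [inner_add_left, h] using hc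
    · exact ⟨innerSL ℂ b, by simpa using hb, by simpa using h⟩
  obtain ⟨u, hu⟩ := he.smulRight_mem (p := p) ((η b)⁻¹ • η) b
  obtain ⟨v, hv⟩ := he.smulRight_mem (p := p) ((η c)⁻¹ • η) c
  have huu : u * u = u := Schatten.incl_injective (by
    rw [map_mul, hu]; ext z; simp [hηb])
  have hvv : v * v = v := Schatten.incl_injective (by
    rw [map_mul, hv]; ext z; simp [hηc])
  have h1 : x * u + u * x = x + u := Schatten.incl_injective (by
    rw [map_add, map_add, map_mul, map_mul, hu, hxe]
    ext z
    simp [hηb, hφ, add_comm])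
  have h2 : u * v + v * u = u + v := Schatten.incl_injective (by
    rw [map_add, map_add, map_mul, map_mul, hu, hv]
    ext z
    have e₁ : (η c)⁻¹ * η z * ((η b)⁻¹ * η c) = (η b)⁻¹ * η z := by field_simp
    have e₂ : (η b)⁻¹ * η z * ((η c)⁻¹ * η b) = (η c)⁻¹ * η z := by field_simp
    simp [smul_smul, e₁, e₂])
  have h3 : v * y + y * v = v + y := Schatten.incl_injective (by
    rw [map_add, map_add, map_mul, map_mul, hv, hye]
    ext z
    simp [hηc, hψ, add_comm])
  exact ((hdi.idemClass_eq_of_segment hx huu h1 A).trans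
    (hdi.idemClass_eq_of_segment (D := LCAlg.of (Schatten p E)) huu hvv h2 A)).trans
    (hdi.idemClass_eq_of_segment hvv hy h3 A)

/-- The class of an idempotent of finite rank is its rank times the class of a minimal projection:
a basis of the range splits it into orthogonal idempotents of rank one. -/
theorem idemClass_eq_finrank_smul (he : IsMinimalProjection e) (hH : SplitExact H)
    (hdi : DiffotopyInvariant H) {r : LCAlg.of (Schatten p E)} (hr : r * r = r)
    (hfin : (Schatten.incl p E r : E →ₗ[ℂ] E).HasFiniteRange) (A : LCAlg) :
    idemClass H r hr A = Module.finrank ℂ (Schatten.incl p E r).range •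
      idemClass H (D := LCAlg.of (Schatten p E)) e he.mul_self A := by
  set R := Schatten.incl p E r with hR
  have hRR : ∀ x, R (R x) = R x := fun x => by
    have := congrArg (Schatten.incl p E) hr
    rw [map_mul] at this
    exact DFunLike.congr_fun this x
  have : FiniteDimensional ℂ R.range := Module.Finite.of_fg hfin
  let b := Module.finBasis ℂ R.range
  let φ : Fin (Module.finrank ℂ R.range) → E →L[ℂ] ℂ := fun i =>
    (LinearMap.toContinuousLinearMap (b.coord i)) ∘L R.rangeRestrict
  have hφ : ∀ i j, φ i (b j) = if j = i then 1 else 0 := fun i j => by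
    obtain ⟨x, hx⟩ := (b j).2
    have : R.rangeRestrict (b j : E) = b j := by
      refine Subtype.ext ?_
      change R (b j : E) = b j
      rw [← hx]
      exact hRR x
    change b.coord i (R.rangeRestrict (b j : E)) = _
    rw [this, Module.Basis.coord_apply, Module.Basis.repr_self, Finsupp.single_apply]
  choose x hx using fun i => he.smulRight_mem (p := p) (φ i) (b i : E)
  have hmul : ∀ i j, x i * x j = if i = j then x i else 0 := fun i j =>
    Schatten.incl_injective (by
      rw [map_mul, hx, hx]
      split_ifs with h
      · subst h
        rw [hx]
        ext z
        simp [hφ]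
      · ext z
        simp [hφ, Ne.symm h])
  have hsum : ∑ i, x i = r := Schatten.incl_injective (by
    rw [map_sum]
    ext z
    have := congrArg Subtype.val (b.sum_repr ⟨R z, z, rfl⟩)
    rw [Submodule.coe_sum] at this
    refine Eq.trans ?_ this
    simp only [hx, _root_.sum_apply]
    rfl)
  have h := hH.idemClass_sum (D := LCAlg.of (Schatten p E)) Finset.univ x hmul A
    (idemClass H (D := LCAlg.of (Schatten p E)) e he.mul_self A) (fun i hi => by
      obtain ⟨ψ, ξ, hψ, hψe⟩ := he.exists_eq_smulRight
      exact idemClass_eq_of_rank_one he hdi hi he.mul_self (by simp [hφ]) hψ (hx i) hψe A)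
    (by rw [hsum]; exact hr)
  rw [Finset.card_univ, Fintype.card_fin] at h
  rw [← h]
  exact idemClass_congr hsum.symm _ _ A

end FiniteRank

/-! ### Fredholm operators -/

section Fredholm

open LinearMap LinearMap.FiniteRangeSetoid

variable {X Y : Type*} [NormedAddCommGroup X] [NormedSpace ℂ X] [NormedAddCommGroup Y]
  [NormedSpace ℂ Y]

/-- If `1 - s` is the sum of an operator of norm less than one and an operator of finite rank, then
`s` is invertible up to operators of finite rank. -/
theorem exists_quasiInverse_of_norm_sub_lt_one [CompleteSpace X] (s G : X →L[ℂ] X)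
    (hG : (G : X →ₗ[ℂ] X).HasFiniteRange) (h : ‖1 - s - G‖ < 1) :
    ∃ g : X →L[ℂ] X, (g * s : X →L[ℂ] X).toLinearMap ≈ .id ∧
      (s * g : X →L[ℂ] X).toLinearMap ≈ .id := by
  obtain ⟨g, h1, h2⟩ : ∃ g : X →L[ℂ] X, g * (s + G) = 1 ∧ (s + G) * g = 1 := by
    let U := Units.oneSub (1 - s - G) h
    have hU : (U : X →L[ℂ] X) = s + G := by
      rw [Units.val_oneSub]; abel
    exact ⟨_, hU ▸ U.inv_mul, hU ▸ U.mul_inv⟩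
  refine ⟨g, ?_, ?_⟩
  · rw [equiv_iff_hasFiniteRange]
    have : (g * s : X →L[ℂ] X).toLinearMap - .id = -((g : X →ₗ[ℂ] X) ∘ₗ (G : X →ₗ[ℂ] X)) := by
      ext x
      have h3 : g (s x + G x) = x := DFunLike.congr_fun h1 x
      change g (s x) - x = -g (G x)
      nth_rewrite 2 [← h3]
      rw [map_add]
      abel
    rw [this]
    exact (hG.comp_left (g : X →ₗ[ℂ] X)).neg
  · rw [equiv_iff_hasFiniteRange]
    have : (s * g : X →L[ℂ] X).toLinearMap - .id = -((G : X →ₗ[ℂ] X) ∘ₗ (g : X →ₗ[ℂ] X)) := by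
      ext x
      have h3 : s (g x) + G (g x) = x := DFunLike.congr_fun h2 x
      change s (g x) - x = -G (g x)
      nth_rewrite 2 [← h3]
      abel
    rw [this]
    exact (hG.comp_right (g : X →ₗ[ℂ] X)).neg

/-- A Fredholm operator `u` has a generalised inverse `v`, for which `1 - v u` and `1 - u v` are
idempotents of finite rank; the first one projects onto the kernel of `u`, the second one has the
dimension of the cokernel as its rank. -/
theorem ContinuousLinearMap.IsFredholm.exists_generalizedInverse {u : X →L[ℂ] Y}
    (hu : u.IsFredholm) : ∃ v : Y →L[ℂ] X, u ∘L v ∘L u = u ∧ v ∘L u ∘L v = v ∧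
      (.id ℂ X - v ∘L u).toLinearMap.HasFiniteRange ∧
      (.id ℂ Y - u ∘L v).toLinearMap.HasFiniteRange ∧
      Module.finrank ℂ (.id ℂ X - v ∘L u).range = Module.finrank ℂ u.ker ∧
      Module.finrank ℂ (.id ℂ Y - u ∘L v).range = Module.finrank ℂ (Y ⧸ u.range) := by
  obtain ⟨pkg⟩ := hu.nonempty_fredholmPackage
  have hu' : ∀ x, u x = pkg.equiv (pkg.decDom.proj x) := fun x =>
    DFunLike.congr_fun pkg.eq_equiv x
  have hv' : ∀ y, pkg.quasiInverse y = pkg.equiv.symm (pkg.decCodom.proj y) := fun y => rfl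
  have hpd : ∀ x : pkg.decDom.X₁, pkg.decDom.proj x = x := fun x => by simp
  have hpc : ∀ x : pkg.decCodom.X₁, pkg.decCodom.proj x = x := fun x => by simp
  have huvu : ∀ x, u (pkg.quasiInverse (u x)) = u x := fun x => by
    rw [hu' x, hv', hpc, hu', hpd]; simp
  have hvuv : ∀ y, pkg.quasiInverse (u (pkg.quasiInverse y)) = pkg.quasiInverse y := fun y => by
    rw [hv' y, hu', hpd, hv', hpc]; simp
  have h3 : (.id ℂ X - pkg.quasiInverse ∘L u).range = u.ker := by
    ext x
    constructor
    · rintro ⟨y, rfl⟩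
      change u (y - pkg.quasiInverse (u y)) = 0
      rw [map_sub, huvu, sub_self]
    · intro hx
      have hx' : u x = 0 := hx
      refine ⟨x, ?_⟩
      change x - pkg.quasiInverse (u x) = x
      rw [hx', map_zero, sub_zero]
  have h4 : (.id ℂ Y - u ∘L pkg.quasiInverse).ker = u.range := by
    ext y
    constructor
    · intro hy
      exact ⟨pkg.quasiInverse y, (sub_eq_zero.1 hy).symm⟩
    · rintro ⟨x, rfl⟩
      change u x - u (pkg.quasiInverse (u x)) = 0
      rw [huvu, sub_self]
  have eqv : (Y ⧸ u.range) ≃ₗ[ℂ] (.id ℂ Y - u ∘L pkg.quasiInverse).range :=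
    (Submodule.quotEquivOfEq _ _ h4.symm).trans (LinearMap.quotKerEquivRange _)
  have := hu.finite_ker
  have : FiniteDimensional ℂ (Y ⧸ u.range) := hu.finite_coker
  have := Module.Finite.equiv eqv
  refine ⟨pkg.quasiInverse, ContinuousLinearMap.ext huvu, ContinuousLinearMap.ext hvuv, ?_,
    Submodule.FG.of_finite, by rw [h3], eqv.finrank_eq.symm⟩
  rw [HasFiniteRange, h3]
  exact Submodule.FG.of_finite

variable {E : Type*} [NormedAddCommGroup E] [InnerProductSpace ℂ E] [CompleteSpace E] {p : ℝ}
  [hp : Fact (1 ≤ p)]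

/-- If `X` is a retract of the Hilbert space, and `1 - s` is of Schatten class when extended by
zero, then `s` is invertible up to operators of finite rank. -/
theorem Schatten.exists_quasiInverse [CompleteSpace X] {ι : X →L[ℂ] E} {π : E →L[ℂ] X}
    (hπ : π ∘L ι = .id ℂ X) (s : X →L[ℂ] X)
    (h : ι ∘L (1 - s) ∘L π ∈ Set.range (incl p E)) :
    ∃ g : X →L[ℂ] X, (g * s : X →L[ℂ] X).toLinearMap ≈ .id ∧
      (s * g : X →L[ℂ] X).toLinearMap ≈ .id := by
  obtain ⟨k, hk⟩ := h
  have hC : 0 < ‖π‖ * ‖ι‖ + 1 := by positivity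
  obtain ⟨G, hG, hGε⟩ := k.exists_finiteRange_norm_sub_le (inv_pos.2 hC)
  refine exists_quasiInverse_of_norm_sub_lt_one s (π ∘L G ∘L ι)
    ((hG.comp_right (ι : X →ₗ[ℂ] E)).comp_left (π : E →ₗ[ℂ] X)) ?_
  have hπ' : ∀ x, π (ι x) = x := fun x => DFunLike.congr_fun hπ x
  have e : 1 - s - π ∘L G ∘L ι = π ∘L (incl p E k - G) ∘L ι := by
    rw [hk]
    ext x
    simp [hπ']
  rw [e]
  calc ‖π ∘L (incl p E k - G) ∘L ι‖ ≤ ‖π‖ * (‖incl p E k - G‖ * ‖ι‖) :=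
        (ContinuousLinearMap.opNorm_comp_le _ _).trans
          (mul_le_mul_of_nonneg_left (ContinuousLinearMap.opNorm_comp_le _ _) (norm_nonneg _))
    _ ≤ ‖π‖ * ((‖π‖ * ‖ι‖ + 1)⁻¹ * ‖ι‖) := by gcongr
    _ = (‖π‖ * ‖ι‖) / (‖π‖ * ‖ι‖ + 1) := by rw [div_eq_mul_inv]; ring
    _ < 1 := (div_lt_one hC).2 (lt_add_one _)

/-- An operator between retracts of the Hilbert space which has an inverse modulo the Schatten
class is Fredholm. -/
theorem Schatten.isFredholm [CompleteSpace X] [CompleteSpace Y] {ι : X →L[ℂ] E} {π : E →L[ℂ] X}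
    (hπ : π ∘L ι = .id ℂ X) {ι' : Y →L[ℂ] E} {π' : E →L[ℂ] Y} (hπ' : π' ∘L ι' = .id ℂ Y)
    {u : X →L[ℂ] Y} {v : Y →L[ℂ] X} (hvu : ι ∘L (1 - v ∘L u) ∘L π ∈ Set.range (incl p E))
    (huv : ι' ∘L (1 - u ∘L v) ∘L π' ∈ Set.range (incl p E)) : u.IsFredholm := by
  obtain ⟨g, hg, -⟩ := exists_quasiInverse hπ _ hvu
  obtain ⟨g', -, hg'⟩ := exists_quasiInverse hπ' _ huv
  have hl : ((g : X →ₗ[ℂ] X) ∘ₗ (v : Y →ₗ[ℂ] X)) ∘ₗ (u : X →ₗ[ℂ] Y) ≈ .id := hg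
  have hr : (u : X →ₗ[ℂ] Y) ∘ₗ ((v : Y →ₗ[ℂ] X) ∘ₗ (g' : Y →ₗ[ℂ] Y)) ≈ .id := hg'
  -- A left and a right inverse modulo operators of finite rank agree modulo such operators.
  have he : (g : X →ₗ[ℂ] X) ∘ₗ (v : Y →ₗ[ℂ] X) ≈ (v : Y →ₗ[ℂ] X) ∘ₗ (g' : Y →ₗ[ℂ] Y) := by
    have h1 := equiv_comp_left (u' := (g : X →ₗ[ℂ] X) ∘ₗ (v : Y →ₗ[ℂ] X)) (Setoid.symm hr)
    have h2 := equiv_comp_right (u := (v : Y →ₗ[ℂ] X) ∘ₗ (g' : Y →ₗ[ℂ] Y)) hl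
    exact Setoid.trans h1 h2
  exact .of_isQuasiInverse (v := g ∘L v) ⟨hl, Setoid.trans (equiv_comp_left he) hr⟩

end Fredholm

/-! ### The Fredholm operator of a Kasparov module -/

section KasparovFredholm

variable {E : Type*} [NormedAddCommGroup E] [InnerProductSpace ℂ E] [CompleteSpace E] {p : ℝ}
  [hp : Fact (1 ≤ p)] (K : LCKasparovModule ℂ (Schatten p E) (E →L[ℂ] E) (Schatten.incl p E))

namespace LCKasparovModule

theorem P_mul_P_mul (x : E →L[ℂ] E) : K.P * (K.P * x) = K.P * x := by
  rw [← mul_assoc, K.P_sq]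

theorem F_mul_P_mul (x : E →L[ℂ] E) : K.F * (K.P * x) = K.F * x - K.P * (K.F * x) := by
  rw [← mul_assoc, K.F_mul_P, sub_mul, mul_assoc]

theorem φ_mul_P_mul (x : E →L[ℂ] E) : K.φ 1 * (K.P * x) = K.P * (K.φ 1 * x) := by
  rw [← mul_assoc, K.φ_mul_P, mul_assoc]

theorem φ_one_mul_self : K.φ 1 * K.φ 1 = K.φ 1 := by
  rw [← map_mul, one_mul]

theorem φ_one_mul_mul (x : E →L[ℂ] E) : K.φ 1 * (K.φ 1 * x) = K.φ 1 * x := by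
  rw [← mul_assoc, K.φ_one_mul_self]

theorem Pφ_idem : K.P * K.φ 1 * (K.P * K.φ 1) = K.P * K.φ 1 := by
  simp only [mul_assoc, P_mul_P_mul, φ_mul_P_mul, φ_one_mul_self]

theorem Pperpφ_idem : K.Pperp * K.φ 1 * (K.Pperp * K.φ 1) = K.Pperp * K.φ 1 := by
  simp only [Pperp, mul_assoc, sub_mul, mul_sub, one_mul, P_mul_P_mul, φ_mul_P_mul,
    φ_one_mul_self]
  abel

theorem φ_defect_mem : K.φ 1 * (1 - K.F * K.F) ∈ Set.range (Schatten.incl p E) :=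
  let ⟨g, _, h⟩ := K.φ_defect
  ⟨g 1, h 1⟩

theorem commutator_mem : K.φ 1 * K.F - K.F * K.φ 1 ∈ Set.range (Schatten.incl p E) :=
  let ⟨g, _, h⟩ := K.commutator
  ⟨g 1, h 1⟩

/-- The two components of `F` between the even and the odd part are inverse to each other modulo
the Schatten class; this is the even part. -/
theorem even_defect_mem : K.P * K.φ 1 - K.P * K.φ 1 * K.F * (K.Pperp * K.φ 1 * K.F) *
    (K.P * K.φ 1) ∈ Set.range (Schatten.incl p E) := by
  have : K.P * K.φ 1 - K.P * K.φ 1 * K.F * (K.Pperp * K.φ 1 * K.F) * (K.P * K.φ 1) =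
      K.P * (K.φ 1 * (1 - K.F * K.F)) * (K.P * K.φ 1) -
        K.P * K.φ 1 * K.F * (K.φ 1 * K.F - K.F * K.φ 1) * (K.P * K.φ 1) := by
    simp only [Pperp, mul_assoc, sub_mul, mul_sub, one_mul, mul_one, P_mul_P_mul, φ_mul_P_mul,
      φ_one_mul_self, F_mul_P_mul]
    abel
  rw [this]
  exact Schatten.sub_mem_range
    (Schatten.mul_mem_range_right _ (Schatten.mul_mem_range_left _ K.φ_defect_mem))
    (Schatten.mul_mem_range_right _ (Schatten.mul_mem_range_left _ K.commutator_mem))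

theorem odd_defect_mem : K.Pperp * K.φ 1 - K.Pperp * K.φ 1 * K.F * (K.P * K.φ 1 * K.F) *
    (K.Pperp * K.φ 1) ∈ Set.range (Schatten.incl p E) := by
  have : K.Pperp * K.φ 1 - K.Pperp * K.φ 1 * K.F * (K.P * K.φ 1 * K.F) * (K.Pperp * K.φ 1) =
      K.Pperp * (K.φ 1 * (1 - K.F * K.F)) * (K.Pperp * K.φ 1) -
        K.Pperp * K.φ 1 * K.F * (K.φ 1 * K.F - K.F * K.φ 1) * (K.Pperp * K.φ 1) := by
    simp only [Pperp, mul_assoc, sub_mul, mul_sub, one_mul, mul_one, P_mul_P_mul, φ_mul_P_mul,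
      φ_one_mul_self, F_mul_P_mul]
    abel
  rw [this]
  exact Schatten.sub_mem_range
    (Schatten.mul_mem_range_right _ (Schatten.mul_mem_range_left _ K.φ_defect_mem))
    (Schatten.mul_mem_range_right _ (Schatten.mul_mem_range_left _ K.commutator_mem))

/-- The component of `F` from the odd to the even part. -/
noncomputable def oddToEven : K.oddSpace →L[ℂ] K.evenSpace :=
  ((K.P * K.φ 1 * K.F).comp K.oddSpace.subtypeL).codRestrict K.evenSpace fun x => ⟨K.F x, rfl⟩

theorem rangeRestrict_comp_subtypeL {q : E →L[ℂ] E} (hq : q * q = q) :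
    q.rangeRestrict ∘L q.range.subtypeL = .id ℂ q.range := by
  ext ⟨_, y, rfl⟩
  exact DFunLike.congr_fun hq y

theorem completeSpace_range {q : E →L[ℂ] E} (hq : q * q = q) : CompleteSpace q.range :=
  (ContinuousLinearMap.IsIdempotentElem.isClosed_range hq).completeSpace_coe

theorem isFredholm_oddPart : K.oddPart.IsFredholm := by
  have : CompleteSpace K.evenSpace := completeSpace_range K.Pφ_idem
  have : CompleteSpace K.oddSpace := completeSpace_range K.Pperpφ_idem
  exact Schatten.isFredholm (p := p) (X := K.evenSpace) (Y := K.oddSpace)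
    (rangeRestrict_comp_subtypeL K.Pφ_idem)
    (rangeRestrict_comp_subtypeL K.Pperpφ_idem) (u := K.oddPart) (v := K.oddToEven)
    K.even_defect_mem K.odd_defect_mem

theorem hasFiniteRange_and_finrank_range_retract {X : Type*} [NormedAddCommGroup X]
    [NormedSpace ℂ X] {ι : X →L[ℂ] E} {π : E →L[ℂ] X} (hπ : π ∘L ι = .id ℂ X) {s : X →L[ℂ] X}
    (hs : s.toLinearMap.HasFiniteRange) :
    (ι ∘L s ∘L π).toLinearMap.HasFiniteRange ∧
      Module.finrank ℂ (ι ∘L s ∘L π).range = Module.finrank ℂ s.range := by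
  have hπ' : ∀ x, π (ι x) = x := fun x => DFunLike.congr_fun hπ x
  have hinj : Function.Injective ι := Function.LeftInverse.injective hπ'
  have hr : (ι ∘L s ∘L π).range = s.range.map ι.toLinearMap := by
    ext y
    constructor
    · rintro ⟨x, rfl⟩
      exact ⟨s (π x), ⟨π x, rfl⟩, rfl⟩
    · rintro ⟨_, ⟨x, rfl⟩, rfl⟩
      exact ⟨ι x, congrArg (fun z => ι (s z)) (hπ' x)⟩
  refine ⟨(hs.comp_right π.toLinearMap).comp_left ι.toLinearMap, ?_⟩
  rw [hr]
  exact (Submodule.equivMapOfInjective ι.toLinearMap hinj s.range).finrank_eq.symm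

/-- The component `T = P^⊥ φ(1) F P φ(1)` of `F` has a generalised inverse `S`, and the idempotents
`P φ(1) - S T` and `P^⊥ φ(1) - T S` are of finite rank, with the dimensions of kernel and cokernel
as their ranks. -/
theorem exists_generalizedInverse : ∃ S : E →L[ℂ] E,
    K.P * K.φ 1 * S = S ∧ S * (K.Pperp * K.φ 1) = S ∧
    K.Pperp * K.φ 1 * K.F * (K.P * K.φ 1) * S * (K.Pperp * K.φ 1 * K.F * (K.P * K.φ 1)) =
      K.Pperp * K.φ 1 * K.F * (K.P * K.φ 1) ∧
    S * (K.Pperp * K.φ 1 * K.F * (K.P * K.φ 1)) * S = S ∧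
    (K.P * K.φ 1 - S * (K.Pperp * K.φ 1 * K.F * (K.P * K.φ 1))).toLinearMap.HasFiniteRange ∧
    (K.Pperp * K.φ 1 - K.Pperp * K.φ 1 * K.F * (K.P * K.φ 1) * S).toLinearMap.HasFiniteRange ∧
    (Module.finrank ℂ (K.P * K.φ 1 - S * (K.Pperp * K.φ 1 * K.F * (K.P * K.φ 1))).range : ℤ) -
      Module.finrank ℂ (K.Pperp * K.φ 1 - K.Pperp * K.φ 1 * K.F * (K.P * K.φ 1) * S).range =
      fredholmIndex K.oddPart := by
  obtain ⟨v, huvu, hvuv, hf, hf', hr, hr'⟩ := K.isFredholm_oddPart.exists_generalizedInverse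
  set u := K.oddPart
  set q := K.P * K.φ 1 with hq
  set q' := K.Pperp * K.φ 1 with hq'
  have hπ := rangeRestrict_comp_subtypeL K.Pφ_idem
  have hπ' := rangeRestrict_comp_subtypeL K.Pperpφ_idem
  let ι : K.evenSpace →L[ℂ] E := K.evenSpace.subtypeL
  let π : E →L[ℂ] K.evenSpace := q.rangeRestrict
  let ι' : K.oddSpace →L[ℂ] E := K.oddSpace.subtypeL
  let π' : E →L[ℂ] K.oddSpace := q'.rangeRestrict
  have hx : ∀ x, π (ι x) = x := fun x => DFunLike.congr_fun hπ x
  have hx' : ∀ x, π' (ι' x) = x := fun x => DFunLike.congr_fun hπ' x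
  have hT : q' * K.F * q = ι' ∘L u ∘L π := rfl
  have hqe : q = ι ∘L π := rfl
  have hqe' : q' = ι' ∘L π' := rfl
  have h1 := hasFiniteRange_and_finrank_range_retract (ι := ι) (π := π) hπ hf
  have h2 := hasFiniteRange_and_finrank_range_retract (ι := ι') (π := π') hπ' hf'
  have e1 : q - ι ∘L v ∘L π' * (q' * K.F * q) = ι ∘L (.id ℂ K.evenSpace - v ∘L u) ∘L π := by
    rw [hT]
    ext x
    change (ι (π x) : E) - ι (v (π' (ι' (u (π x))))) = ι (π x - v (u (π x)))
    rw [hx', map_sub]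
  have e2 : q' - q' * K.F * q * ι ∘L v ∘L π' = ι' ∘L (.id ℂ K.oddSpace - u ∘L v) ∘L π' := by
    rw [hT]
    ext x
    change (ι' (π' x) : E) - ι' (u (π (ι (v (π' x))))) = ι' (π' x - u (v (π' x)))
    rw [hx, map_sub]
  refine ⟨ι ∘L v ∘L π', ?_, ?_, ?_, ?_, ?_, ?_, ?_⟩
  · ext x
    exact congrArg ι (hx (v (π' x)))
  · ext x
    exact congrArg (fun z => ι (v z)) (hx' (π' x))
  · rw [hT]
    ext x
    change ι' (u (π (ι (v (π' (ι' (u (π x)))))))) = ι' (u (π x))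
    rw [hx, hx']
    exact congrArg ι' (DFunLike.congr_fun huvu (π x))
  · rw [hT]
    ext x
    change ι (v (π' (ι' (u (π (ι (v (π' x)))))))) = ι (v (π' x))
    rw [hx, hx']
    exact congrArg ι (DFunLike.congr_fun hvuv (π' x))
  · rw [e1]; exact h1.1
  · rw [e2]; exact h2.1
  · rw [e1, e2, h1.2, h2.2, hr, hr', fredholmIndex]

end LCKasparovModule

end KasparovFredholm

/-! ### Deformation of the Kasparov module -/

section Deformation

open unitInterval

variable {E : Type*} [NormedAddCommGroup E] [InnerProductSpace ℂ E] [CompleteSpace E] {p : ℝ}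
  [hp : Fact (1 ≤ p)]

/-- The path `g` of operators is the sum of the constant `m` and a smooth path with flat ends in
the Schatten class. -/
def IsSchattenPath (p : ℝ) [Fact (1 ≤ p)] (m : E →L[ℂ] E) (g : I → E →L[ℂ] E) : Prop :=
  ∃ h ∈ flatSmooth (Schatten p E), ∀ t, g t = m + Schatten.incl p E (h t)

namespace IsSchattenPath

variable {m n : E →L[ℂ] E} {g k : I → E →L[ℂ] E}

theorem const (m : E →L[ℂ] E) : IsSchattenPath p m fun _ => m :=
  ⟨0, zero_mem _, fun t => by rw [Pi.zero_apply, map_zero, add_zero]⟩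

theorem add (hg : IsSchattenPath p m g) (hk : IsSchattenPath p n k) :
    IsSchattenPath p (m + n) fun t => g t + k t := by
  obtain ⟨x, hx, e⟩ := hg
  obtain ⟨y, hy, e'⟩ := hk
  exact ⟨x + y, add_mem hx hy, fun t => by
    dsimp only
    rw [e, e', Pi.add_apply, map_add]
    abel⟩

theorem sub (hg : IsSchattenPath p m g) (hk : IsSchattenPath p n k) :
    IsSchattenPath p (m - n) fun t => g t - k t := by
  obtain ⟨x, hx, e⟩ := hg
  obtain ⟨y, hy, e'⟩ := hk
  exact ⟨x - y, sub_mem hx hy, fun t => by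
    dsimp only
    rw [e, e', Pi.sub_apply, map_sub]
    abel⟩

theorem mul (hg : IsSchattenPath p m g) (hk : IsSchattenPath p n k) :
    IsSchattenPath p (m * n) fun t => g t * k t := by
  obtain ⟨x, hx, e⟩ := hg
  obtain ⟨y, hy, e'⟩ := hk
  obtain ⟨l, hl⟩ := Schatten.exists_mulLeft (p := p) m
  obtain ⟨r, hr⟩ := Schatten.exists_mulRight (p := p) n
  refine ⟨(fun t => l (y t)) + (fun t => r (x t)) + x * y,
    add_mem (add_mem (clm_comp_mem_flatSmooth l hy) (clm_comp_mem_flatSmooth r hx))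
      (mul_mem hx hy), fun t => ?_⟩
  dsimp only
  rw [e, e', Pi.add_apply, Pi.add_apply, Pi.mul_apply, map_add, map_add, map_mul, hl, hr, add_mul,
    mul_add, mul_add]
  abel

end IsSchattenPath

/-- The element `ε (1 - G²) + P G + P^⊥ G (2 - G²)`, where `ε = 2 P - 1`. -/
def involutionOf (P G : E →L[ℂ] E) : E →L[ℂ] E :=
  (P + P - 1) * (1 - G * G) + P * G + (1 - P) * G * (2 - G * G)

theorem involutionOf_mul_self {P G : E →L[ℂ] E} (h1 : P * P = P) (h2 : G * P = G - P * G) :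
    involutionOf P G * involutionOf P G = 1 := by
  have h3 : ∀ x, P * (P * x) = P * x := fun x => by rw [← mul_assoc, h1]
  have h4 : ∀ x, G * (P * x) = G * x - P * (G * x) := fun x => by
    rw [← mul_assoc, h2, sub_mul, mul_assoc]
  rw [involutionOf, ← one_add_one_eq_two]
  simp only [mul_add, add_mul, mul_sub, sub_mul, mul_assoc, mul_one, one_mul, h1, h2, h3, h4]
  abel

/-- Let `T` and `S` be generalised inverses of each other, where `S` leads from the range of the
idempotent `q'`, which is orthogonal to `P`, to that of `P`, and `T` leads back, and let `R` act on
a complement of `q'` and `S T`. Then conjugation by the involution of `T + S + R` moves the part `T S` of `q'` to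
`S T`, and fixes the remaining part `q' - T S`. -/
theorem involutionOf_conj {P q' T S R : E →L[ℂ] E}
    (hPq' : P * q' = 0) (hq'P : q' * P = 0) (hq' : q' * q' = q')
    (hPS : P * S = S) (hq'T : q' * T = T) (hTq' : T * q' = 0) (hSq' : S * q' = S)
    (hq'S : q' * S = 0) (hRS : R * S = 0) (hRq' : R * q' = 0) (hq'R : q' * R = 0)
    (hTR : T * R = 0)
    (hTST : T * S * T = T) (hSTS : S * T * S = S) :
    involutionOf P (T + S + R) * q' * involutionOf P (T + S + R) = S * T + (q' - T * S) := by
  set G := T + S + R with hG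
  have hTT : T * T = 0 := by
    nth_rewrite 2 [← hq'T]
    rw [← mul_assoc, hTq', zero_mul]
  have hSS : S * S = 0 := by
    nth_rewrite 1 [← hSq']
    rw [mul_assoc, hq'S, mul_zero]
  have h1 : G * q' = S := by rw [hG, add_mul, add_mul, hTq', hSq', hRq']; abel
  have h2 : G * S = T * S := by rw [hG, add_mul, add_mul, hSS, hRS]; abel
  have h3 : q' * G = T := by rw [hG, mul_add, mul_add, hq'T, hq'S, hq'R]; abel
  have h4 : T * G = T * S := by rw [hG, mul_add, mul_add, hTT, hTR]; abel
  have hl : involutionOf P G * q' = S - (q' - T * S) := by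
    have h5 : G * (T * S) = S := by
      rw [hG, add_mul, add_mul, ← mul_assoc, hTT, zero_mul, ← mul_assoc, hSTS, ← hq'T,
        mul_assoc q', ← mul_assoc R, hRq', zero_mul]
      abel
    have h6 : P * (T * S) = 0 := by
      rw [← hq'T, mul_assoc, ← mul_assoc, hPq', zero_mul]
    rw [involutionOf, ← one_add_one_eq_two]
    simp only [add_mul, sub_mul, mul_sub, mul_add, mul_assoc, one_mul, mul_one, h1, h2, hPq', h5,
      h6, hPS]
    abel
  have hr : q' * involutionOf P G = T - (q' - T * S) := by
    have h5 : T * (S * G) = T := by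
      rw [← mul_assoc, hG, mul_add, mul_add, hTST, mul_assoc T S S, hSS, mul_zero,
        ← hSq', ← mul_assoc, mul_assoc (T * S), hq'R, mul_zero, add_zero, add_zero]
    have h7 : ∀ x, q' * (P * x) = 0 := fun x => by rw [← mul_assoc, hq'P, zero_mul]
    have h8 : ∀ x, q' * (G * x) = T * x := fun x => by rw [← mul_assoc, h3]
    have h9 : ∀ x, T * (G * x) = T * (S * x) := fun x => by
      rw [← mul_assoc, h4, mul_assoc]
    rw [involutionOf, ← one_add_one_eq_two]
    simp only [add_mul, sub_mul, mul_sub, mul_add, mul_assoc, one_mul, mul_one, h7, h8, h9, h3,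
      h4, hq'P, h5]
    abel
  have hc : involutionOf P G * q' * involutionOf P G =
      (involutionOf P G * q') * (q' * involutionOf P G) := by
    rw [mul_assoc, mul_assoc, ← mul_assoc q' q', hq']
  have h10 : S * (q' - T * S) = 0 := by rw [mul_sub, hSq', ← mul_assoc, hSTS, sub_self]
  have h11 : (q' - T * S) * T = 0 := by rw [sub_mul, hq'T, hTST, sub_self]
  have h12 : (q' - T * S) * (q' - T * S) = q' - T * S := by
    rw [mul_sub (q' - T * S) q', ← mul_assoc (q' - T * S), h11, zero_mul, sub_zero, sub_mul, hq',
      mul_assoc, hSq']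
  rw [hc, hl, hr, sub_mul, mul_sub S T, mul_sub (q' - T * S) T, h10, h11, h12]
  abel

end Deformation

section Assembly

variable {E : Type} [NormedAddCommGroup E] [InnerProductSpace ℂ E] [CompleteSpace E] {p : ℝ}
  [hp : Fact (1 ≤ p)] (K : LCKasparovModule ℂ (Schatten p E) (E →L[ℂ] E) (Schatten.incl p E))

namespace LCKasparovModule

open LCQuasihom

set_option maxHeartbeats 1000000 in
/-- The second idempotent of the quasihomomorphism of `K` is joined, in the algebra `D_α`, to
`P φ(1) - r + r'`, where `r` and `r'` are finite rank idempotents whose ranks are the dimensions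
of kernel and cokernel of the Fredholm operator. -/
theorem exists_path : ∃ (r r' : Schatten p E) (g : unitInterval → K.Qh.D), g ∈ flatSmooth K.Qh.D ∧
    (∀ t, g t * g t = g t) ∧ g 0 = D.secβ K.Qh 1 ∧
    g 1 = D.secα K.Qh 1 - D.inc K.Qh r + D.inc K.Qh r' ∧
    r * r = r ∧ r' * r' = r' ∧
    D.inc K.Qh r * D.secα K.Qh 1 = D.inc K.Qh r ∧ D.secα K.Qh 1 * D.inc K.Qh r = D.inc K.Qh r ∧
    D.inc K.Qh r' * (D.secα K.Qh 1 - D.inc K.Qh r) = 0 ∧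
    (D.secα K.Qh 1 - D.inc K.Qh r) * D.inc K.Qh r' = 0 ∧
    (Schatten.incl p E r).toLinearMap.HasFiniteRange ∧
    (Schatten.incl p E r').toLinearMap.HasFiniteRange ∧
    (Module.finrank ℂ (Schatten.incl p E r).range : ℤ) -
      Module.finrank ℂ (Schatten.incl p E r').range = fredholmIndex K.oddPart := by
  obtain ⟨S, hqS, hSq', hTST, hSTS, hfin, hfin', hindex⟩ := K.exists_generalizedInverse
  have hP := K.P_sq
  have hq := K.Pφ_idem
  have hq'2 := K.Pperpφ_idem
  have he := K.even_defect_mem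
  have ho := K.odd_defect_mem
  have hPq : K.P * (K.P * K.φ 1) = K.P * K.φ 1 := K.P_mul_P_mul _
  have hPq' : K.P * (K.Pperp * K.φ 1) = 0 := by
    simp only [Pperp, sub_mul, mul_sub, one_mul, P_mul_P_mul, sub_self]
  have hq'P : K.Pperp * K.φ 1 * K.P = 0 := by
    simp only [Pperp, sub_mul, one_mul, mul_assoc, φ_mul_P, P_mul_P_mul, sub_self]
  have hqP : K.P * K.φ 1 * K.P = K.P * K.φ 1 := by
    simp only [mul_assoc, φ_mul_P, P_mul_P_mul]
  have hqq' : K.P * K.φ 1 * (K.Pperp * K.φ 1) = 0 := by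
    simp only [Pperp, mul_assoc, sub_mul, mul_sub, one_mul, P_mul_P_mul, φ_mul_P_mul,
      φ_one_mul_self, sub_self]
  have hq'q : K.Pperp * K.φ 1 * (K.P * K.φ 1) = 0 := by
    rw [← mul_assoc, hq'P, zero_mul]
  have hφq : K.φ 1 * (K.P * K.φ 1) = K.P * K.φ 1 := by
    rw [φ_mul_P_mul, φ_one_mul_self]
  have hqφ : K.P * K.φ 1 * K.φ 1 = K.P * K.φ 1 := by rw [mul_assoc, φ_one_mul_self]
  have hφq' : K.φ 1 * (K.Pperp * K.φ 1) = K.Pperp * K.φ 1 := by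
    simp only [Pperp, sub_mul, mul_sub, one_mul, φ_mul_P_mul, φ_one_mul_self]
  have hq'φ : K.Pperp * K.φ 1 * K.φ 1 = K.Pperp * K.φ 1 := by rw [mul_assoc, φ_one_mul_self]
  -- The part of `F` on the complement of `φ(1)`, and the difference of `F` and its diagonal part.
  set R := (1 - K.φ 1) * K.F * (1 - K.φ 1) with hR
  have hcm := K.commutator_mem
  set c := K.φ 1 * K.F - K.F * K.φ 1 with hc
  have hRP : R * K.P = R - K.P * R := by
    rw [hR]
    simp only [mul_assoc, sub_mul, mul_sub, one_mul, mul_one, φ_mul_P, φ_mul_P_mul, F_mul_P,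
      F_mul_P_mul]
    abel
  have hFdec : K.F = K.Pperp * K.φ 1 * K.F * (K.P * K.φ 1) +
      K.P * K.φ 1 * K.F * (K.Pperp * K.φ 1) + R + (c * (1 - K.φ 1) - (1 - K.φ 1) * c) := by
    rw [hR, hc]
    simp only [Pperp, mul_assoc, sub_mul, mul_sub, one_mul, mul_one, φ_mul_P_mul,
      F_mul_P_mul, P_mul_P_mul, φ_one_mul_self, φ_one_mul_mul]
    abel
  set q := K.P * K.φ 1 with hqdef
  set q' := K.Pperp * K.φ 1 with hq'def
  set T := q' * K.F * q with hT
  set S₀ := q * K.F * q' with hS₀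
  -- From here on only the algebraic relations between these elements matter.
  clear_value T S₀ R c q q'
  have hRq : R * q = 0 := by rw [hR, mul_assoc, sub_mul 1 (K.φ 1) q, one_mul, hφq, sub_self, mul_zero]
  have hRq' : R * q' = 0 := by rw [hR, mul_assoc, sub_mul 1 (K.φ 1) q', one_mul, hφq', sub_self, mul_zero]
  have hqR : q * R = 0 := by
    rw [hR, ← mul_assoc, ← mul_assoc, mul_sub q 1, mul_one, hqφ, sub_self, zero_mul, zero_mul]
  have hq'R : q' * R = 0 := by
    rw [hR, ← mul_assoc, ← mul_assoc, mul_sub q' 1, mul_one, hq'φ, sub_self, zero_mul, zero_mul]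
  have hq'T : q' * T = T := by rw [hT, ← mul_assoc, ← mul_assoc, hq'2]
  have hTq : T * q = T := by rw [hT, mul_assoc, hq]
  have hTq' : T * q' = 0 := by rw [hT, mul_assoc, hqq', mul_zero]
  have hTP : T * K.P = T := by rw [hT, mul_assoc, hqP]
  have hPT : K.P * T = 0 := by rw [← hq'T, ← mul_assoc, hPq', zero_mul]
  have hPS : K.P * S = S := by rw [← hqS, ← mul_assoc, hPq]
  have hSP : S * K.P = 0 := by rw [← hSq', mul_assoc, hq'P, mul_zero]
  have hq'S : q' * S = 0 := by rw [← hqS, ← mul_assoc, hq'q, zero_mul]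
  have hRS : R * S = 0 := by rw [← hqS, ← mul_assoc, hRq, zero_mul]
  have hTR : T * R = 0 := by rw [hT, mul_assoc, hqR, mul_zero]
  have hTT : T * T = 0 := by
    nth_rewrite 2 [← hq'T]
    rw [← mul_assoc, hTq', zero_mul]
  have hSS : S * S = 0 := by
    nth_rewrite 1 [← hSq']
    rw [mul_assoc, hq'S, mul_zero]
  have he' : q - S₀ * T ∈ Set.range (Schatten.incl p E) := by
    have : q - q * K.F * (q' * K.F) * q = q - S₀ * T := by
      rw [hS₀, hT, ← mul_assoc (q * K.F * q'), ← mul_assoc (q * K.F * q'), mul_assoc (q * K.F) q' q',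
        hq'2, ← mul_assoc (q * K.F)]
    rwa [← this]
  have ho' : q' - T * S₀ ∈ Set.range (Schatten.incl p E) := by
    have : q' - q' * K.F * (q * K.F) * q' = q' - T * S₀ := by
      rw [hS₀, hT, ← mul_assoc (q' * K.F * q), ← mul_assoc (q' * K.F * q), mul_assoc (q' * K.F) q q,
        hq, ← mul_assoc (q' * K.F)]
    rwa [← this]
  -- As `T` kills `q - S T`, an inverse of `T` modulo the Schatten class forces `q - S T` into it.
  obtain ⟨r, hr⟩ : q - S * T ∈ Set.range (Schatten.incl p E) := by
    have h : T * (q - S * T) = 0 := by rw [mul_sub, hTq, ← mul_assoc, hTST, sub_self]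
    have h' : q * (q - S * T) = q - S * T := by rw [mul_sub, hq, ← mul_assoc, hqS]
    have : (q - S₀ * T) * (q - S * T) = q - S * T := by
      rw [sub_mul, mul_assoc, h, mul_zero, sub_zero, h']
    rw [← this]
    exact Schatten.mul_mem_range_right _ he'
  obtain ⟨r', hr'⟩ : q' - T * S ∈ Set.range (Schatten.incl p E) := by
    have h : (q' - T * S) * T = 0 := by rw [sub_mul, hq'T, hTST, sub_self]
    have h' : (q' - T * S) * q' = q' - T * S := by rw [sub_mul, hq'2, mul_assoc, hSq']
    have : (q' - T * S) * (q' - T * S₀) = q' - T * S := by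
      rw [mul_sub (q' - T * S), ← mul_assoc (q' - T * S), h, zero_mul, sub_zero, h']
    rw [← this]
    exact Schatten.mul_mem_range_left _ ho'
  have hSS₀ : S - S₀ ∈ Set.range (Schatten.incl p E) := by
    have : S - S₀ = S * (q' - T * S₀) - (q - S * T) * S₀ := by
      have hqS₀ : q * S₀ = S₀ := by rw [hS₀, ← mul_assoc, ← mul_assoc, hq]
      rw [mul_sub, sub_mul, hSq', hqS₀, ← mul_assoc]
      abel
    rw [this]
    exact Schatten.sub_mem_range (Schatten.mul_mem_range_left _ ho')
      (Schatten.mul_mem_range_right _ ⟨r, hr⟩)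
  set G := T + S + R with hG
  obtain ⟨d, hd⟩ : G - K.F ∈ Set.range (Schatten.incl p E) := by
    have : G - K.F = S - S₀ - (c * (1 - K.φ 1) - (1 - K.φ 1) * c) := by
      nth_rewrite 1 [hFdec]
      rw [hG]
      abel
    rw [this]
    exact Schatten.sub_mem_range hSS₀ (Schatten.sub_mem_range
      (Schatten.mul_mem_range_right _ hcm)
      (Schatten.mul_mem_range_left _ hcm))
  have hGP : G * K.P = G - K.P * G := by
    rw [hG, add_mul, add_mul, mul_add, mul_add, hTP, hSP, hRP, hPT, hPS]
    abel
  -- The path from `F` to the perturbation `G`.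
  let Ft : unitInterval → E →L[ℂ] E := fun t => K.F + (Real.smoothTransition t : ℂ) • (G - K.F)
  have hFtP : ∀ t, Ft t * K.P = Ft t - K.P * Ft t := fun t => by
    simp only [Ft, add_mul, mul_add, smul_mul_assoc, mul_smul_comm, sub_mul, mul_sub, hGP,
      K.F_mul_P]
    module
  have hFt : IsSchattenPath p K.F Ft :=
    ⟨_, smoothTransition_smul_mem_flatSmooth d, fun t => by rw [map_smul, hd]⟩
  have hWt : IsSchattenPath p K.W fun t => involutionOf K.P (Ft t) := by
    rw [K.W_eq]
    have hFF := (IsSchattenPath.const (p := p) (1 : E →L[ℂ] E)).sub (hFt.mul hFt)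
    have hFF' := (IsSchattenPath.const (p := p) (2 : E →L[ℂ] E)).sub (hFt.mul hFt)
    exact (((IsSchattenPath.const (K.P + K.P - 1)).mul hFF).add
      ((IsSchattenPath.const K.P).mul hFt)).add
        (((IsSchattenPath.const (1 - K.P)).mul hFt).mul hFF')
  obtain ⟨h, hh, hht⟩ := (hWt.mul (IsSchattenPath.const q')).mul hWt
  have hα : D.toM (D.secα K.Qh 1) = q := by
    rw [hqdef]
    change K.P * K.φ 1 + Schatten.incl p E 0 = _
    rw [map_zero, add_zero]
  have hβ : D.toM (D.secβ K.Qh 1) = K.W * q' * K.W := by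
    rw [hq'def]
    exact D.toM_β K.Qh 1
  have hinc : ∀ x, D.toM (D.inc K.Qh x) = Schatten.incl p E x := fun x => by
    change K.Qh.α 0 + Schatten.incl p E x = _
    rw [map_zero, zero_add]
  have htoM : ∀ t, D.toM (D.secβ K.Qh 1 + D.inc K.Qh (h t)) =
      involutionOf K.P (Ft t) * q' * involutionOf K.P (Ft t) := fun t => by
    rw [D.toM_add, hβ, hinc]
    exact (hht t).symm
  have hsub : ∀ x y : K.Qh.D, D.toM (x - y) = D.toM x - D.toM y := fun x y => by
    rw [eq_sub_iff_add_eq, ← D.toM_add, sub_add_cancel]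
  have hF0 : Ft 0 = K.F := by simp [Ft]
  have hF1 : Ft 1 = G := by simp [Ft]
  have hconj := involutionOf_conj hPq' hq'P hq'2 hPS hq'T hTq' hSq' hq'S hRS hRq' hq'R hTR hTST
    hSTS
  have hSTST : S * T * (S * T) = S * T := by rw [← mul_assoc, hSTS]
  have hSTq : S * T * q = S * T := by rw [mul_assoc, hTq]
  have hqST : q * (S * T) = S * T := by rw [← mul_assoc, hqS]
  refine ⟨r, r', fun t => D.secβ K.Qh 1 + D.inc K.Qh (h t), ?_, fun t => ?_, ?_, ?_, ?_, ?_, ?_, ?_,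
    ?_, ?_, ?_, ?_, ?_⟩
  · exact add_mem (const_mem_flatSmooth _) (clm_comp_mem_flatSmooth (D.inc K.Qh).toCLM hh)
  · refine D.ext' ?_ ?_
    · change ((1 : ℂ) + 0) * (1 + 0) = 1 + 0
      norm_num
    · have hW := involutionOf_mul_self hP (hFtP t)
      rw [D.toM_mul, htoM]
      calc _ = involutionOf K.P (Ft t) * (q' * (involutionOf K.P (Ft t) *
            involutionOf K.P (Ft t)) * q') * involutionOf K.P (Ft t) := by
            simp only [mul_assoc]
        _ = _ := by rw [hW, mul_one, hq'2]
  · have h0 : h 0 = 0 := Schatten.incl_injective (by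
      have := hht 0
      dsimp only at this
      rw [hF0, involutionOf, ← K.W_eq] at this
      rw [map_zero]
      exact (left_eq_add.1 this))
    dsimp only
    rw [h0, map_zero, add_zero]
  · refine D.ext' ?_ ?_
    · change (1 : ℂ) + 0 = 1 - 0 + 0
      norm_num
    · rw [htoM, hF1, hconj, D.toM_add, hsub, hα, hinc, hinc, hr, hr']
      abel
  · refine Schatten.incl_injective ?_
    rw [map_mul, hr, sub_mul, mul_sub, mul_sub, hq, hSTST, hSTq, hqST]
    abel
  · refine Schatten.incl_injective ?_
    have h1 : q' * (T * S) = T * S := by rw [← mul_assoc, hq'T]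
    have h2 : T * S * (T * S) = T * S := by rw [← mul_assoc, hTST]
    have h3 : T * S * q' = T * S := by rw [mul_assoc, hSq']
    rw [map_mul, hr', sub_mul, mul_sub, mul_sub, hq'2, h1, h2, h3]
    abel
  · refine D.ext' (zero_mul _) ?_
    rw [D.toM_mul, hα, hinc, hr, sub_mul, hq, hSTq]
  · refine D.ext' (mul_zero _) ?_
    rw [D.toM_mul, hα, hinc, hr, mul_sub, hq, hqST]
  · refine D.ext' (zero_mul _) ?_
    rw [D.toM_mul, hsub, hα, hinc, hinc, hr, hr', D.toM_zero, sub_sub_cancel, sub_mul,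
      ← mul_assoc, hq'S, zero_mul, mul_assoc T S, ← mul_assoc S S, hSS, zero_mul, mul_zero,
      sub_zero]
  · refine D.ext' (mul_zero _) ?_
    rw [D.toM_mul, hsub, hα, hinc, hinc, hr, hr', D.toM_zero, sub_sub_cancel, mul_sub,
      mul_assoc, hTq', mul_zero, mul_assoc S T, ← mul_assoc T T, hTT, zero_mul, mul_zero,
      sub_zero]
  · rw [hr]; exact hfin
  · rw [hr']; exact hfin'
  · rw [hr, hr']; exact hindex

end LCKasparovModule

end Assembly

/-! ### The index -/

section Index

variable {E : Type} [NormedAddCommGroup E] [InnerProductSpace ℂ E] [CompleteSpace E] {p : ℝ}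
  [hp : Fact (1 ≤ p)] (K : LCKasparovModule ℂ (Schatten p E) (E →L[ℂ] E) (Schatten.incl p E))

namespace LCKasparovModule

open LCQuasihom

/-- In the algebra `D_α`, the classes of the two idempotents of the quasihomomorphism of `K` differ
by the Fredholm index times the class of a minimal projection. -/
theorem idemClass_sub_idemClass {H : LCAlg ⥤ AddCommGrpCat.{w}} (hH : SplitExact H)
    (hdi : DiffotopyInvariant H) {e : Schatten p E} (he : IsMinimalProjection e) (A : LCAlg)
    (hx : D.secα K.Qh 1 * D.secα K.Qh 1 = D.secα K.Qh 1)
    (hy : D.secβ K.Qh 1 * D.secβ K.Qh 1 = D.secβ K.Qh 1) :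
    idemClass H (D := LCAlg.of K.Qh.D) (D.secα K.Qh 1) hx A -
        idemClass H (D := LCAlg.of K.Qh.D) (D.secβ K.Qh 1) hy A =
      fredholmIndex K.oddPart • (idemClass H (D := LCAlg.of (Schatten p E)) e he.mul_self A ≫
        H.map (LCAlg.ofHom (B := (LCAlg.of K.Qh.D).tensor A)
          (ProjTensor.map (D.inc K.Qh) (LCHom.id A)))) := by
  obtain ⟨r, r', g, hg, hgi, hg0, hg1, hr, hr', hrx, hxr, hr'x, hxr', hfin, hfin', hind⟩ :=
    K.exists_path
  set x := D.secα K.Qh 1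
  set y := D.secβ K.Qh 1
  let f : LCHom (Schatten p E) K.Qh.D := D.inc K.Qh
  have hfr : f r * f r = f r := by rw [← map_mul, hr]
  have hfr' : f r' * f r' = f r' := by rw [← map_mul, hr']
  have hx0 : (x - f r) * (x - f r) = x - f r := by
    rw [sub_mul, mul_sub, mul_sub, hx, hxr, hrx, hfr]; abel
  have h1 : idemClass H (D := LCAlg.of K.Qh.D) x hx A =
      idemClass H (D := LCAlg.of K.Qh.D) (x - f r) hx0 A +
        idemClass H (D := LCAlg.of K.Qh.D) (f r) hfr A := by
    have := hH.idemClass_add (D := LCAlg.of K.Qh.D) hx0 hfr (by rw [sub_mul, hxr, hfr, sub_self])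
      (by rw [mul_sub, hrx, hfr, sub_self]) (by rw [sub_add_cancel, hx]) A
    rw [← this]
    exact idemClass_congr (D := LCAlg.of K.Qh.D) (sub_add_cancel x (f r)).symm _ _ A
  have h2 : idemClass H (D := LCAlg.of K.Qh.D) y hy A =
      idemClass H (D := LCAlg.of K.Qh.D) (x - f r) hx0 A +
        idemClass H (D := LCAlg.of K.Qh.D) (f r') hfr' A := by
    rw [← hH.idemClass_add (D := LCAlg.of K.Qh.D) hx0 hfr' hxr' hr'x (by rw [← hg1, hgi]) A]
    exact (idemClass_congr (D := LCAlg.of K.Qh.D) hg0.symm _ _ A).trans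
      ((hdi.idemClass_eq (D := LCAlg.of K.Qh.D) hg hgi A).trans
        (idemClass_congr (D := LCAlg.of K.Qh.D) hg1 _ _ A))
  rw [h1, h2, add_sub_add_left_eq_sub,
    idemClass_map (D := LCAlg.of (Schatten p E)) (D' := LCAlg.of K.Qh.D) f r hr hfr A,
    idemClass_map (D := LCAlg.of (Schatten p E)) (D' := LCAlg.of K.Qh.D) f r' hr' hfr' A,
    idemClass_eq_finrank_smul he hH hdi hr hfin A, idemClass_eq_finrank_smul he hH hdi hr' hfin' A,
    Preadditive.nsmul_comp, Preadditive.nsmul_comp, ← hind, sub_smul, natCast_zsmul, natCast_zsmul]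

end LCKasparovModule

end Index

theorem mainTheorem7 {E : Type} [NormedAddCommGroup E] [InnerProductSpace ℂ E] [CompleteSpace E]
    (p : ℝ) [Fact (1 ≤ p)]
    (K : LCKasparovModule ℂ (Schatten p E) (E →L[ℂ] E) (Schatten.incl p E))
    (H : LCAlg ⥤ AddCommGrpCat.{w}) (hH : SplitExact H) (hdi : DiffotopyInvariant H)
    (e : Schatten p E) (he : IsMinimalProjection e)
    (hst : IsStable H (J := LCAlg.of (Schatten p E)) e he.mul_self) (A : LCAlg) :
    K.oddPart.IsFredholm ∧
      K.Qh.inducedTensor (L := LCAlg.of (Schatten p E)) H hH A =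
        fredholmIndex K.oddPart • stabMap H (J := LCAlg.of (Schatten p E)) e he.mul_self A := by
  refine ⟨K.isFredholm_oddPart, ?_⟩
  let L : LCAlg := LCAlg.of (Schatten p E)
  let S : DoubleSplitExt ((LCAlg.of ℂ).tensor A) (L.tensor A) :=
    (LCQuasihom.doubleSplit (A := LCAlg.of ℂ) (B := L) K.Qh).tensor A
  have hx : LCQuasihom.D.secα K.Qh 1 * LCQuasihom.D.secα K.Qh 1 = LCQuasihom.D.secα K.Qh 1 := by
    rw [← map_mul, one_mul]
  have hy : LCQuasihom.D.secβ K.Qh 1 * LCQuasihom.D.secβ K.Qh 1 = LCQuasihom.D.secβ K.Qh 1 := by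
    rw [← map_mul, one_mul]
  have h1 : H.map A.leftUnitor.inv ≫ H.map (LCAlg.ofHom S.α) =
      idemClass H (D := LCAlg.of K.Qh.D) (LCQuasihom.D.secα K.Qh 1) hx A :=
    (idemClass_map (D := LCAlg.of ℂ) (D' := LCAlg.of K.Qh.D) (LCQuasihom.D.secα K.Qh) (1 : ℂ)
      (one_mul 1) hx A).symm
  have h2 : H.map A.leftUnitor.inv ≫ H.map (LCAlg.ofHom S.β) =
      idemClass H (D := LCAlg.of K.Qh.D) (LCQuasihom.D.secβ K.Qh 1) hy A :=
    (idemClass_map (D := LCAlg.of ℂ) (D' := LCAlg.of K.Qh.D) (LCQuasihom.D.secβ K.Qh) (1 : ℂ)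
      (one_mul 1) hy A).symm
  have h3 : H.map A.leftUnitor.inv ≫ S.induced H hH =
      fredholmIndex K.oddPart • idemClass H (D := L) e he.mul_self A := by
    have key : (H.map A.leftUnitor.inv ≫ S.induced H hH) ≫ H.map (LCAlg.ofHom S.ι) =
        (fredholmIndex K.oddPart • idemClass H (D := L) e he.mul_self A) ≫
          H.map (LCAlg.ofHom S.ι) := by
      rw [Category.assoc, S.induced_comp, Preadditive.comp_sub, h1, h2, Preadditive.zsmul_comp]
      exact K.idemClass_sub_idemClass hH hdi he A hx hy
    -- `H(ι ⊗ A)` is injective, as `ι ⊗ A` is the inclusion of a split extension.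
    ext z
    exact (hH S.ι S.π S.α S.split_α).1 (ConcreteCategory.congr_hom key z)
  have h4 : idemClass H (D := L) e he.mul_self A ≫
      H.map (LCAlg.ofHom (A := L.tensor A) (B := A.tensor L) (ProjTensor.flip L A)) =
      stabMap H (J := L) e he.mul_self A := by
    rw [idemClass, stabMap, ← H.map_comp]
    congr 1
    exact LCHom.ext fun a => ProjTensor.flipCLM_tmul e a
  change H.map A.leftUnitor.inv ≫ S.induced H hH ≫
    H.map (LCAlg.ofHom (A := L.tensor A) (B := A.tensor L) (ProjTensor.flip L A)) = _
  rw [← Category.assoc, h3, Preadditive.zsmul_comp, h4]
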